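/- Throughout, $\pi(n)$ is the set of prime divisors of a positive integer $n$, $n_\pi$ is the largest divisor $t$ of $n$ with $\pi(t)\subseteq\pi$, and $\pi(G)=\pi(|G|)$ for a finite group $G$. A subgroup $H\le G$ is a $\pi$-subgroup if $\pi(H)\subseteq\pi$, and a $\pi$-Hall subgroup, $H\in\mathrm{Hall}_\pi(G)$, if moreover no prime of $\pi$ divides $|G:H|$. We write $G\in E_\pi$ if $\mathrm{Hall}_\pi(G)\neq\varnothing$; $G\in C_\pi$ if $G\in E_\pi$ and all $\pi$-Hall subgroups of $G$ are conjugate; $G\in D_\pi$ if $G\in C_\pi$ and every $\pi$-subgroup of $G$ lies in a $\pi$-Hall subgroup. The number of $G$-conjugacy classes of $\pi$-Hall subgroups is $k_\pi(G)$. Let $\pi$ be a set of primes with $2,3\in\pi$, let $q$ be a power of an odd prime $p\notin\pi$, let $\eta\in\{+,-\}$, and let $\varepsilon\in\{1,-1\}$ be such that $q\equiv\varepsilon\pmod 4$. Let $G\simeq \mathrm{SL}_2^\eta(q)$, where $\mathrm{SL}_2^+=\mathrm{SL}_2$, $\mathrm{SL}_2^-=\mathrm{SU}_2$ (these groups are isomorphic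 to each other and to $\mathrm{Sp}_2(q)$); let $\mathrm{PGL}_2^+(q)=\mathrm{PGL}_2(q)$ and $\mathrm{PGL}_2^-(q)=\mathrm{PGU}_2(q)$, acting on $G$ by conjugation. For $H\le G$ let $\mathrm PH$ be its image in $\mathrm PG=G/Z(G)$. Then: (A) If $H\in\mathrm{Hall}_\pi(G)$, then one of the following holds: (a) $\pi\cap\pi(G)\subseteq\pi(q-\varepsilon)$, and $\mathrm PH$ is a $\pi$-Hall subgroup of a dihedral subgroup $D_{q-\varepsilon}$ of order $q-\varepsilon$ of $\mathrm PG$. All $\pi$-Hall subgroups of this type are conjugate in $G$. (b) $\pi\cap\pi(G)=\{2,3\}$, $(q^2-1)_{\{2,3\}}=24$, and $\mathrm PH\simeq\mathrm{Alt}_4$. All $\pi$-Hall subgroups of this type are conjugate in $G$. (c) $\pi\cap\pi(G)=\{2,3\}$, $(q^2-1)_{\{2,3\}}=48$, and $\mathrm PH\simeq\mathrm{Sym}_4$. The $\pi$-Hall subgroups of this type form exactly two conjugacy classes of $G$, and $\mathrm{PGL}_2^\eta(q)$ interchanges these classes. (d) $\pi\cap\pi(G)=\{2,3,5\}$, $(q^2-1)_{\{2,3,5\}}=120$,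 and $\mathrm PH\simeq\mathrm{Alt}_5$. The $\pi$-Hall subgroups of this type form exactly two conjugacy classes of $G$, and $\mathrm{PGL}_2^\eta(q)$ interchanges these classes. The assertions on conjugacy classes in (a)–(d) hold whenever the arithmetic conditions on $\pi$ and $q$ in the respective item hold. (B) Conversely, if $\pi$ and $q$ satisfy the arithmetic conditions of one of (a)–(d), then $G\in E_\pi$. (C) If $G\in E_\pi$, then $k_\pi(G)\in\{1,2,3\}$. (D) If $H\in\mathrm{Hall}_\pi(G)$, then there is a $\pi$-subgroup $K\le G$ that is not conjugate in $G$ to a subgroup of $H$. In particular $G\notin D_\pi$. (E) Every $\pi$-Hall subgroup of $\mathrm PG$ equals $\mathrm PH$ for some $H\in\mathrm{Hall}_\pi(G)$. Conversely, the complete preimage in $G$ of any $\pi$-Hall subgroup of $\mathrm PG$ is a $\pi$-Hall subgroup of $G$. -/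

import Mathlib

/-! Hall subgroups with respect to a set `π` of primes (of finite groups). -/

namespace HallPi

section Arithmetic

/-- `n_π`: the largest divisor `t` of `n` all of whose prime divisors lie in `π` (for `n ≥ 1`). -/
noncomputable def piPart (π : Set ℕ) (n : ℕ) : ℕ :=
  sSup {t : ℕ | t ∣ n ∧ ∀ r ∈ t.primeFactors, r ∈ π}

/-- For odd `q`, the sign `ε(q)` with `q ≡ ε(q) (mod 4)`. -/
def eps (q : ℕ) : ℤ := if q % 4 = 1 then 1 else -1

/-- The natural number `q - ε(q)`. -/
def qSubEps (q : ℕ) : ℕ := ((q : ℤ) - eps q).toNat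

end Arithmetic

section Groups

variable {G : Type*} [Group G]

/-- `π(G)`: the set of prime divisors of the order of `G`. -/
def primesOf (G : Type*) : Set ℕ := {r | r ∈ (Nat.card G).primeFactors}

/-- `H` is a `π`-subgroup. -/
def IsPiSubgroup (π : Set ℕ) (H : Subgroup G) : Prop :=
  ∀ r ∈ (Nat.card H).primeFactors, r ∈ π

/-- `H` is a `π`-Hall subgroup of the finite group `G`: all prime divisors of its order are in `π`,
and no prime divisor of its index is. -/
def IsHall (π : Set ℕ) (H : Subgroup G) : Prop :=
  IsPiSubgroup π H ∧ ∀ r ∈ H.index.primeFactors, r ∉ π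

/-- `H` and `K` are conjugate subgroups of `G`. -/
def ConjSub (H K : Subgroup G) : Prop :=
  ∃ g : G, K = H.map (MulAut.conj g).toMonoidHom

/-- `G ∈ E_π`. -/
def SatisfiesE (π : Set ℕ) (G : Type*) [Group G] : Prop :=
  ∃ H : Subgroup G, IsHall π H

/-- `G ∈ C_π`. -/
def SatisfiesC (π : Set ℕ) (G : Type*) [Group G] : Prop :=
  SatisfiesE π G ∧ ∀ H K : Subgroup G, IsHall π H → IsHall π K → ConjSub H K

/-- `G ∈ D_π`. -/
def SatisfiesD (π : Set ℕ) (G : Type*) [Group G] : Prop :=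
  SatisfiesC π G ∧
    ∀ K : Subgroup G, IsPiSubgroup π K → ∃ H : Subgroup G, IsHall π H ∧ K ≤ H

/-- `k_π(G)`: the number of conjugacy classes of `π`-Hall subgroups of `G`. -/
noncomputable def numHallClasses (π : Set ℕ) (G : Type*) [Group G] : ℕ :=
  Set.ncard {C : Set (Subgroup G) | ∃ H : Subgroup G, IsHall π H ∧ C = {K | ConjSub H K}}

/-- `PH`: the image of `H` in `PG = G / Z(G)`.  (For `G = SL₂` or `SU₂` the centre consists of the
scalar matrices in `G`.) -/
def proj (H : Subgroup G) : Subgroup (G ⧸ Subgroup.center G) :=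
  H.map (QuotientGroup.mk' (Subgroup.center G))

/-- `PH` is a `π`-Hall subgroup of a dihedral subgroup `D_{q-ε}` of order `q - ε` of `PG`.
(`DihedralGroup n` has order `2 * n`, and `4 ∣ q - ε`.) -/
def HallInDihedral (π : Set ℕ) (q : ℕ) (H : Subgroup G) : Prop :=
  ∃ D : Subgroup (G ⧸ Subgroup.center G),
    Nonempty (D ≃* DihedralGroup (qSubEps q / 2)) ∧
      proj H ≤ D ∧ IsHall π ((proj H).subgroupOf D)

/-- `PH ≃ X`. -/
def ProjIso (X : Type*) [Group X] (H : Subgroup G) : Prop := Nonempty (proj H ≃* X)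

/-- `π ∩ π(G) ⊆ π(q - ε)`. -/
def CondA (π : Set ℕ) (G : Type*) (q : ℕ) : Prop :=
  π ∩ primesOf G ⊆ {r | r ∈ (qSubEps q).primeFactors}

/-- `π ∩ π(G) = {2, 3}` and `(q² - 1)_{2,3} = 24`. -/
def CondB (π : Set ℕ) (G : Type*) (q : ℕ) : Prop :=
  π ∩ primesOf G = {2, 3} ∧ piPart {2, 3} (q ^ 2 - 1) = 24

/-- `π ∩ π(G) = {2, 3}` and `(q² - 1)_{2,3} = 48`. -/
def CondC (π : Set ℕ) (G : Type*) (q : ℕ) : Prop :=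
  π ∩ primesOf G = {2, 3} ∧ piPart {2, 3} (q ^ 2 - 1) = 48

/-- `π ∩ π(G) = {2, 3, 5}` and `(q² - 1)_{2,3,5} = 120`. -/
def CondD (π : Set ℕ) (G : Type*) (q : ℕ) : Prop :=
  π ∩ primesOf G = {2, 3, 5} ∧ piPart {2, 3, 5} (q ^ 2 - 1) = 120

/-- Any two `π`-Hall subgroups of type `T` are conjugate in `G`. -/
def AllConjugate (π : Set ℕ) (T : Subgroup G → Prop) : Prop :=
  ∀ H K : Subgroup G, IsHall π H → T H → IsHall π K → T K → ConjSub H K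

/-- The `π`-Hall subgroups of type `T` of `G` form exactly two conjugacy classes (represented by
`H₁` and `H₂`), and some element `g` of the subgroup `Γ` of `L` interchanges the two classes.
Here `G` is regarded as a subgroup of `L` through the embedding `ι`, and `Γ` acts on it by
conjugation. -/
def TwoClassesInterchanged {L : Type*} [Group L] (π : Set ℕ) (T : Subgroup G → Prop)
    (ι : G →* L) (Γ : Subgroup L) : Prop :=
  ∃ H₁ H₂ : Subgroup G, (IsHall π H₁ ∧ T H₁) ∧ (IsHall π H₂ ∧ T H₂) ∧ ¬ ConjSub H₁ H₂ ∧
    (∀ K : Subgroup G, (IsHall π K ∧ T K) ↔ (ConjSub H₁ K ∨ ConjSub H₂ K)) ∧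
    ∃ g ∈ Γ,
      (∃ K : Subgroup G, ConjSub H₂ K ∧ (H₁.map ι).map (MulAut.conj g).toMonoidHom = K.map ι) ∧
      (∃ K : Subgroup G, ConjSub H₁ K ∧ (H₂.map ι).map (MulAut.conj g).toMonoidHom = K.map ι)

end Groups

section Linear

open Matrix

/-- The group of `n × n` matrices over `K` preserving the standard Hermitian form
`(x, y) ↦ ∑ i, x i ^ q * y i` with `q = p ^ a`.  For `K` of order `q ^ 2` this is `GU_n(q)`. -/
def unitaryGL (n : ℕ) (K : Type*) [Field K] (p a : ℕ) [Fact p.Prime] [CharP K p] :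
    Subgroup (GL (Fin n) K) where
  carrier := {g | ((g : Matrix (Fin n) (Fin n) K).map (iterateFrobenius K p a))ᵀ *
    (g : Matrix (Fin n) (Fin n) K) = 1}
  one_mem' := by simp
  mul_mem' := by
    intro g h hg hh
    have hg' : ((g : Matrix (Fin n) (Fin n) K).map (iterateFrobenius K p a))ᵀ *
      (g : Matrix (Fin n) (Fin n) K) = 1 := hg
    have hh' : ((h : Matrix (Fin n) (Fin n) K).map (iterateFrobenius K p a))ᵀ *
      (h : Matrix (Fin n) (Fin n) K) = 1 := hh
    change (((g * h : GL (Fin n) K) : Matrix (Fin n) (Fin n) K).map (iterateFrobenius K p a))ᵀ *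
      ((g * h : GL (Fin n) K) : Matrix (Fin n) (Fin n) K) = 1
    rw [Units.val_mul, Matrix.map_mul, transpose_mul, Matrix.mul_assoc,
      ← Matrix.mul_assoc _ (g : Matrix (Fin n) (Fin n) K), hg', Matrix.one_mul, hh']
  inv_mem' := by
    intro g hg
    have hg' : ((g : Matrix (Fin n) (Fin n) K).map (iterateFrobenius K p a))ᵀ *
      (g : Matrix (Fin n) (Fin n) K) = 1 := hg
    have h1 : ((g⁻¹ : GL (Fin n) K) : Matrix (Fin n) (Fin n) K) =
        ((g : Matrix (Fin n) (Fin n) K).map (iterateFrobenius K p a))ᵀ := by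
      rw [Matrix.coe_units_inv]
      exact Matrix.inv_eq_left_inv hg'
    change (((g⁻¹ : GL (Fin n) K) : Matrix (Fin n) (Fin n) K).map (iterateFrobenius K p a))ᵀ *
      ((g⁻¹ : GL (Fin n) K) : Matrix (Fin n) (Fin n) K) = 1
    have h2 : (((g⁻¹ : GL (Fin n) K) : Matrix (Fin n) (Fin n) K).map (iterateFrobenius K p a))ᵀ *
        ((g : Matrix (Fin n) (Fin n) K).map (iterateFrobenius K p a))ᵀ = 1 := by
      rw [← transpose_mul, ← Matrix.map_mul, ← Units.val_mul, mul_inv_cancel]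
      simp
    rw [← h1] at h2
    exact h2

open Classical in
/-- `GL_n^η(q)` for a sign `η`, with `q = p ^ a`: it is `GL_n(q)` for `η = 1` (over the field `K`
of order `q`) and `GU_n(q)` for `η = -1` (over the field `K` of order `q ^ 2`). -/
noncomputable def GLEta (n : ℕ) (K : Type*) [Field K] (p a : ℕ) [Fact p.Prime] [CharP K p]
    (η : ℤˣ) : Subgroup (GL (Fin n) K) :=
  if η = 1 then ⊤ else unitaryGL n K p a

/-- `SL_n^η(q)`: the matrices of determinant `1` in `GL_n^η(q)`. -/
noncomputable def SLEta (n : ℕ) (K : Type*) [Field K] (p a : ℕ) [Fact p.Prime] [CharP K p]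
    (η : ℤˣ) : Subgroup (GL (Fin n) K) :=
  GLEta n K p a η ⊓ (Matrix.GeneralLinearGroup.det).ker

end Linear

end HallPi

namespace HallPi

/-! ### Recognition of Alt₄, Sym₄ and Alt₅ from the order and from missing element orders. -/

section AbstractGroups

variable {P : Type*} [Group P]

/-! Write h for the π-part of q² - 1. Since p ∉ π and |SL₂(q)| = q(q² - 1), a subgroup is π-Hall
exactly when its order is h, and 24 divides h. Condition (a) then reads h ∣ 2(q - ε), and (b), (c),
(d) read h = 24, 48, 120 (`HallSetup`).

Which subgroups can occur is decided by Klein's count of poles. A π-Hall subgroup H contains -1, and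
as p ∤ h its elements other than ±1 are semisimple, each fixing exactly two points of the projective
line over an algebraic closure. Counting orbits on the points so fixed (`pole_count`) leaves an
abelian subgroup of index at most 2, or |H| = 24, 48, 120 with strong limits on element orders
modulo ±1; the latter identify PH with Alt₄, Sym₄ or Alt₅ (`finite_subgroup_alternatives`).

Conjugacy is controlled by pairs I, J with I² = J² = -1 and JI = -IJ. Such a pair identifies the
Hamilton quaternions over F with the 2 × 2 matrices, the norm becoming the determinant, and any two
pairs are conjugate in GL₂ (`exists_conjGL_pair`). Each polyhedral Hall subgroup is generated by
fixed quaternions over some pair, so every polyhedral type is one GL₂-orbit. Matrices of square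
determinant act as elements of SL₂. Hence the orbit is one SL₂-class or two, according to whether
some matrix normalizing the subgroup has nonsquare determinant. Up to scalars and the tetrahedral
group, the normalizer of the quaternion group ⟨I, J⟩ consists of 1 and 1 + i, and det(1 + i) = 2.
For h = 24 the element 2 is a nonsquare, and the orbit stays one class. For h = 48 it is a square,
and for h = 120 the matrix 1 + i does not normalize the icosahedral group, so the orbit splits into
two classes fused by GL₂.

In the dihedral type H normalizes ⟨I⟩ for some I with I² = -1. All such I are conjugate in SL₂, the
centralizer of I is cyclic of order q - ε, and H meets it in a subgroup of odd index; taking a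
square root in this odd quotient aligns any two such H (`conjSub_of_isDihedralAt`).

For (D), a dihedral H contains no binary tetrahedral group, Alt₄ contains no Sym₃, and in the
two-class types a Hall subgroup of the other class serves. For (E), the centre has order 2 and 2 ∈
π. Finally SU₂ is reduced to SL₂ over the fixed field by a change of basis under which GL₂ acts
through GU₂ up to scalars (`exists_mulEquiv_SLEta`). -/

theorem card_conjugatesOf_mul_card_centralizer [Finite P] (x : P) :
    Nat.card (conjugatesOf x) * Nat.card (Subgroup.centralizer ({x} : Set P)) = Nat.card P := by
  have h := MulAction.index_stabilizer (ConjAct P) x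
  rw [← Subgroup.index_mul_card (Subgroup.centralizer ({x} : Set P))]
  have h1 : Nat.card (MulAction.stabilizer (ConjAct P) x) =
      Nat.card (Subgroup.centralizer ({x} : Set P)) :=
    congrArg (fun H : Subgroup P => Nat.card H) (ConjAct.stabilizer_eq_centralizer x)
  have h2 : (MulAction.stabilizer (ConjAct P) x).index =
      (Subgroup.centralizer ({x} : Set P)).index :=
    congrArg (fun H : Subgroup P => H.index) (ConjAct.stabilizer_eq_centralizer x)
  rw [← h2, h]
  congr 1
  rw [← Nat.card_coe_set_eq]
  refine congrArg (fun s : Set P => Nat.card s) ?_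
  ext y
  rw [ConjAct.mem_orbit_conjAct]
  exact isConj_comm

theorem commute_of_mem_centralizer_singleton {x y : P}
    (h : y ∈ Subgroup.centralizer ({x} : Set P)) : Commute x y :=
  (Subgroup.mem_centralizer_singleton_iff.1 h).symm

/-- An element of order r commuting with x would multiply with x to an element of order s r. -/
theorem not_dvd_card_centralizer [Finite P] {r s : ℕ} [Fact r.Prime] (x : P) (hx : orderOf x = s)
    (hrs : s.Coprime r) (h : ∀ y : P, orderOf y ≠ s * r) :
    ¬ r ∣ Nat.card (Subgroup.centralizer ({x} : Set P)) := by
  intro hd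
  obtain ⟨y, hy⟩ := exists_prime_orderOf_dvd_card' r hd
  have hy' : orderOf (y : P) = r := by rw [Subgroup.orderOf_coe, hy]
  refine h (x * y) ?_
  rw [(commute_of_mem_centralizer_singleton y.2).orderOf_mul_eq_mul_orderOf_of_coprime
    (by rw [hx, hy']; exact hrs), hx, hy']

theorem orderOf_dvd_card_centralizer (x : P) :
    orderOf x ∣ Nat.card (Subgroup.centralizer ({x} : Set P)) := by
  have hx : x ∈ Subgroup.centralizer ({x} : Set P) := by
    simp [Subgroup.mem_centralizer_singleton_iff]
  have := orderOf_dvd_natCard (⟨x, hx⟩ : Subgroup.centralizer ({x} : Set P))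
  rwa [Subgroup.orderOf_mk] at this

theorem card_conjugatesOf_le_of_normal [Finite P] {N : Subgroup P} [N.Normal] {x : P}
    (hx : x ∈ N) : Nat.card (conjugatesOf x) ≤ Nat.card N := by
  refine Nat.card_mono (Set.toFinite (N : Set P)) ?_
  intro y hy
  obtain ⟨c, hc⟩ := isConj_iff.1 (show IsConj x y from hy)
  rw [← hc]
  exact Subgroup.Normal.conj_mem inferInstance x hx c

theorem card_sylow_eq_of_card_eq [Finite P] {r n m : ℕ} [hr : Fact r.Prime] (S : Sylow r P)
    (h : Nat.card P = r ^ n * m) (hm : ¬ r ∣ m) : Nat.card S = r ^ n := by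
  have hm0 : m ≠ 0 := by rintro rfl; exact hm (dvd_zero _)
  rw [Sylow.card_eq_multiplicity, h, Nat.factorization_mul (pow_ne_zero _ hr.out.ne_zero) hm0]
  simp [hr.out.factorization_self, Nat.factorization_eq_zero_of_not_dvd hm]

/-- The action on the Sylow 3-subgroups. Without elements of order 6, centralizers of elements of
order 3 have order 3, so these elements have too many conjugates for a normal Sylow 3-subgroup, and
there are four. The kernel lies in a Sylow normalizer, of order 3 or 6, too small for the conjugates
of an element of order 2 or 3. -/
theorem exists_injective_perm_fin_four [Finite P] (hc : Nat.card P = 12 ∨ Nat.card P = 24)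
    (h6 : ∀ x : P, orderOf x ≠ 6) :
    ∃ f : P →* Equiv.Perm (Fin 4), Function.Injective f := by
  have : Fact (Nat.Prime 3) := ⟨by norm_num⟩
  have : Fact (Nat.Prime 2) := ⟨by norm_num⟩
  have hC3 : ∀ y : P, orderOf y = 3 →
      ¬ 2 ∣ Nat.card (Subgroup.centralizer ({y} : Set P)) := fun y hy =>
    not_dvd_card_centralizer y hy (by norm_num) h6
  have hcl : ∀ y : P, orderOf y = 3 → Nat.card P ≤ 3 * Nat.card (conjugatesOf y) := by
    intro y hy
    have h1 := card_conjugatesOf_mul_card_centralizer y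
    have h2 := hC3 y hy
    have h4 : Nat.card (Subgroup.centralizer ({y} : Set P)) ∣ 3 := by
      have h8 : (Nat.card (Subgroup.centralizer ({y} : Set P))).Coprime 8 := by
        rw [show 8 = 2 ^ 3 by norm_num]
        exact Nat.Coprime.pow_right _
          ((Nat.Prime.coprime_iff_not_dvd Nat.prime_two).2 h2).symm
      refine h8.dvd_of_dvd_mul_right (show _ ∣ 3 * 8 from ?_)
      have := Dvd.intro_left _ h1
      rcases hc with h | h <;> rw [h] at this
      · exact this.trans (by norm_num)
      · exact this
    have := Nat.le_of_dvd (by norm_num) h4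
    rw [← h1, mul_comm]
    gcongr
  have hcl2 : ∀ a : P, orderOf a = 2 → 3 ≤ Nat.card (conjugatesOf a) := by
    intro a ha
    have h1 := card_conjugatesOf_mul_card_centralizer a
    have h2 := not_dvd_card_centralizer (r := 3) a ha (by norm_num) h6
    have h4 : 3 ∣ Nat.card (conjugatesOf a) := by
      refine ((Nat.Prime.coprime_iff_not_dvd Nat.prime_three).2 h2).dvd_of_dvd_mul_right ?_
      rw [h1]; rcases hc with h | h <;> rw [h] <;> norm_num
    refine Nat.le_of_dvd ?_ h4
    rcases Nat.eq_zero_or_pos (Nat.card (conjugatesOf a)) with h | h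
    · rw [h, zero_mul] at h1; omega
    · exact h
  let Q : Sylow 3 P := default
  have hQ : Nat.card Q = 3 := by
    rcases hc with h | h
    · exact card_sylow_eq_of_card_eq (n := 1) (m := 4) Q h (by norm_num)
    · exact card_sylow_eq_of_card_eq (n := 1) (m := 8) Q h (by norm_num)
  have hQi : Q.index * 3 = Nat.card P := by
    have := Subgroup.index_mul_card Q.1
    rwa [hQ] at this
  have h3 : ∃ y ∈ Q, orderOf y = 3 := by
    obtain ⟨y, hy⟩ := exists_prime_orderOf_dvd_card' (G := Q) 3 (by rw [hQ])
    exact ⟨y, y.2, by rw [Subgroup.orderOf_coe, hy]⟩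
  obtain ⟨y, hyQ, hy⟩ := h3
  have hS4 : Nat.card (Sylow 3 P) = 4 := by
    have h1 := Sylow.card_dvd_index Q
    have h2 := card_sylow_modEq_one 3 P
    have h1' : Nat.card (Sylow 3 P) ∣ 8 := by
      rcases hc with h | h
      · have : Q.index = 4 := by omega
        rw [this] at h1; exact h1.trans (by norm_num)
      · have : Q.index = 8 := by omega
        rw [this] at h1; exact h1
    have h3 : Nat.card (Sylow 3 P) ≠ 1 := by
      intro h
      have : Subsingleton (Sylow 3 P) := (Nat.card_eq_one_iff_unique.1 h).1
      have : Q.Normal := Sylow.normal_of_subsingleton Q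
      have := card_conjugatesOf_le_of_normal (N := Q.1) hyQ
      have h5 := hcl y hy
      have : Nat.card Q.1 = 3 := hQ
      omega
    have hle := Nat.le_of_dvd (by norm_num) h1'
    generalize Nat.card (Sylow 3 P) = n at *
    interval_cases n <;> simp_all [Nat.ModEq]
  let e : Sylow 3 P ≃ Fin 4 := Finite.equivFinOfCardEq hS4
  let φ := MulAction.toPermHom P (Sylow 3 P)
  have hφ : Function.Injective φ := by
    rw [← MonoidHom.ker_eq_bot_iff, Subgroup.eq_bot_iff_card]
    set K := φ.ker with hK
    have hKN : ∀ R : Sylow 3 P, K ≤ Subgroup.normalizer (R : Set P) := by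
      intro R x hx
      have hx' : φ x R = R := by rw [MonoidHom.mem_ker.1 hx]; rfl
      exact Sylow.smul_eq_iff_mem_normalizer.1 hx'
    have hn : Nat.card (Subgroup.normalizer (Q : Set P)) * 4 = Nat.card P := by
      rw [← hS4, Sylow.card_eq_index_normalizer Q]; exact Subgroup.card_mul_index _
    have hdvd : Nat.card K ∣ 6 := by
      refine (Subgroup.card_dvd_of_le (hKN Q)).trans ?_
      rcases hc with hc | hc
      · rw [show Nat.card (Subgroup.normalizer (Q : Set P)) = 3 by omega]; norm_num
      · rw [show Nat.card (Subgroup.normalizer (Q : Set P)) = 6 by omega]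
    have hle := Nat.le_of_dvd Nat.card_pos (Subgroup.card_dvd_of_le (hKN Q))
    have hK3 : ¬ 3 ∣ Nat.card K := by
      intro h
      obtain ⟨x, hx⟩ := exists_prime_orderOf_dvd_card' 3 h
      have hx' : orderOf (x : P) = 3 := by rw [Subgroup.orderOf_coe, hx]
      have h4 := hcl x hx'
      have h5 := card_conjugatesOf_le_of_normal x.2
      omega
    have hK2 : ¬ 2 ∣ Nat.card K := by
      intro h
      obtain ⟨x, hx⟩ := exists_prime_orderOf_dvd_card' 2 h
      have hx' : orderOf (x : P) = 2 := by rw [Subgroup.orderOf_coe, hx]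
      have h4 := hcl2 x hx'
      have h5 := card_conjugatesOf_le_of_normal x.2
      have := Nat.le_of_dvd (by norm_num) hdvd
      generalize Nat.card K = m at *
      interval_cases m <;> omega
    have := Nat.le_of_dvd (by norm_num) hdvd
    have hpos : 0 < Nat.card K := Nat.card_pos
    generalize Nat.card K = m at *
    interval_cases m <;> omega
  exact ⟨(e.permCongrHom.toMonoidHom).comp φ, e.permCongrHom.injective.comp hφ⟩

/-- The action on the Sylow 2-subgroups. An involution has at least 15 conjugates and each Sylow
subgroup covers at most 3 of them, so there are 5 or 15 Sylow subgroups. The kernel again cannot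
hold a whole class of elements of order 2 or 3. -/
theorem exists_injective_perm_fin_five [Finite P] (hc : Nat.card P = 60)
    (h6 : ∀ x : P, orderOf x ≠ 6) (h10 : ∀ x : P, orderOf x ≠ 10) (h15 : ∀ x : P, orderOf x ≠ 15) :
    ∃ f : P →* Equiv.Perm (Fin 5), Function.Injective f := by
  have : Fact (Nat.Prime 3) := ⟨by norm_num⟩
  have : Fact (Nat.Prime 2) := ⟨by norm_num⟩
  have : Fact (Nat.Prime 5) := ⟨by norm_num⟩
  have hdvd : ∀ x : P, Nat.card (Subgroup.centralizer ({x} : Set P)) ∣ 60 := fun x =>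
    hc ▸ Subgroup.card_subgroup_dvd_card _
  have hC3 : ∀ y : P, orderOf y = 3 →
      Nat.card (Subgroup.centralizer ({y} : Set P)) = 3 := by
    intro y hy
    have h1 := not_dvd_card_centralizer (r := 2) y hy (by norm_num) h6
    have h2 := not_dvd_card_centralizer (r := 5) y hy (by norm_num) h15
    have h3 := orderOf_dvd_card_centralizer y
    have h5 := hdvd y
    have h7 := Nat.le_of_dvd (by norm_num) h5
    rw [hy] at h3
    generalize Nat.card (Subgroup.centralizer ({y} : Set P)) = m at *
    interval_cases m <;> omega
  have hC2 : ∀ y : P, orderOf y = 2 →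
      Nat.card (Subgroup.centralizer ({y} : Set P)) ∣ 4 := by
    intro y hy
    have h1 := not_dvd_card_centralizer (r := 3) y hy (by norm_num) h6
    have h2 := not_dvd_card_centralizer (r := 5) y hy (by norm_num) h10
    have h5 := hdvd y
    have h7 := Nat.le_of_dvd (by norm_num) h5
    generalize Nat.card (Subgroup.centralizer ({y} : Set P)) = m at *
    interval_cases m <;> omega
  have hcl3 : ∀ y : P, orderOf y = 3 → Nat.card (conjugatesOf y) = 20 := by
    intro y hy
    have h1 := card_conjugatesOf_mul_card_centralizer y
    rw [hC3 y hy] at h1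
    omega
  have hcl2 : ∀ y : P, orderOf y = 2 → 15 ≤ Nat.card (conjugatesOf y) := by
    intro y hy
    have h1 := card_conjugatesOf_mul_card_centralizer y
    have h2 := Nat.le_of_dvd (by norm_num) (hC2 y hy)
    by_contra hlt
    have : Nat.card (conjugatesOf y) ≤ 14 := by omega
    have := Nat.mul_le_mul this h2
    omega
  have hS : ∀ S : Sylow 2 P, Nat.card S = 4 := fun S =>
    card_sylow_eq_of_card_eq (n := 2) (m := 15) S hc (by norm_num)
  let S : Sylow 2 P := default
  obtain ⟨a, haS, ha⟩ : ∃ a ∈ S, orderOf a = 2 := by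
    obtain ⟨y, hy⟩ := exists_prime_orderOf_dvd_card' (G := S) 2 (by rw [hS]; norm_num)
    exact ⟨y, y.2, by rw [Subgroup.orderOf_coe, hy]⟩
  have hn : Nat.card (Sylow 2 P) * Nat.card (Subgroup.normalizer (S : Set P)) = 60 := by
    rw [Sylow.card_eq_index_normalizer S, ← hc]; exact Subgroup.index_mul_card _
  have h4n : 4 ∣ Nat.card (Subgroup.normalizer (S : Set P)) := by
    rw [← hS S]; exact Subgroup.card_dvd_of_le Subgroup.le_normalizer
  have hS5 : Nat.card (Sylow 2 P) = 5 := by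
    have hge : 5 ≤ Nat.card (Sylow 2 P) := by
      have : Nat.card (conjugatesOf a) ≤ Nat.card (Sylow 2 P) * 3 := by
        classical
        have := Fintype.ofFinite P
        have := Fintype.ofFinite (Sylow 2 P)
        have hsub : conjugatesOf a ⊆ ↑((Finset.univ : Finset (Sylow 2 P)).biUnion
            fun R => ((R : Set P).toFinset.erase 1)) := by
          intro b hb
          have hb2 : orderOf b = 2 := by
            obtain ⟨c, rfl⟩ := isConj_iff.1 (show IsConj a b from hb)
            rw [← MulAut.conj_apply, MulEquiv.orderOf_eq, ha]
          obtain ⟨R, hR⟩ := IsPGroup.exists_le_sylow (p := 2) (P := Subgroup.zpowers b)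
            (IsPGroup.of_card (n := 1) (by rw [Nat.card_zpowers, hb2, pow_one]))
          simp only [Finset.coe_biUnion, Set.mem_iUnion]
          refine ⟨R, Finset.mem_coe.2 (Finset.mem_univ _), ?_⟩
          simp only [Finset.coe_erase, Set.coe_toFinset, Set.mem_sdiff, Set.mem_singleton_iff]
          refine ⟨hR (Subgroup.mem_zpowers b), ?_⟩
          rintro rfl
          simp at hb2
        have h1 := Nat.card_mono (Finset.finite_toSet _) hsub
        refine h1.trans ?_
        rw [Nat.card_coe_set_eq, Set.ncard_coe_finset]
        rw [Nat.card_eq_fintype_card (α := Sylow 2 P)]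
        refine Finset.card_biUnion_le_card_mul _ _ _ fun R _ => ?_
        rw [Finset.card_erase_of_mem (by simp), Set.toFinset_card,
          ← Nat.card_eq_fintype_card]
        exact (congrArg (· - 1) (hS R)).le
      have := hcl2 a ha
      omega
    -- Burnside's transfer: a self-normalizing abelian Sylow 2-subgroup has a normal complement of
    -- order 15, which cannot contain the 20 conjugates of an element of order 3.
    have hne : Nat.card (Sylow 2 P) ≠ 15 := by
      intro h
      have hN : Nat.card (Subgroup.normalizer (S : Set P)) = 4 := by
        rw [h] at hn; omega
      have hcomm : Subgroup.normalizer (S : Set P) ≤ Subgroup.centralizer (S : Set P) := by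
        have : (S : Subgroup P) = Subgroup.normalizer (S : Set P) :=
          Subgroup.eq_of_le_of_card_ge Subgroup.le_normalizer (by rw [hN]; exact (hS S).ge)
        intro x hx
        rw [← this] at hx
        have hco := (IsPGroup.isMulCommutative_of_card_eq_prime_sq (p := 2) (hS S)).is_comm.comm
        intro y hy
        exact congrArg Subtype.val (hco ⟨y, hy⟩ ⟨x, hx⟩)
      have hK := (MonoidHom.ker_transferSylow_isComplement' S hcomm).card_mul_card
      rw [show Nat.card (S : Subgroup P) = 4 from hS S, hc] at hK
      have hK15 : Nat.card (MonoidHom.transferSylow S hcomm).ker = 15 := by omega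
      obtain ⟨x, hx⟩ := exists_prime_orderOf_dvd_card' 3
        (show 3 ∣ Nat.card (MonoidHom.transferSylow S hcomm).ker by rw [hK15]; norm_num)
      have h4 := hcl3 x (by rw [Subgroup.orderOf_coe, hx])
      have h5 := card_conjugatesOf_le_of_normal x.2
      omega
    have h15' : Nat.card (Sylow 2 P) ∣ 15 := by
      obtain ⟨m, hm⟩ := h4n
      rw [hm] at hn
      exact ⟨m, by linarith⟩
    have := Nat.le_of_dvd (by norm_num) h15'
    generalize Nat.card (Sylow 2 P) = m at *
    interval_cases m <;> omega
  let e : Sylow 2 P ≃ Fin 5 := Finite.equivFinOfCardEq hS5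
  let φ := MulAction.toPermHom P (Sylow 2 P)
  have hφ : Function.Injective φ := by
    rw [← MonoidHom.ker_eq_bot_iff, Subgroup.eq_bot_iff_card]
    set K := φ.ker with hK
    have hKN : K ≤ Subgroup.normalizer (S : Set P) := by
      intro x hx
      have hx' : φ x S = S := by rw [MonoidHom.mem_ker.1 hx]; rfl
      exact Sylow.smul_eq_iff_mem_normalizer.1 hx'
    have hdvd : Nat.card K ∣ 12 := by
      refine (Subgroup.card_dvd_of_le hKN).trans ?_
      rw [show Nat.card (Subgroup.normalizer (S : Set P)) = 12 by rw [hS5] at hn; omega]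
    have hle := Nat.le_of_dvd (by norm_num) hdvd
    have hK3 : ¬ 3 ∣ Nat.card K := by
      intro h
      obtain ⟨x, hx⟩ := exists_prime_orderOf_dvd_card' 3 h
      have h4 := hcl3 x (by rw [Subgroup.orderOf_coe, hx])
      have h5 := card_conjugatesOf_le_of_normal x.2
      omega
    have hK2 : ¬ 2 ∣ Nat.card K := by
      intro h
      obtain ⟨x, hx⟩ := exists_prime_orderOf_dvd_card' 2 h
      have h4 := hcl2 x (by rw [Subgroup.orderOf_coe, hx])
      have h5 := card_conjugatesOf_le_of_normal x.2
      omega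
    have hpos : 0 < Nat.card K := Nat.card_pos
    generalize Nat.card K = m at *
    interval_cases m <;> omega
  exact ⟨(e.permCongrHom.toMonoidHom).comp φ, e.permCongrHom.injective.comp hφ⟩

theorem nonempty_mulEquiv_alternatingGroup_four [Finite P] (hc : Nat.card P = 12)
    (h6 : ∀ x : P, orderOf x ≠ 6) : Nonempty (P ≃* alternatingGroup (Fin 4)) := by
  obtain ⟨f, hf⟩ := exists_injective_perm_fin_four (Or.inl hc) h6
  have hi : f.range.index = 2 := by
    have h := Subgroup.index_mul_card f.range
    rw [← Nat.card_congr (MonoidHom.ofInjective hf).toEquiv, hc, Nat.card_perm] at h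
    simp [Nat.factorial] at h
    omega
  have := Equiv.Perm.eq_alternatingGroup_of_index_eq_two hi
  exact ⟨(MonoidHom.ofInjective hf).trans (MulEquiv.subgroupCongr this)⟩

theorem nonempty_mulEquiv_perm_four [Finite P] (hc : Nat.card P = 24)
    (h6 : ∀ x : P, orderOf x ≠ 6) : Nonempty (P ≃* Equiv.Perm (Fin 4)) := by
  obtain ⟨f, hf⟩ := exists_injective_perm_fin_four (Or.inr hc) h6
  have := Fintype.ofFinite P
  refine ⟨MulEquiv.ofBijective f ((Fintype.bijective_iff_injective_and_card f).2 ⟨hf, ?_⟩)⟩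
  rw [← Nat.card_eq_fintype_card, hc, Fintype.card_perm]
  rfl

theorem nonempty_mulEquiv_alternatingGroup_five [Finite P] (hc : Nat.card P = 60)
    (h6 : ∀ x : P, orderOf x ≠ 6) (h10 : ∀ x : P, orderOf x ≠ 10) (h15 : ∀ x : P, orderOf x ≠ 15) :
    Nonempty (P ≃* alternatingGroup (Fin 5)) := by
  obtain ⟨f, hf⟩ := exists_injective_perm_fin_five hc h6 h10 h15
  have hi : f.range.index = 2 := by
    have h := Subgroup.index_mul_card f.range
    rw [← Nat.card_congr (MonoidHom.ofInjective hf).toEquiv, hc, Nat.card_perm] at h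
    simp [Nat.factorial] at h
    omega
  have := Equiv.Perm.eq_alternatingGroup_of_index_eq_two hi
  exact ⟨(MonoidHom.ofInjective hf).trans (MulEquiv.subgroupCongr this)⟩

end AbstractGroups

end HallPi


namespace HallPi

/-! ### Klein's orbit count. -/

section PoleCount

/-- With `oᵢ = h / nᵢ` the last hypothesis is 1/n₁ + 1/n₂ + 1/n₃ = 1 + 2/h. Its solutions are the
dihedral family (2, 2, n) and the triples (2, 3, 3), (2, 3, 4), (2, 3, 5); working with orbit
lengths avoids fractions. -/
theorem pole_count_arith {h n₁ n₂ n₃ o₁ o₂ o₃ : ℕ} (h₁ : o₁ * n₁ = h) (h₂ : o₂ * n₂ = h)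
    (h₃ : o₃ * n₃ = h) (hn₁ : 2 ≤ n₁) (h12 : n₁ ≤ n₂) (h23 : n₂ ≤ n₃)
    (ho : o₁ + o₂ + o₃ = h + 2) :
    o₃ ≤ 2 ∨ (h = 12 ∧ n₁ = 2 ∧ n₂ = 3 ∧ n₃ = 3) ∨ (h = 24 ∧ n₁ = 2 ∧ n₂ = 3 ∧ n₃ = 4) ∨
      (h = 60 ∧ n₁ = 2 ∧ n₂ = 3 ∧ n₃ = 5) := by
  have e1 : n₁ = 2 := by
    by_contra hne
    have a1 := Nat.mul_le_mul_left o₁ (show 3 ≤ n₁ by omega)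
    have a2 := Nat.mul_le_mul_left o₂ (show 3 ≤ n₂ by omega)
    have a3 := Nat.mul_le_mul_left o₃ (show 3 ≤ n₃ by omega)
    omega
  subst e1
  have e2 : n₂ = 2 ∨ n₂ = 3 := by
    by_contra hne
    have a2 := Nat.mul_le_mul_left o₂ (show 4 ≤ n₂ by omega)
    have a3 := Nat.mul_le_mul_left o₃ (show 4 ≤ n₃ by omega)
    omega
  rcases e2 with rfl | rfl
  · left; omega
  · have e3 : n₃ = 3 ∨ n₃ = 4 ∨ n₃ = 5 := by
      by_contra hne
      have a3 := Nat.mul_le_mul_left o₃ (show 6 ≤ n₃ by omega)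
      omega
    rcases e3 with rfl | rfl | rfl <;> omega

theorem pole_count_arith' {h : ℕ} {n o : Fin 3 → ℕ} (h₁ : ∀ i, o i * n i = h)
    (hn : ∀ i, 2 ≤ n i) (ho : o 0 + o 1 + o 2 = h + 2) :
    (∃ i, o i ≤ 2) ∨ (h = 12 ∧ ∀ i, n i = 2 ∨ n i = 3) ∨
      (h = 24 ∧ ∀ i, n i = 2 ∨ n i = 3 ∨ n i = 4) ∨
      (h = 60 ∧ ∀ i, n i = 2 ∨ n i = 3 ∨ n i = 5) := by
  have key : ∀ i j l : Fin 3, (∀ x, x = i ∨ x = j ∨ x = l) → n i ≤ n j → n j ≤ n l →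
      o i + o j + o l = h + 2 →
      (∃ i, o i ≤ 2) ∨ (h = 12 ∧ ∀ i, n i = 2 ∨ n i = 3) ∨
      (h = 24 ∧ ∀ i, n i = 2 ∨ n i = 3 ∨ n i = 4) ∨
      (h = 60 ∧ ∀ i, n i = 2 ∨ n i = 3 ∨ n i = 5) := by
    intro i j l hx hij hjl hsum
    rcases pole_count_arith (h₁ i) (h₁ j) (h₁ l) (hn i) hij hjl hsum with
      h' | ⟨a, b, c, d⟩ | ⟨a, b, c, d⟩ | ⟨a, b, c, d⟩
    · exact Or.inl ⟨l, h'⟩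
    · refine Or.inr (Or.inl ⟨a, fun x => ?_⟩)
      rcases hx x with rfl | rfl | rfl <;> simp [*]
    · refine Or.inr (Or.inr (Or.inl ⟨a, fun x => ?_⟩))
      rcases hx x with rfl | rfl | rfl <;> simp [*]
    · refine Or.inr (Or.inr (Or.inr ⟨a, fun x => ?_⟩))
      rcases hx x with rfl | rfl | rfl <;> simp [*]
  rcases le_total (n 0) (n 1) with a | a <;> rcases le_total (n 1) (n 2) with b | b <;>
    rcases le_total (n 0) (n 2) with c | c
  · exact key 0 1 2 (by decide) a b (by omega)
  · exact key 0 1 2 (by decide) a b (by omega)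
  · exact key 0 2 1 (by decide) c b (by omega)
  · exact key 2 0 1 (by decide) c a (by omega)
  · exact key 1 0 2 (by decide) a c (by omega)
  · exact key 1 2 0 (by decide) b c (by omega)
  · exact key 2 1 0 (by decide) b a (by omega)
  · exact key 2 1 0 (by decide) b a (by omega)

open MulAction in
/-- Orbit count for a finite group acting in such a way that all elements outside a subgroup of
order two have exactly two fixed points. -/
theorem pole_count {H X : Type*} [Group H] [Finite H] [MulAction H X] [Finite X] (z : H)
    (hz : z ≠ 1) (hz2 : z * z = 1) (hzX : ∀ x : X, z • x = x)
    (h2 : ∀ h : H, h ≠ 1 → h ≠ z → (fixedBy X h).ncard = 2)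
    (hX : ∀ x : X, ∃ h : H, h ≠ 1 ∧ h ≠ z ∧ h • x = x) :
    (∃ x : X, Nat.card H ≤ 2 * Nat.card (stabilizer H x)) ∨ Nat.card H = 2 ∨
      (Nat.card H = 24 ∧
        ∀ x : X, Nat.card (stabilizer H x) = 4 ∨ Nat.card (stabilizer H x) = 6) ∨
      (Nat.card H = 48 ∧
        ∀ x : X, Nat.card (stabilizer H x) = 4 ∨ Nat.card (stabilizer H x) = 6 ∨
          Nat.card (stabilizer H x) = 8) ∨
      (Nat.card H = 120 ∧
        ∀ x : X, Nat.card (stabilizer H x) = 4 ∨ Nat.card (stabilizer H x) = 6 ∨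
          Nat.card (stabilizer H x) = 10) := by
  classical
  have := Fintype.ofFinite H
  have := Fintype.ofFinite X
  have hzord : orderOf z = 2 := orderOf_eq_prime (by rw [sq, hz2]) hz
  have hstab : ∀ x : X, ∃ n, 2 ≤ n ∧ Nat.card (stabilizer H x) = 2 * n := by
    intro x
    have hzx : z ∈ stabilizer H x := hzX x
    have hd : 2 ∣ Nat.card (stabilizer H x) := by
      have := orderOf_dvd_natCard (⟨z, hzx⟩ : stabilizer H x)
      rwa [Subgroup.orderOf_mk, hzord] at this
    obtain ⟨n, hn⟩ := hd
    refine ⟨n, ?_, hn⟩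
    obtain ⟨h, hh1, hhz, hhx⟩ := hX x
    have h3 : 3 ≤ Nat.card (stabilizer H x) := by
      have hsub : (({1, z, h} : Finset H) : Set H) ⊆ (stabilizer H x : Set H) := by
        intro y hy
        simp only [Finset.coe_insert, Finset.coe_singleton, Set.mem_insert_iff,
          Set.mem_singleton_iff] at hy
        rcases hy with rfl | rfl | rfl
        · exact one_mem _
        · exact hzx
        · exact hhx
      have := Nat.card_mono (Set.toFinite _) hsub
      rw [Nat.card_coe_set_eq, Set.ncard_coe_finset, Finset.card_eq_three.2
        ⟨1, z, h, hz.symm, hh1.symm, hhz.symm, rfl⟩] at this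
      exact this
    omega
  obtain ⟨m, hm⟩ : 2 ∣ Nat.card H := hzord ▸ orderOf_dvd_natCard z
  have hmpos : 0 < m := by have : 0 < Nat.card H := Nat.card_pos; omega
  have hburn := sum_card_fixedBy_eq_card_orbits_mul_card_group H X
  set Ω := Quotient (orbitRel H X) with hΩ
  have hXsum : Nat.card X = ∑ ω : Ω, (orbit H (Quotient.out ω)).ncard := by
    rw [Nat.card_congr (selfEquivSigmaOrbits H X), Nat.card_sigma]
    rfl
  choose n hn2 hn using hstab
  have horb : ∀ x : X, (orbit H x).ncard * n x = m := by
    intro x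
    have := Subgroup.index_mul_card (stabilizer H x)
    rw [index_stabilizer, hn, hm] at this
    nlinarith
  -- The elements 1 and z fix every point, each of the other |H| - 2 elements exactly two.
  have hleft : ∑ h : H, Fintype.card (fixedBy X h) = 2 * Nat.card X + 2 * (Nat.card H - 2) := by
    have hfull : ∀ h : H, (∀ x : X, h • x = x) → Fintype.card (fixedBy X h) = Nat.card X := by
      intro h hh
      rw [Nat.card_eq_fintype_card]
      exact Fintype.card_congr ((Equiv.setCongr (Set.eq_univ_of_forall hh)).trans
        (Equiv.Set.univ X))
    rw [← Finset.add_sum_erase _ _ (Finset.mem_univ (1 : H)),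
      ← Finset.add_sum_erase _ _ (Finset.mem_erase.2 ⟨hz, Finset.mem_univ z⟩),
      hfull 1 (fun x => one_smul H x), hfull z hzX, Finset.sum_congr rfl (g := fun _ => 2),
      Finset.sum_const, Finset.card_erase_of_mem (Finset.mem_erase.2 ⟨hz, Finset.mem_univ z⟩),
      Finset.card_erase_of_mem (Finset.mem_univ _), Finset.card_univ, ← Nat.card_eq_fintype_card,
      smul_eq_mul]
    · omega
    · intro h hh
      simp only [Finset.mem_erase, Finset.mem_univ, and_true] at hh
      rw [← Nat.card_eq_fintype_card, Nat.card_coe_set_eq, h2 h hh.2 hh.1]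
  rw [hleft, hm, ← Nat.card_eq_fintype_card, ← Nat.card_eq_fintype_card, hm] at hburn
  have hr : Nat.card X + 2 * m = Nat.card Ω * m + 2 := by
    have : 2 * Nat.card X + 2 * (2 * m - 2) = 2 * (Nat.card Ω * m) := by rw [hburn]; ring
    omega
  -- Every stabilizer has order at least 4, so orbits have length at most m/2; together with the
  -- orbit count this leaves fewer than four orbits.
  have hXle : 2 * Nat.card X ≤ Nat.card Ω * m := by
    rw [hXsum, Finset.mul_sum, Nat.card_eq_fintype_card, ← smul_eq_mul, ← Finset.card_univ]
    refine Finset.sum_le_card_nsmul _ _ _ fun ω _ => ?_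
    rw [← horb (Quotient.out ω), mul_comm]
    exact Nat.mul_le_mul_left _ (hn2 _)
  have hΩ4 : Nat.card Ω < 4 := by
    by_contra h4
    have := Nat.mul_le_mul_right m (not_lt.1 h4)
    omega
  have hopos : ∀ x : X, 0 < (orbit H x).ncard := fun x =>
    Nat.pos_of_ne_zero fun h => by have := horb x; rw [h] at this; omega
  interval_cases hcard : Nat.card Ω
  · right; left; omega
  · have hne : Nonempty Ω := (Nat.card_pos_iff.1 (by omega)).1
    have hne' : Nonempty X := ⟨Quotient.out hne.some⟩
    have : 0 < Nat.card X := Nat.card_pos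
    right; left; omega
  -- With two orbits the count gives |X| = 2, so both points are fixed by all of H.
  · left
    let e : Fin 2 ≃ Ω := (Finite.equivFinOfCardEq hcard).symm
    rw [← e.sum_comp, Fin.sum_univ_two] at hXsum
    have h0 := hopos (Quotient.out (e 0))
    have h1 := hopos (Quotient.out (e 1))
    refine ⟨Quotient.out (e 0), ?_⟩
    have := horb (Quotient.out (e 0))
    rw [show (orbit H (Quotient.out (e 0))).ncard = 1 by omega] at this
    rw [hn, hm]
    omega
  · let e : Fin 3 ≃ Ω := (Finite.equivFinOfCardEq hcard).symm
    rw [← e.sum_comp, Fin.sum_univ_three] at hXsum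
    have := pole_count_arith' (h := m) (n := fun i => n (Quotient.out (e i)))
      (o := fun i => (orbit H (Quotient.out (e i))).ncard) (fun i => horb _) (fun i => hn2 _)
      (by omega)
    have hrep : ∀ x : X, ∃ i, n x = n (Quotient.out (e i)) := by
      intro x
      refine ⟨e.symm (Quotient.mk _ x), ?_⟩
      rw [Equiv.apply_symm_apply]
      have h1 := horb x
      have h2 := horb (Quotient.out (Quotient.mk (orbitRel H X) x))
      have h3 : orbit H (Quotient.out (Quotient.mk (orbitRel H X) x)) = orbit H x :=
        orbit_eq_iff.2 (Quotient.exact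
          (Quotient.out_eq (Quotient.mk (orbitRel H X) x)) : (orbitRel H X) _ _)
      rw [h3, ← h1] at h2
      exact (Nat.eq_of_mul_eq_mul_left (hopos x) h2).symm
    rcases this with ⟨i, hi⟩ | ⟨h, hi⟩ | ⟨h, hi⟩ | ⟨h, hi⟩
    · left
      refine ⟨Quotient.out (e i), ?_⟩
      rw [hn, hm, ← horb (Quotient.out (e i))]
      nlinarith
    all_goals right
    · right; left
      refine ⟨by omega, fun x => ?_⟩
      obtain ⟨i, hx⟩ := hrep x
      have := hi i
      rw [hn x, hx]; omega
    · right; right; left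
      refine ⟨by omega, fun x => ?_⟩
      obtain ⟨i, hx⟩ := hrep x
      have := hi i
      rw [hn x, hx]; omega
    · right; right; right
      refine ⟨by omega, fun x => ?_⟩
      obtain ⟨i, hx⟩ := hrep x
      have := hi i
      rw [hn x, hx]; omega

end PoleCount

end HallPi


namespace HallPi

/-! ### Fixed points of SL₂ on the projective line. -/

section ProjectiveLine

open Matrix MulAction
open scoped MatrixGroups LinearAlgebra.Projectivization

variable {F : Type*} [Field F]

/-- The inclusion of the special linear group into the ring of matrices. -/
def mat {R : Type*} [CommRing R] : SL(2, R) →* Matrix (Fin 2) (Fin 2) R where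
  toFun g := g.1
  map_one' := rfl
  map_mul' _ _ := rfl

theorem mat_injective {R : Type*} [CommRing R] :
    Function.Injective (mat : SL(2, R) → Matrix (Fin 2) (Fin 2) R) :=
  Subtype.val_injective

@[simp]
theorem det_mat {R : Type*} [CommRing R] (g : SL(2, R)) : (mat g).det = 1 :=
  g.2

@[simp]
theorem mat_neg {R : Type*} [CommRing R] (g : SL(2, R)) : mat (-g) = -mat g :=
  rfl

/-- If v and w were independent, Cramer's rule would kill every entry of A. This makes eigenspaces
of noncentral elements one-dimensional. -/
theorem exists_smul_eq_of_mulVec_eq_zero {A : Matrix (Fin 2) (Fin 2) F} (hA : A ≠ 0)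
    {v w : Fin 2 → F} (hw : w ≠ 0) (hAv : A *ᵥ v = 0) (hAw : A *ᵥ w = 0) :
    ∃ c : F, c • w = v := by
  have hv0 := congrFun hAv 0
  have hv1 := congrFun hAv 1
  have hw0 := congrFun hAw 0
  have hw1 := congrFun hAw 1
  simp only [mulVec, dotProduct, Fin.sum_univ_two, Pi.zero_apply] at hv0 hv1 hw0 hw1
  have hdet : v 0 * w 1 = v 1 * w 0 := by
    by_contra hne
    have hne' : v 0 * w 1 - v 1 * w 0 ≠ 0 := sub_ne_zero.2 hne
    apply hA
    ext i j
    have h00 : A 0 0 * (v 0 * w 1 - v 1 * w 0) = 0 := by linear_combination w 1 * hv0 - v 1 * hw0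
    have h01 : A 0 1 * (v 0 * w 1 - v 1 * w 0) = 0 := by linear_combination v 0 * hw0 - w 0 * hv0
    have h10 : A 1 0 * (v 0 * w 1 - v 1 * w 0) = 0 := by linear_combination w 1 * hv1 - v 1 * hw1
    have h11 : A 1 1 * (v 0 * w 1 - v 1 * w 0) = 0 := by linear_combination v 0 * hw1 - w 0 * hv1
    fin_cases i <;> fin_cases j <;> simp_all
  by_cases h0 : w 0 = 0
  · have h1 : w 1 ≠ 0 := by
      intro h1
      apply hw; ext i; fin_cases i <;> simp_all
    refine ⟨v 1 / w 1, ?_⟩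
    ext i; fin_cases i
    · have : v 0 = 0 := by simpa [h0, h1] using hdet
      simp [h0, this]
    · simp [h1]
  · refine ⟨v 0 / w 0, ?_⟩
    ext i; fin_cases i
    · simp [h0]
    · simp only [Pi.smul_apply, smul_eq_mul, Fin.mk_one, Fin.isValue]
      field_simp
      linear_combination hdet

theorem SL2_sq_sub_trace_mul_add_one (g : SL(2, F)) {c : F} {v : Fin 2 → F} (hv : v ≠ 0)
    (h : (mat g) *ᵥ v = c • v) : c ^ 2 - (mat g).trace * c + 1 = 0 := by
  have hdet : ((mat g) - scalar (Fin 2) c).det = 0 := by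
    refine exists_mulVec_eq_zero_iff.1 ⟨v, hv, ?_⟩
    rw [sub_mulVec, h, scalar_apply, ← smul_one_eq_diagonal, smul_mulVec, one_mulVec, sub_self]
  have h1 := det_mat g
  rw [det_fin_two] at hdet h1
  simp [trace_fin_two] at *
  linear_combination hdet - h1

theorem SL2_exists_eigenvector (g : SL(2, F)) {c : F} (hc : c ^ 2 - (mat g).trace * c + 1 = 0) :
    ∃ v : Fin 2 → F, v ≠ 0 ∧ (mat g) *ᵥ v = c • v := by
  have hdet : ((mat g) - scalar (Fin 2) c).det = 0 := by
    have h1 := det_mat g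
    rw [det_fin_two] at h1 ⊢
    simp [trace_fin_two] at *
    linear_combination hc + h1
  obtain ⟨v, hv, h⟩ := exists_mulVec_eq_zero_iff.2 hdet
  refine ⟨v, hv, ?_⟩
  rwa [sub_mulVec, scalar_apply, ← smul_one_eq_diagonal, smul_mulVec, one_mulVec, sub_eq_zero] at h

theorem SL2_smul_mk_eq_iff (g : SL(2, F)) {v : Fin 2 → F} (hv : v ≠ 0) :
    g • Projectivization.mk F v hv = Projectivization.mk F v hv ↔ ∃ c : F, (mat g) *ᵥ v = c • v := by
  rw [Projectivization.smul_mk, Projectivization.mk_eq_mk_iff']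
  exact ⟨fun ⟨c, hc⟩ => ⟨c, hc.symm⟩, fun ⟨c, hc⟩ => ⟨c, hc.symm⟩⟩

theorem SL2_eq_one_or_neg_one_of_scalar {g : SL(2, F)} {c : F}
    (h : mat g = scalar (Fin 2) c) : g = 1 ∨ g = -1 := by
  have h1 := det_mat g
  rw [h] at h1
  simp at h1
  rcases h1 with rfl | rfl
  · left; apply mat_injective; rw [h]; simp
  · right; apply mat_injective; rw [h, mat_neg, map_one, map_neg, map_one]

/-- The characteristic polynomial X² - tX + 1 has discriminant t² - 4, so there are two distinct
eigenvalues c and t - c, each with a single eigenline. -/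
theorem SL2_ncard_fixed [IsAlgClosed F] (g : SL(2, F)) (ht : (mat g).trace ^ 2 ≠ 4) :
    {x : ℙ F (Fin 2 → F) | g • x = x}.ncard = 2 := by
  obtain ⟨c, hc⟩ : ∃ c : F, c ^ 2 - (mat g).trace * c + 1 = 0 := by
    have := IsAlgClosed.exists_root (Polynomial.X ^ 2 - Polynomial.C (mat g).trace * Polynomial.X + 1)
      (by
        rw [show (Polynomial.X ^ 2 - Polynomial.C (mat g).trace * Polynomial.X + 1 : Polynomial F) =
          Polynomial.C 1 * Polynomial.X ^ 2 + Polynomial.C (-(mat g).trace) * Polynomial.X +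
          Polynomial.C 1 by simp; ring, Polynomial.degree_quadratic one_ne_zero]
        norm_num)
    obtain ⟨c, hc⟩ := this
    exact ⟨c, by simpa using hc⟩
  set t := (mat g).trace
  have hd : (t - c) ^ 2 - t * (t - c) + 1 = 0 := by linear_combination hc
  have hcd : c ≠ t - c := by
    intro h
    apply ht
    have : t = 2 * c := by linear_combination -h
    rw [this] at hc ⊢
    linear_combination -4 * hc
  obtain ⟨v, hv, hgv⟩ := SL2_exists_eigenvector g hc
  obtain ⟨w, hw, hgw⟩ := SL2_exists_eigenvector g hd
  have hset : {x : ℙ F (Fin 2 → F) | g • x = x} =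
      {Projectivization.mk F v hv, Projectivization.mk F w hw} := by
    have hker : ∀ {b : F} {u u' : Fin 2 → F}, (mat g) *ᵥ u = b • u → u' ≠ 0 → (mat g) *ᵥ u' = b • u' →
        ∃ a : F, a • u' = u := by
      intro b u u' hu hu0 hu'
      refine exists_smul_eq_of_mulVec_eq_zero (A := (mat g) - scalar (Fin 2) b) ?_ hu0 ?_ ?_
      · intro h0
        have h1 := det_mat g
        apply ht
        rw [sub_eq_zero] at h0
        change (mat g).trace ^ 2 = 4
        rw [h0] at h1 ⊢
        simp at h1 ⊢
        rcases h1 with rfl | rfl <;> norm_num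
      · rw [sub_mulVec, hu, scalar_apply, ← smul_one_eq_diagonal, smul_mulVec, one_mulVec, sub_self]
      · rw [sub_mulVec, hu', scalar_apply, ← smul_one_eq_diagonal, smul_mulVec, one_mulVec,
          sub_self]
    ext x
    induction x using Projectivization.ind with
    | h u hu =>
      rw [Set.mem_ofPred_eq, SL2_smul_mk_eq_iff, Set.mem_insert_iff, Set.mem_singleton_iff,
        Projectivization.mk_eq_mk_iff', Projectivization.mk_eq_mk_iff']
      constructor
      · rintro ⟨b, hb⟩
        have hbq := SL2_sq_sub_trace_mul_add_one g hu hb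
        have : (b - c) * (b - (t - c)) = 0 := by linear_combination hbq - hc
        rcases mul_eq_zero.1 this with h | h
        · rw [sub_eq_zero] at h; subst h
          exact Or.inl (hker hb hv hgv)
        · rw [sub_eq_zero] at h; subst h
          exact Or.inr (hker hb hw hgw)
      · rintro (⟨a, rfl⟩ | ⟨a, rfl⟩)
        · exact ⟨c, by rw [mulVec_smul, hgv, smul_comm]⟩
        · exact ⟨t - c, by rw [mulVec_smul, hgw, smul_comm]⟩
  rw [hset, Set.ncard_pair]
  rw [Ne, Projectivization.mk_eq_mk_iff']
  rintro ⟨a, rfl⟩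
  rw [mulVec_smul, hgw, smul_smul, smul_smul] at hgv
  have ha : a ≠ 0 := by rintro rfl; simp at hv
  have : (a * (t - c) - c * a) • w = 0 := by rw [sub_smul, hgv, sub_self]
  rcases smul_eq_zero.1 this with h | h
  · apply hcd
    have : a * (t - c - c) = 0 := by linear_combination h
    rcases mul_eq_zero.1 this with h | h
    · exact absurd h ha
    · linear_combination -h
  · exact hw h

end ProjectiveLine

/-! ### Poles of a subgroup and their stabilizers. -/

section PoleStabilizer

open Matrix MulAction
open scoped MatrixGroups LinearAlgebra.Projectivization

variable {F : Type*} [Field F]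

/-- The points of the projective line fixed by a non-central element of `H`. -/
def poles (H : Subgroup SL(2, F)) : SubMulAction H (ℙ F (Fin 2 → F)) where
  carrier := {x | ∃ h ∈ H, h ≠ 1 ∧ h ≠ -1 ∧ h • x = x}
  smul_mem' := by
    rintro ⟨g, hg⟩ x ⟨h, hh, h1, h2, hx⟩
    refine ⟨g * h * g⁻¹, H.mul_mem (H.mul_mem hg hh) (H.inv_mem hg), ?_, ?_, ?_⟩
    · intro h'; apply h1
      rw [mul_inv_eq_one] at h'
      exact mul_eq_left.1 h'
    · intro h'; apply h2
      rw [mul_inv_eq_iff_eq_mul] at h'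
      have : g * h = g * -1 := by rw [h']; simp
      exact mul_left_cancel this
    · change (g * h * g⁻¹) • g • x = g • x
      rw [smul_smul, mul_assoc, inv_mul_cancel, mul_one, mul_smul, hx]

theorem SL2_neg_one_smul (x : ℙ F (Fin 2 → F)) : (-1 : SL(2, F)) • x = x := by
  induction x using Projectivization.ind with
  | h u hu =>
    rw [SL2_smul_mk_eq_iff]
    exact ⟨-1, by rw [mat_neg, map_one, neg_mulVec, one_mulVec, neg_smul, one_smul]⟩

theorem finite_poles [IsAlgClosed F] (H : Subgroup SL(2, F)) [Finite H]
    (hH : ∀ h ∈ H, (mat h).trace ^ 2 = 4 → h = 1 ∨ h = -1) : Finite (poles H) := by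
  have : ((poles H : Set (ℙ F (Fin 2 → F)))) ⊆
      ⋃ h ∈ {h : SL(2, F) | h ∈ H ∧ h ≠ 1 ∧ h ≠ -1}, {x | h • x = x} := by
    rintro x ⟨h, hh, h1, h2, hx⟩
    simp only [Set.mem_iUnion]
    exact ⟨h, ⟨hh, h1, h2⟩, hx⟩
  refine Set.Finite.subset (Set.Finite.biUnion ?_ ?_) this
  · exact (Set.toFinite (H : Set SL(2, F))).subset fun h hh => hh.1
  · rintro h ⟨hh, h1, h2⟩
    refine Set.finite_of_ncard_ne_zero ?_
    rw [SL2_ncard_fixed h fun h4 => ?_]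
    · norm_num
    · rcases hH h hh h4 with h' | h' <;> contradiction

/-- The commutator fixes a vector spanning x, so its trace is 2. The trace hypothesis, which
excludes nontrivial elements that are unipotent up to sign, makes it ±1, and -1 fixes no nonzero
vector. -/
theorem commute_of_smul_eq {H : Subgroup SL(2, F)}
    (h2 : (2 : F) ≠ 0) (hH : ∀ h ∈ H, (mat h).trace ^ 2 = 4 → h = 1 ∨ h = -1)
    {x : ℙ F (Fin 2 → F)} {a b : SL(2, F)} (ha : a ∈ H) (hb : b ∈ H) (hax : a • x = x)
    (hbx : b • x = x) : a * b = b * a := by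
  induction x using Projectivization.ind with
  | h u hu =>
    rw [SL2_smul_mk_eq_iff] at hax hbx
    obtain ⟨α, hα⟩ := hax
    obtain ⟨β, hβ⟩ := hbx
    set g : SL(2, F) := (b * a)⁻¹ * (a * b)
    have h1 : mat (a * b) *ᵥ u = mat (b * a) *ᵥ u := by
      rw [map_mul, map_mul, ← mulVec_mulVec, ← mulVec_mulVec,
        hα, hβ, mulVec_smul, mulVec_smul, hα, hβ, smul_comm]
    have hgu : (mat g) *ᵥ u = (1 : F) • u := by
      rw [map_mul, ← mulVec_mulVec, h1, mulVec_mulVec,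
        ← map_mul, inv_mul_cancel]
      simp
    have ht := SL2_sq_sub_trace_mul_add_one g hu hgu
    have ht2 : (mat g).trace = 2 := by linear_combination -ht
    rcases hH g (H.mul_mem (H.inv_mem (H.mul_mem hb ha)) (H.mul_mem ha hb))
      (by rw [ht2]; norm_num) with h | h
    · exact (inv_mul_eq_one.1 h).symm
    · exfalso
      rw [h, mat_neg, map_one, neg_mulVec, one_mulVec, one_smul] at hgu
      apply hu
      have : (2 : F) • u = 0 := by
        rw [two_smul]; nth_rewrite 1 [← hgu]; simp
      exact (smul_eq_zero.1 this).resolve_left h2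

end PoleStabilizer

end HallPi


namespace HallPi

/-! ### Finite subgroups of SL₂ without unipotent elements. -/

section FiniteSubgroups

open Matrix MulAction
open scoped MatrixGroups LinearAlgebra.Projectivization

variable {F : Type*} [Field F]

theorem SL2_one_ne_neg_one (h2 : (2 : F) ≠ 0) : (1 : SL(2, F)) ≠ -1 := by
  intro h
  have := congrFun (congrFun (congrArg mat h) 0) 0
  simp at this
  apply h2
  linear_combination this

/-- Lagrange's theorem in the quotient by the central subgroup {1, z}, whose order is n. -/
theorem pow_half_card_eq_one_or {S : Type*} [Group S] [Finite S] {z : S} (hz : z ≠ 1)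
    (hz2 : z * z = 1) (hc : ∀ s : S, z * s = s * z) {n : ℕ} (hn : Nat.card S = 2 * n) (s : S) :
    s ^ n = 1 ∨ s ^ n = z := by
  have hzord : orderOf z = 2 := orderOf_eq_prime (by rw [sq, hz2]) hz
  have hN : (Subgroup.zpowers z).Normal :=
    ⟨fun x hx g => by
      obtain ⟨m, rfl⟩ := hx
      have : Commute g (z ^ m) := (show Commute g z from (hc g).symm).zpow_right m
      change g * z ^ m * g⁻¹ ∈ _
      rw [this.eq, mul_inv_cancel_right]
      exact ⟨m, rfl⟩⟩
  have hi : (Subgroup.zpowers z).index = n := by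
    have := Subgroup.index_mul_card (Subgroup.zpowers z)
    rw [Nat.card_zpowers, hzord, hn] at this
    omega
  have := Subgroup.pow_index_mem (Subgroup.zpowers z) s
  classical
  rw [hi, mem_zpowers_iff_mem_range_orderOf, hzord] at this
  simpa [Finset.range_add_one, eq_comm, or_comm] using this

/-- Every element other than ±1 lies in the stabilizer of a pole, and these stabilizers are abelian.
A pole with at most two conjugates therefore gives an abelian subgroup of index at most 2; otherwise
the stabilizer orders from the pole count bound the element orders modulo ±1. -/
theorem finite_subgroup_alternatives_aux [IsAlgClosed F] (h2 : (2 : F) ≠ 0)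
    (H : Subgroup SL(2, F)) [Finite H] (hneg : -1 ∈ H)
    (hH : ∀ h ∈ H, (mat h).trace ^ 2 = 4 → h = 1 ∨ h = -1) :
    (∃ C ≤ H, (∀ a ∈ C, ∀ b ∈ C, a * b = b * a) ∧ Nat.card H ≤ 2 * Nat.card C) ∨
      (Nat.card H = 24 ∧ ∀ h ∈ H, (h ^ 2 = 1 ∨ h ^ 2 = -1) ∨ (h ^ 3 = 1 ∨ h ^ 3 = -1)) ∨
      (Nat.card H = 48 ∧ ∀ h ∈ H, (h ^ 2 = 1 ∨ h ^ 2 = -1) ∨ (h ^ 3 = 1 ∨ h ^ 3 = -1) ∨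
        (h ^ 4 = 1 ∨ h ^ 4 = -1)) ∨
      (Nat.card H = 120 ∧ ∀ h ∈ H, (h ^ 2 = 1 ∨ h ^ 2 = -1) ∨ (h ^ 3 = 1 ∨ h ^ 3 = -1) ∨
        (h ^ 5 = 1 ∨ h ^ 5 = -1)) := by
  have := finite_poles H hH
  set z : H := ⟨-1, hneg⟩ with hzdef
  have hz : z ≠ 1 := fun h => SL2_one_ne_neg_one h2 (congrArg Subtype.val h).symm
  have hz2 : z * z = 1 := Subtype.ext (by simp [hzdef])
  have hne : ∀ h : H, h ≠ 1 → h ≠ z → (mat (h : SL(2, F))).trace ^ 2 ≠ 4 := by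
    intro h h1 hz' h4
    rcases hH h h.2 h4 with h' | h'
    · exact h1 (Subtype.ext h')
    · exact hz' (Subtype.ext h')
  have hstabcomm : ∀ x : poles H, ∀ a ∈ stabilizer H x, ∀ b ∈ stabilizer H x, a * b = b * a := by
    intro x a ha b hb
    apply Subtype.ext
    exact commute_of_smul_eq h2 hH (x := x.1) a.2 b.2 (congrArg Subtype.val ha)
      (congrArg Subtype.val hb)
  have hpole : ∀ h : H, h ≠ 1 → h ≠ z → ∃ x : poles H, h • x = x := by
    intro h h1 hz'
    have hn := SL2_ncard_fixed (h : SL(2, F)) (hne h h1 hz')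
    obtain ⟨x, hx⟩ := Set.nonempty_of_ncard_ne_zero
      (s := {x : ℙ F (Fin 2 → F) | (h : SL(2, F)) • x = x}) (by rw [hn]; norm_num)
    exact ⟨⟨x, h, h.2, fun h' => h1 (Subtype.ext h'), fun h' => hz' (Subtype.ext h'), hx⟩,
      Subtype.ext hx⟩
  have hpow : ∀ x : poles H, ∀ h ∈ stabilizer H x, ∀ n, Nat.card (stabilizer H x) = 2 * n →
      (h : SL(2, F)) ^ n = 1 ∨ (h : SL(2, F)) ^ n = -1 := by
    intro x h hh n hn
    have hzs : z ∈ stabilizer H x := Subtype.ext (SL2_neg_one_smul x.1)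
    have := pow_half_card_eq_one_or (S := stabilizer H x) (z := ⟨z, hzs⟩)
      (fun h => hz (congrArg Subtype.val h)) (Subtype.ext hz2)
      (fun s => Subtype.ext (hstabcomm x z hzs s s.2)) hn ⟨h, hh⟩
    rcases this with h' | h'
    · left; exact congrArg (fun y : stabilizer H x => ((y : H) : SL(2, F))) h'
    · right; exact congrArg (fun y : stabilizer H x => ((y : H) : SL(2, F))) h'
  have key := pole_count (H := H) (X := poles H) z hz hz2
    (fun x => Subtype.ext (SL2_neg_one_smul x.1))
    (fun h h1 hz' => by
      refine Eq.trans ?_ (SL2_ncard_fixed (h : SL(2, F)) (hne h h1 hz'))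
      rw [← Set.ncard_image_of_injective _ (Subtype.val_injective (p := (· ∈ poles H)))]
      congr 1
      ext x
      constructor
      · rintro ⟨y, hy, rfl⟩
        exact congrArg Subtype.val hy
      · intro hx
        exact ⟨⟨x, h, h.2, fun h' => h1 (Subtype.ext h'), fun h' => hz' (Subtype.ext h'), hx⟩,
          Subtype.ext hx, rfl⟩)
    (fun x => by
      obtain ⟨h, hh, h1, h2, hx⟩ := x.2
      exact ⟨⟨h, hh⟩, fun h' => h1 (congrArg Subtype.val h'),
        fun h' => h2 (congrArg Subtype.val h'), Subtype.ext hx⟩)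
  have hcase : ∀ h ∈ H, (h ^ 2 = 1 ∨ h ^ 2 = -1) ∨
      ∃ x : poles H, ∃ g ∈ stabilizer H x, (g : SL(2, F)) = h := by
    intro h hh
    by_cases h1 : h = 1
    · left; left; simp [h1]
    by_cases h1' : h = -1
    · left; left; simp [h1']
    obtain ⟨x, hx⟩ := hpole ⟨h, hh⟩ (fun h' => h1 (congrArg Subtype.val h'))
      (fun h' => h1' (congrArg Subtype.val h'))
    exact Or.inr ⟨x, ⟨h, hh⟩, hx, rfl⟩
  rcases key with ⟨x, hx⟩ | h | ⟨h, hs⟩ | ⟨h, hs⟩ | ⟨h, hs⟩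
  · left
    refine ⟨(stabilizer H x).map H.subtype, ?_, ?_, ?_⟩
    · rintro _ ⟨a, -, rfl⟩; exact a.2
    · rintro _ ⟨a, ha, rfl⟩ _ ⟨b, hb, rfl⟩
      exact congrArg Subtype.val (hstabcomm x a ha b hb)
    · rwa [Subgroup.card_map_of_injective H.subtype_injective]
  · left
    exact ⟨⊥, bot_le, by simp, by simp [h]⟩
  · right; left
    refine ⟨h, fun g hg => ?_⟩
    rcases hcase g hg with h' | ⟨x, g, hgx, rfl⟩
    · exact Or.inl h'
    · rcases hs x with h' | h'
      · exact Or.inl (hpow x g hgx 2 h')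
      · exact Or.inr (hpow x g hgx 3 h')
  · right; right; left
    refine ⟨h, fun g hg => ?_⟩
    rcases hcase g hg with h' | ⟨x, g, hgx, rfl⟩
    · exact Or.inl h'
    · rcases hs x with h' | h' | h'
      · exact Or.inl (hpow x g hgx 2 h')
      · exact Or.inr (Or.inl (hpow x g hgx 3 h'))
      · exact Or.inr (Or.inr (hpow x g hgx 4 h'))
  · right; right; right
    refine ⟨h, fun g hg => ?_⟩
    rcases hcase g hg with h' | ⟨x, g, hgx, rfl⟩
    · exact Or.inl h'
    · rcases hs x with h' | h' | h'
      · exact Or.inl (hpow x g hgx 2 h')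
      · exact Or.inr (Or.inl (hpow x g hgx 3 h'))
      · exact Or.inr (Or.inr (hpow x g hgx 5 h'))

theorem SL2_mem_center_iff {g : SL(2, F)} :
    g ∈ Subgroup.center SL(2, F) ↔ g = 1 ∨ g = -1 := by
  constructor
  · intro h
    obtain ⟨r, -, hr⟩ := Matrix.SpecialLinearGroup.mem_center_iff.1 h
    exact SL2_eq_one_or_neg_one_of_scalar hr.symm
  · rintro (rfl | rfl)
    · exact one_mem _
    · rw [Subgroup.mem_center_iff]; intro h; simp

theorem SL2_mk_eq_one_iff {g : SL(2, F)} :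
    QuotientGroup.mk' (Subgroup.center SL(2, F)) g = 1 ↔ g = 1 ∨ g = -1 := by
  rw [← SL2_mem_center_iff]; exact QuotientGroup.eq_one_iff g

theorem SL2_card_proj (h2 : (2 : F) ≠ 0) {H : Subgroup SL(2, F)} (hneg : -1 ∈ H) :
    Nat.card H = 2 * Nat.card (proj H) := by
  set f := (QuotientGroup.mk' (Subgroup.center SL(2, F))).subgroupMap H
  have hf : Function.Surjective f := MonoidHom.subgroupMap_surjective _ _
  have h1 := f.ker.card_mul_index
  rw [Subgroup.index_ker, MonoidHom.range_eq_top.2 hf, Subgroup.card_top] at h1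
  rw [← h1]
  congr 1
  have hz : (⟨-1, hneg⟩ : H) ≠ 1 := fun h => SL2_one_ne_neg_one h2 (congrArg Subtype.val h).symm
  have : (f.ker : Set H) = {1, ⟨-1, hneg⟩} := by
    ext ⟨g, hg⟩
    rw [SetLike.mem_coe, MonoidHom.mem_ker, Set.mem_insert_iff, Set.mem_singleton_iff,
      Subtype.ext_iff, Subtype.ext_iff (a2 := (1 : H)), Subtype.ext_iff]
    exact SL2_mk_eq_one_iff
  change Nat.card (f.ker : Set H) = 2
  rw [this, Nat.card_coe_set_eq, Set.ncard_pair hz.symm]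

/-- The count is done over an algebraic closure and pulled back along the injective base change. The
surviving element orders in PH exclude 6 (and also 10 and 15 when |H| = 120), which is what the
recognition lemmas require. -/
theorem finite_subgroup_alternatives (h2 : (2 : F) ≠ 0)
    (H : Subgroup SL(2, F)) [Finite H] (hneg : -1 ∈ H)
    (hH : ∀ h ∈ H, (mat h).trace ^ 2 = 4 → h = 1 ∨ h = -1) :
    (∃ C ≤ H, (∀ a ∈ C, ∀ b ∈ C, a * b = b * a) ∧ Nat.card H ≤ 2 * Nat.card C) ∨
      (Nat.card H = 24 ∧ ProjIso (alternatingGroup (Fin 4)) H) ∨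
      (Nat.card H = 48 ∧ ProjIso (Equiv.Perm (Fin 4)) H) ∨
      (Nat.card H = 120 ∧ ProjIso (alternatingGroup (Fin 5)) H) := by
  set f : SL(2, F) →* SL(2, AlgebraicClosure F) :=
    SpecialLinearGroup.map (algebraMap F (AlgebraicClosure F)) with hf
  have hfmat : ∀ g, mat (f g) = (mat g).map (algebraMap F (AlgebraicClosure F)) := fun g => rfl
  have hinj : Function.Injective f := by
    intro a b h
    apply mat_injective
    have := congrArg mat h
    rw [hfmat, hfmat] at this
    exact Matrix.map_injective (algebraMap F (AlgebraicClosure F)).injective this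
  have hfneg : ∀ g, f (-g) = -f g := by
    intro g; apply mat_injective
    rw [hfmat, mat_neg, mat_neg, hfmat]
    ext i j; simp
  have h2' : (2 : AlgebraicClosure F) ≠ 0 := by
    intro h
    apply h2
    apply (algebraMap F (AlgebraicClosure F)).injective
    rw [map_ofNat, map_zero, h]
  have hcard : Nat.card (H.map f) = Nat.card H := Subgroup.card_map_of_injective hinj
  have hfin : Finite (H.map f) := Set.Finite.image f (Set.toFinite (H : Set SL(2, F)))
  have hpull : ∀ g : SL(2, F), ∀ n : ℕ, (f g ^ n = 1 ∨ f g ^ n = -1) → (g ^ n = 1 ∨ g ^ n = -1) := by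
    intro g n h
    rw [← map_pow] at h
    rcases h with h | h
    · left; exact hinj (by rw [h, map_one])
    · right; exact hinj (by rw [h, hfneg, map_one])
  have hPfin : Finite (proj H) := Set.Finite.image _ (Set.toFinite (H : Set SL(2, F)))
  have hord : ∀ n : ℕ, ∀ g : SL(2, F), (g ^ n = 1 ∨ g ^ n = -1) →
      orderOf (QuotientGroup.mk' (Subgroup.center SL(2, F)) g) ∣ n := by
    intro n g h
    apply orderOf_dvd_of_pow_eq_one
    rw [← map_pow, SL2_mk_eq_one_iff]
    exact h
  have hcp := SL2_card_proj h2 hneg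
  have key := finite_subgroup_alternatives_aux h2' (H.map f)
    ⟨-1, hneg, by rw [hfneg, map_one]⟩ (by
      rintro _ ⟨g, hg, rfl⟩ ht
      have : (mat g).trace ^ 2 = 4 := by
        apply (algebraMap F (AlgebraicClosure F)).injective
        rw [hfmat] at ht
        rw [map_ofNat, ← ht]
        simp [trace_fin_two]
      rcases hH g hg this with h | h
      · left; rw [h, map_one]
      · right; rw [h, hfneg, map_one])
  rw [hcard] at key
  have hnot : ∀ m : ℕ, ∀ x : proj H, orderOf x = m →
      ∃ g ∈ H, orderOf (QuotientGroup.mk' (Subgroup.center SL(2, F)) g) = m := by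
    rintro m ⟨x, g, hg, rfl⟩ hx
    exact ⟨g, hg, by rw [← hx]; exact (Subgroup.orderOf_mk _ _).symm⟩
  rcases key with ⟨C, hC, hcomm, hle⟩ | ⟨h, hs⟩ | ⟨h, hs⟩ | ⟨h, hs⟩
  · left
    refine ⟨C.comap f, ?_, ?_, ?_⟩
    · intro g hg
      obtain ⟨g', hg', he⟩ := hC hg
      rwa [← hinj he]
    · intro a ha b hb
      exact hinj (by rw [map_mul, map_mul, hcomm _ ha _ hb])
    · rw [← Nat.card_congr ((C.comap f).equivMapOfInjective f hinj).toEquiv.symm,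
        Subgroup.map_comap_eq, inf_eq_right.2]
      · exact hle
      · intro g hg
        obtain ⟨g', hg', he⟩ := hC hg
        exact ⟨g', he⟩
  · right; left
    refine ⟨h, nonempty_mulEquiv_alternatingGroup_four (by omega) fun x hx => ?_⟩
    obtain ⟨g, hg, ho⟩ := hnot 6 x hx
    rcases hs (f g) ⟨g, hg, rfl⟩ with h' | h'
    all_goals
      have := hord _ g (hpull g _ h')
      rw [ho] at this
      revert this; decide
  · right; right; left
    refine ⟨h, nonempty_mulEquiv_perm_four (by omega) fun x hx => ?_⟩
    obtain ⟨g, hg, ho⟩ := hnot 6 x hx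
    rcases hs (f g) ⟨g, hg, rfl⟩ with h' | h' | h'
    all_goals
      have := hord _ g (hpull g _ h')
      rw [ho] at this
      revert this; decide
  · right; right; right
    refine ⟨h, nonempty_mulEquiv_alternatingGroup_five (by omega) (fun x hx => ?_)
      (fun x hx => ?_) (fun x hx => ?_)⟩
    all_goals
      obtain ⟨g, hg, ho⟩ := hnot _ x hx
      rcases hs (f g) ⟨g, hg, rfl⟩ with h' | h' | h'
      all_goals
        have := hord _ g (hpull g _ h')
        rw [ho] at this
        revert this; decide

end FiniteSubgroups

end HallPi


namespace HallPi

/-! ### Power relations read off from traces. -/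

section Traces

open Matrix
open scoped MatrixGroups

variable {F : Type*} [Field F]

theorem mat_mul_self (g : SL(2, F)) : mat g * mat g = (mat g).trace • mat g - 1 := by
  have h := det_mat g
  rw [det_fin_two] at h
  ext i j
  fin_cases i <;> fin_cases j <;> simp [Matrix.mul_apply, trace_fin_two]
  · linear_combination -h
  · ring
  · ring
  · linear_combination -h

theorem mat_inv (g : SL(2, F)) : mat g⁻¹ = (mat g).trace • 1 - mat g := by
  have h : mat g⁻¹ = adjugate (mat g) := rfl
  rw [h, adjugate_fin_two]
  ext i j
  fin_cases i <;> fin_cases j <;> simp [trace_fin_two]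

/-- A matrix in SL₂ proportional to the identity is ±1. With Cayley–Hamilton this turns gⁿ = ±1, for
noncentral g, into a polynomial equation for the trace. -/
theorem eq_zero_of_smul_mat_eq {g : SL(2, F)} (h1 : g ≠ 1) (h2 : g ≠ -1) {a b : F}
    (h : a • mat g = b • (1 : Matrix (Fin 2) (Fin 2) F)) : a = 0 := by
  by_contra ha
  have : mat g = scalar (Fin 2) (b / a) := by
    rw [scalar_apply, ← smul_one_eq_diagonal, div_eq_inv_mul, mul_smul, ← h, smul_smul,
      inv_mul_cancel₀ ha, one_smul]
  rcases SL2_eq_one_or_neg_one_of_scalar this with h | h <;> contradiction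

theorem exists_mat_eq_smul_one {g : SL(2, F)} (h : g = 1 ∨ g = -1) :
    ∃ c : F, mat g = c • (1 : Matrix (Fin 2) (Fin 2) F) := by
  rcases h with rfl | rfl
  · exact ⟨1, by simp⟩
  · exact ⟨-1, by simp⟩

theorem mat_cube (g : SL(2, F)) :
    mat (g ^ 3) = ((mat g).trace ^ 2 - 1) • mat g - (mat g).trace • 1 := by
  rw [map_pow, pow_three, mat_mul_self, mul_sub, mul_one, mul_smul_comm, mat_mul_self]
  module

theorem mat_pow_five (g : SL(2, F)) :
    mat (g ^ 5) = ((mat g).trace ^ 4 - 3 * (mat g).trace ^ 2 + 1) • mat g -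
      ((mat g).trace ^ 3 - 2 * (mat g).trace) • 1 := by
  have h3 := mat_cube g
  rw [map_pow] at h3
  rw [map_pow, show 5 = 3 + 2 by norm_num, pow_add, h3, pow_two (mat g)]
  simp only [sub_mul, mul_sub, smul_mul_assoc, mul_smul_comm, mat_mul_self, one_mul, mul_one]
  module

theorem trace_eq_zero_of_sq {g : SL(2, F)} (h1 : g ≠ 1) (h2 : g ≠ -1)
    (h : g ^ 2 = 1 ∨ g ^ 2 = -1) : (mat g).trace = 0 := by
  obtain ⟨c, hc⟩ := exists_mat_eq_smul_one h
  rw [map_pow, sq, mat_mul_self] at hc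
  exact eq_zero_of_smul_mat_eq h1 h2 (b := c + 1) (by rw [add_smul c, one_smul, ← hc]; abel)

theorem trace_sq_eq_one_of_cube {g : SL(2, F)} (h1 : g ≠ 1) (h2 : g ≠ -1)
    (h : g ^ 3 = 1 ∨ g ^ 3 = -1) : (mat g).trace ^ 2 = 1 := by
  obtain ⟨c, hc⟩ := exists_mat_eq_smul_one h
  rw [mat_cube] at hc
  exact sub_eq_zero.1 (eq_zero_of_smul_mat_eq h1 h2 (b := c + (mat g).trace)
    (by rw [add_smul c, ← hc]; abel))

theorem trace_of_pow_five {g : SL(2, F)} (h1 : g ≠ 1) (h2 : g ≠ -1)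
    (h : g ^ 5 = 1 ∨ g ^ 5 = -1) : (mat g).trace ^ 4 - 3 * (mat g).trace ^ 2 + 1 = 0 := by
  obtain ⟨c, hc⟩ := exists_mat_eq_smul_one h
  rw [mat_pow_five] at hc
  exact eq_zero_of_smul_mat_eq h1 h2
    (b := c + ((mat g).trace ^ 3 - 2 * (mat g).trace)) (by rw [add_smul c, ← hc]; abel)

theorem mul_self_eq_neg_one_of_trace {g : SL(2, F)} (h : (mat g).trace = 0) : g * g = -1 := by
  apply mat_injective
  rw [map_mul, mat_mul_self, h, zero_smul, zero_sub, mat_neg, map_one]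

theorem trace_eq_zero_of_mul_self_eq_neg_one (hF : (2 : F) ≠ 0) {g : SL(2, F)} (h : g * g = -1) :
    (mat g).trace = 0 := by
  refine trace_eq_zero_of_sq ?_ ?_ (Or.inr (by rw [sq, h]))
  · rintro rfl
    exact SL2_one_ne_neg_one hF (by simpa using h)
  · rintro rfl
    exact SL2_one_ne_neg_one hF (by simpa using h)

end Traces

/-! ### GL₂ acting on SL₂. -/

section Conjugation

open Matrix
open scoped MatrixGroups

variable {F : Type*} [Field F]

/-- The action of the general linear group on the special linear group by conjugation. -/
def conjGL : GL (Fin 2) F →* MulAut SL(2, F) where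
  toFun u :=
    { toFun := fun g => ⟨u.1 * mat g * u⁻¹.1, by
        rw [det_mul_right_comm, ← Units.val_mul, mul_inv_cancel, Units.val_one, one_mul]
        exact g.2⟩
      invFun := fun g => ⟨u⁻¹.1 * mat g * u.1, by
        rw [det_mul_right_comm, ← Units.val_mul, inv_mul_cancel, Units.val_one, one_mul]
        exact g.2⟩
      left_inv := fun g => by
        apply mat_injective
        change u⁻¹.1 * (u.1 * mat g * u⁻¹.1) * u.1 = mat g
        simp [mul_assoc]
      right_inv := fun g => by
        apply mat_injective
        change u.1 * (u⁻¹.1 * mat g * u.1) * u⁻¹.1 = mat g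
        simp [mul_assoc]
      map_mul' := fun g h => by
        apply mat_injective
        change u.1 * mat (g * h) * u⁻¹.1 = (u.1 * mat g * u⁻¹.1) * (u.1 * mat h * u⁻¹.1)
        rw [map_mul]
        simp [mul_assoc] }
  map_one' := by
    ext1 g
    apply mat_injective
    change (1 : Matrix (Fin 2) (Fin 2) F) * mat g * ((1 : GL (Fin 2) F)⁻¹).1 = mat g
    simp
  map_mul' u v := by
    ext1 g
    apply mat_injective
    change (u * v).1 * mat g * (u * v)⁻¹.1 = u.1 * (v.1 * mat g * v⁻¹.1) * u⁻¹.1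
    simp [mul_assoc, _root_.mul_inv_rev]

theorem mat_conjGL (u : GL (Fin 2) F) (g : SL(2, F)) :
    mat (conjGL u g) = u.1 * mat g * u⁻¹.1 :=
  rfl

theorem conjGL_eq_iff {u : GL (Fin 2) F} {g h : SL(2, F)} :
    conjGL u g = h ↔ u.1 * mat g = mat h * u.1 := by
  rw [← mat_injective.eq_iff, mat_conjGL, Units.mul_inv_eq_iff_eq_mul]

theorem conjGL_neg (u : GL (Fin 2) F) (g : SL(2, F)) : conjGL u (-g) = -conjGL u g := by
  apply mat_injective
  rw [mat_conjGL, mat_neg, mat_neg, mat_conjGL]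
  simp

theorem conjGL_smul_mat {u : GL (Fin 2) F} {c : F} {g h : SL(2, F)} (hu : u.1 = c • mat g) :
    conjGL u h = g * h * g⁻¹ := by
  rw [conjGL_eq_iff, hu, mul_smul_comm, smul_mul_assoc, ← map_mul, ← map_mul]
  simp

/-- Dividing u by a square root of its determinant puts it in SL₂, and scalars act trivially. So the
determinant modulo squares is the only obstruction to passing from GL₂- to SL₂-conjugacy. -/
theorem exists_conj_eq_conjGL_of_isSquare_det {u : GL (Fin 2) F} (h : IsSquare u.1.det) :
    ∃ g : SL(2, F), conjGL u = MulAut.conj g := by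
  obtain ⟨c, hc⟩ := h
  have hdet : u.1.det ≠ 0 := by
    have := (isUnit_iff_isUnit_det u.1).1 u.isUnit
    exact this.ne_zero
  have hc0 : c ≠ 0 := by rintro rfl; simp at hc; exact hdet hc
  have hg : (c⁻¹ • u.1).det = 1 := by
    rw [det_smul, hc, Fintype.card_fin]
    field_simp
  refine ⟨⟨c⁻¹ • u.1, hg⟩, ?_⟩
  ext1 h
  refine conjGL_smul_mat (c := c) ?_
  change u.1 = c • c⁻¹ • u.1
  rw [smul_smul, mul_inv_cancel₀ hc0, one_smul]

theorem ConjSub.of_conjGL {u : GL (Fin 2) F} (h : IsSquare u.1.det) {H K : Subgroup SL(2, F)}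
    (hK : H.map (conjGL u).toMonoidHom = K) : ConjSub H K := by
  obtain ⟨g, hg⟩ := exists_conj_eq_conjGL_of_isSquare_det h
  exact ⟨g, by rw [← hK, hg]⟩

/-- The inclusion of the special linear group into the general linear group. -/
def toGL (g : SL(2, F)) : GL (Fin 2) F where
  val := mat g
  inv := mat g⁻¹
  val_inv := by rw [← map_mul]; simp
  inv_val := by rw [← map_mul]; simp

theorem conjGL_toGL (g : SL(2, F)) : conjGL (toGL g) = MulAut.conj g := by
  ext1 h
  exact conjGL_smul_mat (c := 1) (one_smul F (mat g)).symm

end Conjugation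

end HallPi


namespace HallPi

/-! ### Quaternion pairs and their conjugacy in GL₂. -/

section QuaternionPairs

open Matrix
open scoped MatrixGroups Quaternion

variable {F : Type*} [Field F]

/-- Two elements satisfying the relations of the quaternion units `i` and `j`. -/
structure IsQuatPair (I J : SL(2, F)) : Prop where
  sqI : I * I = -1
  sqJ : J * J = -1
  anti : J * I = -(I * J)

/-- The norm form of the quaternions. -/
def quatNorm (x : ℍ[F,-1,-1]) : F := x.re ^ 2 + x.imI ^ 2 + x.imJ ^ 2 + x.imK ^ 2

theorem quat_mul_star (x : ℍ[F,-1,-1]) : x * star x = ⟨quatNorm x, 0, 0, 0⟩ := by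
  ext <;> simp [quatNorm] <;> ring

namespace IsQuatPair

variable {I J : SL(2, F)}

theorem sqK (h : IsQuatPair I J) : (I * J) * (I * J) = -1 := by
  rw [mul_assoc, ← mul_assoc J, h.anti, neg_mul, mul_assoc, h.sqJ, mul_neg, mul_neg, mul_neg,
    neg_neg, mul_one, h.sqI]

/-- The algebra homomorphism from the quaternions sending `i` and `j` to the given pair. -/
noncomputable def hom (h : IsQuatPair I J) : ℍ[F,-1,-1] →ₐ[F] Matrix (Fin 2) (Fin 2) F :=
  QuaternionAlgebra.Basis.liftHom
    { i := mat I
      j := mat J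
      k := mat (I * J)
      i_mul_i := by rw [← map_mul, h.sqI]; simp
      j_mul_j := by rw [← map_mul, h.sqJ]; simp
      i_mul_j := by rw [← map_mul]
      j_mul_i := by rw [← map_mul, h.anti]; simp }

theorem hom_apply (h : IsQuatPair I J) (x : ℍ[F,-1,-1]) :
    h.hom x = x.re • 1 + x.imI • mat I + x.imJ • mat J + x.imK • mat (I * J) := by
  rw [← Algebra.algebraMap_eq_smul_one]; rfl

theorem hom_i (h : IsQuatPair I J) : h.hom ⟨0, 1, 0, 0⟩ = mat I := by simp [hom_apply]

theorem hom_j (h : IsQuatPair I J) : h.hom ⟨0, 0, 1, 0⟩ = mat J := by simp [hom_apply]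

theorem hom_k (h : IsQuatPair I J) : h.hom ⟨0, 0, 0, 1⟩ = mat (I * J) := by
  simp [hom_apply, -map_mul]

theorem trace_hom (h2 : (2 : F) ≠ 0) (h : IsQuatPair I J) (x : ℍ[F,-1,-1]) :
    (h.hom x).trace = 2 * x.re := by
  rw [hom_apply]
  simp only [trace_add, trace_smul, trace_one, trace_eq_zero_of_mul_self_eq_neg_one h2 h.sqI,
    trace_eq_zero_of_mul_self_eq_neg_one h2 h.sqJ, trace_eq_zero_of_mul_self_eq_neg_one h2 h.sqK]
  simp [mul_comm]

/-- If x maps to 0, then so does xy, and the trace formula gives re(xy) = 0 for all y; the basis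
elements y recover the coordinates of x up to sign. -/
theorem hom_injective (h2 : (2 : F) ≠ 0) (h : IsQuatPair I J) : Function.Injective h.hom := by
  rw [injective_iff_map_eq_zero]
  intro x hx
  have key : ∀ y : ℍ[F,-1,-1], (x * y).re = 0 := by
    intro y
    have := h.trace_hom h2 (x * y)
    rw [map_mul, hx, zero_mul, trace_zero] at this
    exact (mul_eq_zero.1 this.symm).resolve_left h2
  have h1 := key ⟨1, 0, 0, 0⟩
  have hi := key ⟨0, 1, 0, 0⟩
  have hj := key ⟨0, 0, 1, 0⟩
  have hk := key ⟨0, 0, 0, 1⟩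
  simp at h1 hi hj hk
  ext <;> simpa

theorem hom_surjective (h2 : (2 : F) ≠ 0) (h : IsQuatPair I J) : Function.Surjective h.hom := by
  have : Module.finrank F ℍ[F,-1,-1] = Module.finrank F (Matrix (Fin 2) (Fin 2) F) := by
    rw [QuaternionAlgebra.finrank_eq_four, Module.finrank_matrix]; simp
  exact (LinearMap.injective_iff_surjective_of_finrank_eq_finrank this
    (f := h.hom.toLinearMap)).1 (h.hom_injective h2)

/-- The adjugate is trace minus matrix, hence corresponds to quaternion conjugation, and A · adj A =
det A becomes x · x̄ = N(x). -/
theorem det_hom (h2 : (2 : F) ≠ 0) (h : IsQuatPair I J) (x : ℍ[F,-1,-1]) :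
    (h.hom x).det = quatNorm x := by
  have h1 : adjugate (h.hom x) = h.hom (star x) := by
    have : adjugate (h.hom x) = (h.hom x).trace • 1 - h.hom x := by
      rw [adjugate_fin_two]
      ext i j
      fin_cases i <;> fin_cases j <;> simp [trace_fin_two]
    rw [this, trace_hom h2, hom_apply, hom_apply]
    simp only [QuaternionAlgebra.re_star, QuaternionAlgebra.imI_star, QuaternionAlgebra.imJ_star,
      QuaternionAlgebra.imK_star]
    module
  have h3 := mul_adjugate (h.hom x)
  rw [h1, ← map_mul, quat_mul_star, hom_apply] at h3
  have := congrFun (congrFun h3 0) 0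
  simpa using this.symm

/-- The element of the special linear group given by a unit quaternion. -/
noncomputable def ofQuat (h2 : (2 : F) ≠ 0) (h : IsQuatPair I J) (x : ℍ[F,-1,-1])
    (hx : quatNorm x = 1) : SL(2, F) :=
  ⟨h.hom x, (h.det_hom h2 x).trans hx⟩

theorem mat_ofQuat (h2 : (2 : F) ≠ 0) (h : IsQuatPair I J) (x : ℍ[F,-1,-1])
    (hx : quatNorm x = 1) : mat (h.ofQuat h2 x hx) = h.hom x :=
  rfl

theorem exists_mat_eq (h2 : (2 : F) ≠ 0) (h : IsQuatPair I J) (g : SL(2, F)) :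
    ∃ x : ℍ[F,-1,-1], mat g = h.hom x ∧ quatNorm x = 1 := by
  obtain ⟨x, hx⟩ := h.hom_surjective h2 (mat g)
  exact ⟨x, hx.symm, by rw [← h.det_hom h2, hx, det_mat]⟩

theorem map_conjGL (h : IsQuatPair I J) (u : GL (Fin 2) F) :
    IsQuatPair (conjGL u I) (conjGL u J) where
  sqI := by rw [← map_mul, h.sqI, conjGL_neg, map_one]
  sqJ := by rw [← map_mul, h.sqJ, conjGL_neg, map_one]
  anti := by rw [← map_mul, h.anti, conjGL_neg, map_mul]

theorem conjGL_hom (h : IsQuatPair I J) (u : GL (Fin 2) F) (x : ℍ[F,-1,-1]) :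
    (h.map_conjGL u).hom x = u.1 * h.hom x * u⁻¹.1 := by
  rw [hom_apply, hom_apply, ← map_mul, mat_conjGL, mat_conjGL, mat_conjGL]
  simp only [mul_add, add_mul, mul_smul_comm, smul_mul_assoc, mul_one, Units.mul_inv]

end IsQuatPair

/-- In a finite field -1 = a² + b², and the symmetric matrix with rows (a, b), (b, -a) anticommutes
with the rotation by a right angle. -/
theorem exists_isQuatPair [Finite F] : ∃ I J : SL(2, F), IsQuatPair I J := by
  have := Fintype.ofFinite F
  obtain ⟨p, hp⟩ := CharP.exists F
  have hpp : Fact p.Prime := ⟨CharP.char_is_prime F p⟩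
  obtain ⟨a, b, hab⟩ := CharP.sq_add_sq F p (-1)
  have hab' : (a : F) ^ 2 + (b : F) ^ 2 = -1 := by exact_mod_cast hab
  refine ⟨⟨!![0, 1; -1, 0], by simp [det_fin_two]⟩,
    ⟨!![(a : F), b; b, -a], by rw [det_fin_two]; simp; linear_combination -hab'⟩, ?_, ?_, ?_⟩
  · apply mat_injective
    change !![0, 1; -1, 0] * !![0, 1; -1, 0] = -(1 : Matrix (Fin 2) (Fin 2) F)
    ext i j; fin_cases i <;> fin_cases j <;> simp
  · apply mat_injective
    change !![(a : F), b; b, -a] * !![(a : F), b; b, -a] = -1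
    ext i j
    fin_cases i <;> fin_cases j <;> simp
    · linear_combination hab'
    · ring
    · ring
    · linear_combination hab'
  · apply mat_injective
    change !![(a : F), b; b, -a] * !![0, 1; -1, 0] = -(!![0, 1; -1, 0] * !![(a : F), b; b, -a])
    ext i j; fin_cases i <;> fin_cases j <;> simp

theorem det_one_sub_mat (g : SL(2, F)) : (1 - mat g).det = 2 - (mat g).trace := by
  have h := det_mat g
  rw [det_fin_two] at h
  rw [det_fin_two, trace_fin_two]
  simp
  linear_combination h

/-- The matrix 1 - YX intertwines X and Y, since (1 - YX)X = X + Y = Y(1 - YX); its determinant is 2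
- tr(YX). -/
theorem exists_conjGL_of_trace_ne {X Y : SL(2, F)} (hX : X * X = -1) (hY : Y * Y = -1)
    (ht : (mat (Y * X)).trace ≠ 2) :
    ∃ u : GL (Fin 2) F, u.1 = 1 - mat (Y * X) ∧ conjGL u X = Y := by
  have hdet : IsUnit (1 - mat (Y * X)).det := by
    rw [det_one_sub_mat, isUnit_iff_ne_zero, sub_ne_zero]; exact ht.symm
  obtain ⟨u, hu⟩ := (isUnit_iff_isUnit_det _).2 hdet
  refine ⟨u, hu, ?_⟩
  rw [conjGL_eq_iff, hu, sub_mul, mul_sub, ← map_mul, ← map_mul, mul_assoc, hX, ← mul_assoc, hY]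
  simp [add_comm]

/-- If 1 - I'I is singular, then 1 + I'I is not; so I is first replaced by -I = JIJ⁻¹. -/
theorem exists_conjGL_pair_left (h2 : (2 : F) ≠ 0) {I J I' : SL(2, F)} (h : IsQuatPair I J)
    (hI' : I' * I' = -1) : ∃ u : GL (Fin 2) F, conjGL u I = I' := by
  by_cases ht : (mat (I' * I)).trace = 2
  · obtain ⟨u, -, hu⟩ := exists_conjGL_of_trace_ne (X := -I) (Y := I') (by simp [h.sqI]) hI' (by
      rw [mul_neg, mat_neg, trace_neg, ht]
      intro h'
      have : (2 : F) * 2 = 0 := by linear_combination -h'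
      rcases mul_eq_zero.1 this with h'' | h'' <;> exact h2 h'')
    refine ⟨u * toGL J, ?_⟩
    rw [map_mul, MulAut.mul_apply, conjGL_toGL, MulAut.conj_apply, h.anti]
    rw [neg_mul, mul_assoc, mul_inv_cancel, mul_one, hu]
  · obtain ⟨u, -, hu⟩ := exists_conjGL_of_trace_ne h.sqI hI' ht
    exact ⟨u, hu⟩

/-- Skolem–Noether by hand. Once I has been moved to I' and J to L, the product J'L commutes with
I', so the intertwiner 1 - J'L (or 1 + J'L) fixes I' while moving ±L to J'. A wrong sign is
corrected by conjugating with I', which negates L. -/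
theorem exists_conjGL_pair (h2 : (2 : F) ≠ 0) {I J I' J' : SL(2, F)} (h : IsQuatPair I J)
    (h' : IsQuatPair I' J') : ∃ u : GL (Fin 2) F, conjGL u I = I' ∧ conjGL u J = J' := by
  obtain ⟨v, hv⟩ := exists_conjGL_pair_left h2 h h'.sqI
  have hp := h.map_conjGL v
  rw [hv] at hp
  set L := conjGL v J with hL
  have hcomm : ∀ u : GL (Fin 2) F, (u.1 = 1 - mat (J' * L) ∨ u.1 = 1 - mat (J' * -L)) →
      conjGL u I' = I' := by
    intro u hu
    have : J' * L * I' = I' * (J' * L) := by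
      rw [mul_assoc, hp.anti, mul_neg, ← mul_assoc, h'.anti, neg_mul, neg_neg, mul_assoc]
    rw [conjGL_eq_iff]
    rcases hu with hu | hu
    · rw [hu, sub_mul, mul_sub, ← map_mul, ← map_mul, this, one_mul, mul_one]
    · rw [hu, sub_mul, mul_sub, ← map_mul, ← map_mul, mul_neg, neg_mul, mul_neg, this, one_mul,
        mul_one]
  by_cases ht : (mat (J' * L)).trace = 2
  · obtain ⟨u, hu1, hu⟩ := exists_conjGL_of_trace_ne (X := -L) (Y := J') (by simp [hp.sqJ]) h'.sqJ
      (by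
        rw [mul_neg, mat_neg, trace_neg, ht]
        intro h'
        have : (2 : F) * 2 = 0 := by linear_combination -h'
        rcases mul_eq_zero.1 this with h'' | h'' <;> exact h2 h'')
    refine ⟨u * toGL I' * v, ?_, ?_⟩
    · rw [map_mul, map_mul, MulAut.mul_apply, MulAut.mul_apply, hv, conjGL_toGL, MulAut.conj_apply,
        mul_inv_cancel_right, hcomm u (Or.inr hu1)]
    · rw [map_mul, map_mul, MulAut.mul_apply, MulAut.mul_apply, ← hL, conjGL_toGL,
        MulAut.conj_apply, ← hu]
      congr 1
      rw [mul_inv_eq_iff_eq_mul, neg_mul, hp.anti, neg_neg]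
  · obtain ⟨u, hu1, hu⟩ := exists_conjGL_of_trace_ne hp.sqJ h'.sqJ ht
    refine ⟨u * v, ?_, ?_⟩
    · rw [map_mul, MulAut.mul_apply, hv, hcomm u (Or.inl hu1)]
    · rw [map_mul, MulAut.mul_apply, ← hL, hu]

end QuaternionPairs

end HallPi


namespace HallPi

/-! ### Bounding generated subgroups by coset enumeration. -/

section CosetBound

theorem closure_subset_of_mul_right {G : Type*} [Group G] [Finite G] {s U : Set G}
    (h1 : (1 : G) ∈ U) (h : ∀ x ∈ U, ∀ g ∈ s, x * g ∈ U) : (Subgroup.closure s : Set G) ⊆ U := by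
  intro x hx
  have hx' : x ∈ Submonoid.closure s := by
    rw [← Subgroup.closure_toSubmonoid_of_finite]
    exact hx
  induction hx' using Submonoid.closure_induction_right with
  | one => exact h1
  | mul_right a ha b hb ih =>
    refine h _ (ih ?_) b hb
    rw [← Subgroup.closure_toSubmonoid_of_finite] at ha
    exact ha

/-- The union of the cosets A r is stable under right multiplication by the generators and contains
1; in a finite group no inverses are needed, so it contains the generated subgroup. -/
theorem card_closure_le {G : Type*} [Group G] [Finite G] [DecidableEq G] (s : Set G)
    (A : Subgroup G) (reps : Finset G) (h1 : 1 ∈ reps)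
    (hstep : ∀ r ∈ reps, ∀ g ∈ s, ∃ r' ∈ reps, r * g * r'⁻¹ ∈ A) :
    Nat.card (Subgroup.closure s) ≤ Nat.card A * reps.card := by
  set U : Set G := (fun x : G × G => x.1 * x.2) '' ((A : Set G) ×ˢ (reps : Set G)) with hU
  have hsub : (Subgroup.closure s : Set G) ⊆ U := by
    refine closure_subset_of_mul_right ⟨(1, 1), ⟨A.one_mem, h1⟩, one_mul 1⟩ ?_
    rintro _ ⟨⟨a, r⟩, ⟨ha, hr⟩, rfl⟩ g hg
    obtain ⟨r', hr', hm⟩ := hstep r hr g hg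
    refine ⟨(a * (r * g * r'⁻¹), r'), ⟨A.mul_mem ha hm, hr'⟩, ?_⟩
    simp [mul_assoc]
  have h2 := Set.ncard_le_ncard hsub (Set.toFinite U)
  have h3 := Set.ncard_image_le (f := fun x : G × G => x.1 * x.2)
    (Set.toFinite ((A : Set G) ×ˢ (reps : Set G)))
  rw [Set.ncard_prod, Set.ncard_coe_finset] at h3
  exact h2.trans h3

end CosetBound

/-! ### Orders of the binary polyhedral groups from their relations. -/

section QuatGroups

open Matrix
open scoped MatrixGroups Quaternion

variable {F : Type*} [Field F]

namespace IsQuatPair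

variable {I J : SL(2, F)}

theorem inv_I (h : IsQuatPair I J) : I⁻¹ = -I := by
  rw [inv_eq_iff_mul_eq_one, mul_neg, h.sqI, neg_neg]

theorem inv_J (h : IsQuatPair I J) : J⁻¹ = -J := by
  rw [inv_eq_iff_mul_eq_one, mul_neg, h.sqJ, neg_neg]

theorem ne_one_of_sq (h2 : (2 : F) ≠ 0) {g : SL(2, F)} (hg : g * g = -1) : g ≠ 1 := by
  rintro rfl
  exact SL2_one_ne_neg_one h2 (by simpa using hg)

theorem orderOf_of_sq (h2 : (2 : F) ≠ 0) {g : SL(2, F)} (hg : g * g = -1) : orderOf g = 4 := by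
  have : orderOf g = 2 ^ (1 + 1) := by
    apply orderOf_eq_prime_pow
    · rw [pow_one, sq, hg]; exact (SL2_one_ne_neg_one h2).symm
    · rw [show 2 ^ (1 + 1) = 2 * 2 by norm_num, pow_mul, sq g, hg]; simp
  simpa using this

/-- Two cosets of ⟨I⟩, of order 4, suffice; order 4 itself is excluded since J does not commute with
I. -/
theorem card_closure [Finite F] (h2 : (2 : F) ≠ 0) (h : IsQuatPair I J) :
    Nat.card (Subgroup.closure {I, J}) = 8 := by
  classical
  have hI : Nat.card (Subgroup.zpowers I) = 4 := by
    rw [Nat.card_zpowers, orderOf_of_sq h2 h.sqI]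
  have hIm : I ∈ Subgroup.zpowers I := Subgroup.mem_zpowers I
  have hneg : -1 ∈ Subgroup.zpowers I := by rw [← h.sqI]; exact mul_mem hIm hIm
  have hle : Nat.card (Subgroup.closure {I, J}) ≤ 4 * ({1, J} : Finset SL(2, F)).card := by
    rw [← hI]
    refine card_closure_le _ _ _ (by simp) ?_
    intro r hr g hg
    simp only [Finset.mem_insert, Finset.mem_singleton] at hr
    simp only [Set.mem_insert_iff, Set.mem_singleton_iff] at hg
    rcases hr with rfl | rfl <;> rcases hg with rfl | rfl
    · exact ⟨1, by simp, by simp⟩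
    · exact ⟨g, by simp, by simp⟩
    · refine ⟨r, by simp, ?_⟩
      rw [h.anti, neg_mul, mul_inv_cancel_right, ← h.inv_I]
      exact inv_mem hIm
    · refine ⟨1, by simp, ?_⟩
      rw [inv_one, mul_one, h.sqJ]
      exact hneg
  have hle8 := hle.trans (Nat.mul_le_mul_left 4 Finset.card_le_two)
  have hsub : Subgroup.zpowers I ≤ Subgroup.closure {I, J} := by
    rw [Subgroup.zpowers_le]; exact Subgroup.subset_closure (by simp)
  have hdvd := Subgroup.card_dvd_of_le hsub
  have hne : Nat.card (Subgroup.closure {I, J}) ≠ 4 := by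
    intro h4
    have he := Subgroup.eq_of_le_of_card_ge hsub (by rw [h4, hI])
    have hJ : J ∈ Subgroup.zpowers I := by rw [he]; exact Subgroup.subset_closure (by simp)
    obtain ⟨n, rfl⟩ := hJ
    have hc : I ^ n * I = I * I ^ n := (Commute.refl I).zpow_left n
    have := h.anti
    simp only at this
    rw [hc] at this
    have h5 : (1 : SL(2, F)) = -1 := by
      have := congrArg (fun x => (I * I ^ n)⁻¹ * x) this
      simpa using this
    exact SL2_one_ne_neg_one h2 h5
  rw [hI] at hdvd
  have : 0 < Nat.card (Subgroup.closure {I, J}) := Nat.card_pos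
  omega

end IsQuatPair

/-- A quaternion pair together with an element of order `6` permuting `i`, `j` and `k`. -/
structure IsQuatTriple (I J W : SL(2, F)) : Prop extends IsQuatPair I J where
  conjI : W * I = J * W
  conjJ : W * J = I * J * W
  cube : W * W * W = -1

namespace IsQuatTriple

variable {I J W : SL(2, F)}

theorem conjK (h : IsQuatTriple I J W) : W * (I * J) = I * W := by
  rw [← mul_assoc, h.conjI, mul_assoc, h.conjJ, ← mul_assoc, ← mul_assoc, h.anti, neg_mul, mul_assoc I,
    h.sqJ]
  simp

theorem W_mul_I (h : IsQuatTriple I J W) : J = W * I * W⁻¹ := by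
  rw [h.conjI, mul_inv_cancel_right]

theorem J_mem (h : IsQuatTriple I J W) {s : Set SL(2, F)} (hI : I ∈ s) (hW : W ∈ s) :
    J ∈ Subgroup.closure s := by
  rw [h.W_mul_I]
  exact mul_mem (mul_mem (Subgroup.subset_closure hW) (Subgroup.subset_closure hI))
    (inv_mem (Subgroup.subset_closure hW))

theorem orderOf_W_sq (h2 : (2 : F) ≠ 0) (h : IsQuatTriple I J W) : orderOf (W * W) = 3 := by
  have : Fact (Nat.Prime 3) := ⟨Nat.prime_three⟩
  apply orderOf_eq_prime
  · have : (W * W) ^ 3 = (W * W * W) ^ 2 := by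
      rw [← sq, ← pow_mul, ← pow_succ, ← pow_mul]
    rw [this, h.cube]; simp
  · intro h1
    have hc := h.cube
    rw [h1, one_mul] at hc
    have := h.conjI
    rw [hc] at this
    have hIJ : I = J := by simpa using this
    have ha := h.anti
    rw [hIJ] at ha
    have h5 : (1 : SL(2, F)) = -1 := by
      have := congrArg (fun x => (J * J)⁻¹ * x) ha
      simpa using this
    exact SL2_one_ne_neg_one h2 h5

theorem quat_le (h : IsQuatTriple I J W) :
    Subgroup.closure {I, J} ≤ Subgroup.closure {I, W} := by
  rw [Subgroup.closure_le]
  rintro x (rfl | rfl)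
  · exact Subgroup.subset_closure (by simp)
  · exact h.J_mem (by simp) (by simp)

/-- At most three cosets of the quaternion group of order 8, represented by 1, W, W², while W²
contributes a factor 3 to the order. -/
theorem card_closure [Finite F] (h2 : (2 : F) ≠ 0) (h : IsQuatTriple I J W) :
    Nat.card (Subgroup.closure {I, W}) = 24 := by
  classical
  have hQ := h.toIsQuatPair.card_closure h2
  have hI : I ∈ Subgroup.closure {I, J} := Subgroup.subset_closure (by simp)
  have hJ : J ∈ Subgroup.closure {I, J} := Subgroup.subset_closure (by simp)
  have hneg : -1 ∈ Subgroup.closure {I, J} := by rw [← h.sqI]; exact mul_mem hI hI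
  have hle : Nat.card (Subgroup.closure {I, W}) ≤ 8 * ({1, W, W * W} : Finset SL(2, F)).card := by
    rw [← hQ]
    refine card_closure_le _ _ _ (by simp) ?_
    intro r hr g hg
    simp only [Finset.mem_insert, Finset.mem_singleton] at hr
    simp only [Set.mem_insert_iff, Set.mem_singleton_iff] at hg
    rcases hr with rfl | rfl | rfl <;> rcases hg with rfl | rfl
    · exact ⟨1, by simp, by simpa using hI⟩
    · exact ⟨g, by simp, by simp⟩
    · refine ⟨r, by simp, ?_⟩
      rw [h.conjI, mul_inv_cancel_right]
      exact hJ
    · exact ⟨g * g, by simp, by simp⟩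
    · refine ⟨W * W, by simp, ?_⟩
      rw [mul_assoc W, h.conjI, ← mul_assoc, h.conjJ, mul_assoc _ W W, mul_inv_cancel_right]
      exact mul_mem hI hJ
    · refine ⟨1, by simp, ?_⟩
      rw [h.cube]; simpa using hneg
  have hle' := hle.trans (Nat.mul_le_mul_left 8 Finset.card_le_three)
  have h8 := Subgroup.card_dvd_of_le h.quat_le
  have h3 : 3 ∣ Nat.card (Subgroup.closure {I, W}) := by
    rw [← h.orderOf_W_sq h2]
    have hm : W * W ∈ Subgroup.closure {I, W} :=
      mul_mem (Subgroup.subset_closure (by simp)) (Subgroup.subset_closure (by simp))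
    have := orderOf_dvd_natCard (⟨W * W, hm⟩ : Subgroup.closure {I, W})
    rwa [Subgroup.orderOf_mk] at this
  rw [hQ] at h8
  have : 0 < Nat.card (Subgroup.closure {I, W}) := Nat.card_pos
  omega

theorem neg_one_mem (h : IsQuatTriple I J W) {s : Set SL(2, F)} (hI : I ∈ s) :
    -1 ∈ Subgroup.closure s := by
  rw [← h.sqI]; exact mul_mem (Subgroup.subset_closure hI) (Subgroup.subset_closure hI)

/-- The group generated by the pair is normalized by every element which conjugates the generators
into it. -/
theorem mem_normalizer_quat [Finite F] {g : SL(2, F)} {I J : SL(2, F)}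
    (hI : g * I * g⁻¹ ∈ Subgroup.closure {I, J}) (hJ : g * J * g⁻¹ ∈ Subgroup.closure {I, J}) :
    g ∈ Subgroup.normalizer (Subgroup.closure {I, J} : Set SL(2, F)) := by
  set Q := Subgroup.closure {I, J}
  have hle : Q.map (MulAut.conj g).toMonoidHom ≤ Q := by
    rw [Subgroup.map_le_iff_le_comap, Subgroup.closure_le]
    rintro x (rfl | rfl)
    · exact hI
    · exact hJ
  have heq : Q.map (MulAut.conj g).toMonoidHom = Q :=
    Subgroup.eq_of_le_of_card_ge hle
      (Subgroup.card_map_of_injective (MulAut.conj g).injective).ge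
  rw [Subgroup.mem_normalizer_iff]
  intro x
  constructor
  · intro hx
    exact hle ⟨x, hx, rfl⟩
  · intro hx
    have hx' : g * x * g⁻¹ ∈ Q.map (MulAut.conj g).toMonoidHom := by rw [heq]; exact hx
    obtain ⟨y, hy, he⟩ := hx'
    have : y = x := by simpa using he
    rwa [← this]

theorem W_mem_normalizer [Finite F] (h : IsQuatTriple I J W) :
    W ∈ Subgroup.normalizer (Subgroup.closure {I, J} : Set SL(2, F)) := by
  have hI : I ∈ Subgroup.closure {I, J} := Subgroup.subset_closure (by simp)
  have hJ : J ∈ Subgroup.closure {I, J} := Subgroup.subset_closure (by simp)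
  apply mem_normalizer_quat
  · rw [h.conjI, mul_inv_cancel_right]; exact hJ
  · rw [h.conjJ, mul_inv_cancel_right]; exact mul_mem hI hJ

end IsQuatTriple

theorem pow_mem_of_le_normalizer {G : Type*} [Group G] [Finite G] {Q H : Subgroup G} (hQ : Q ≤ H)
    (hn : H ≤ Subgroup.normalizer (Q : Set G)) {m : ℕ} (hm : Nat.card H = m * Nat.card Q) {x : G}
    (hx : x ∈ H) : x ^ m ∈ Q := by
  have : (Q.subgroupOf H).Normal := Subgroup.normal_subgroupOf_iff_le_normalizer hQ |>.2 hn
  have h1 := Subgroup.pow_index_mem (Q.subgroupOf H) ⟨x, hx⟩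
  have h2 : (Q.subgroupOf H).index = m := by
    have := Subgroup.index_mul_card (Q.subgroupOf H)
    rw [Nat.card_congr (Subgroup.subgroupOfEquivOfLe hQ).toEquiv, hm] at this
    exact Nat.eq_of_mul_eq_mul_right Nat.card_pos this
  rw [h2] at h1
  exact h1

/-- An element extending a quaternion triple to the binary octahedral group. -/
structure IsOctahedral (I J W R : SL(2, F)) : Prop extends IsQuatTriple I J W where
  sqR : R * R = I
  conjRI : R * I = I * R
  conjRJ : R * J = I * J * R
  conjRW : R * W = J * W⁻¹ * J⁻¹ * R

namespace IsOctahedral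

variable {I J W R : SL(2, F)}

theorem T_le (I W R : SL(2, F)) : Subgroup.closure {I, W} ≤ Subgroup.closure {I, W, R} :=
  Subgroup.closure_mono (by intro x; simp; tauto)

theorem le_normalizer_quat [Finite F] (h : IsOctahedral I J W R) :
    Subgroup.closure {I, W, R} ≤
      Subgroup.normalizer (Subgroup.closure {I, J} : Set SL(2, F)) := by
  have hI : I ∈ Subgroup.closure {I, J} := Subgroup.subset_closure (by simp)
  have hJ : J ∈ Subgroup.closure {I, J} := Subgroup.subset_closure (by simp)
  rw [Subgroup.closure_le]
  rintro x (rfl | rfl | rfl)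
  · exact Subgroup.le_normalizer hI
  · exact h.W_mem_normalizer
  · apply IsQuatTriple.mem_normalizer_quat
    · rw [h.conjRI, mul_inv_cancel_right]; exact hI
    · rw [h.conjRJ, mul_inv_cancel_right]; exact mul_mem hI hJ

theorem card_closure [Finite F] (h2 : (2 : F) ≠ 0) (h : IsOctahedral I J W R) :
    Nat.card (Subgroup.closure {I, W, R}) = 48 := by
  classical
  have hQ := h.toIsQuatPair.card_closure h2
  have hT := h.toIsQuatTriple.card_closure h2
  have hI : I ∈ Subgroup.closure {I, W} := Subgroup.subset_closure (by simp)
  have hW : W ∈ Subgroup.closure {I, W} := Subgroup.subset_closure (by simp)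
  have hJ : J ∈ Subgroup.closure {I, W} := h.J_mem (by simp) (by simp)
  have hle : Nat.card (Subgroup.closure {I, W, R}) ≤ 24 * ({1, R} : Finset SL(2, F)).card := by
    rw [← hT]
    refine card_closure_le _ _ _ (by simp) ?_
    intro r hr g hg
    simp only [Finset.mem_insert, Finset.mem_singleton] at hr
    simp only [Set.mem_insert_iff, Set.mem_singleton_iff] at hg
    rcases hr with rfl | rfl <;> rcases hg with rfl | rfl | rfl
    · exact ⟨1, by simp, by simpa using hI⟩
    · exact ⟨1, by simp, by simpa using hW⟩
    · exact ⟨g, by simp, by simp⟩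
    · exact ⟨r, by simp, by rw [h.conjRI, mul_inv_cancel_right]; exact hI⟩
    · refine ⟨r, by simp, ?_⟩
      rw [h.conjRW, mul_inv_cancel_right]
      exact mul_mem (mul_mem hJ (inv_mem hW)) (inv_mem hJ)
    · exact ⟨1, by simp, by rw [h.sqR]; simpa using hI⟩
  have hle' := hle.trans (Nat.mul_le_mul_left 24 Finset.card_le_two)
  have h24 := Subgroup.card_dvd_of_le (T_le I W R)
  rw [hT] at h24
  -- If R added nothing, then R³, and by R² = I also R, would lie in the quaternion group. But R has
  -- order 8, so that group would be cyclic and J would commute with I.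
  have hne : Nat.card (Subgroup.closure {I, W, R}) ≠ 24 := by
    intro h24
    have hR : R ∈ Subgroup.closure {I, W, R} := Subgroup.subset_closure (by simp)
    have h12 := pow_mem_of_le_normalizer
      (h.quat_le.trans (T_le I W R)) h.le_normalizer_quat (m := 3) (by rw [h24, hQ]) hR
    have hIQ : I ∈ Subgroup.closure {I, J} := Subgroup.subset_closure (by simp)
    have hJQ : J ∈ Subgroup.closure {I, J} := Subgroup.subset_closure (by simp)
    have hRQ : R ∈ Subgroup.closure {I, J} := by
      have : R = R ^ 3 * I⁻¹ := by rw [← h.sqR]; group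
      rw [this]
      exact mul_mem h12 (inv_mem hIQ)
    have hord : orderOf R = 8 := by
      have : orderOf R = 2 ^ (2 + 1) := by
        have h4 : R ^ 2 ^ 2 = -1 := by
          rw [show 2 ^ 2 = 2 * 2 by norm_num, pow_mul, sq R, h.sqR, sq, h.sqI]
        apply orderOf_eq_prime_pow
        · rw [h4]; exact (SL2_one_ne_neg_one h2).symm
        · rw [pow_succ, pow_mul, h4]; simp
      simpa using this
    have hle := Subgroup.zpowers_le.2 hRQ
    have he := Subgroup.eq_of_le_of_card_ge hle (by rw [hQ, Nat.card_zpowers, hord])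
    rw [← he] at hJQ
    obtain ⟨n, hn⟩ := hJQ
    have hc : J * I = I * J := by
      rw [← hn]
      exact ((show Commute R I from h.conjRI).zpow_left n).eq
    have ha := h.anti
    rw [hc] at ha
    have h5 : (1 : SL(2, F)) = -1 := by
      have := congrArg (fun x => (I * J)⁻¹ * x) ha
      simpa using this
    exact SL2_one_ne_neg_one h2 h5
  have : 0 < Nat.card (Subgroup.closure {I, W, R}) := Nat.card_pos
  omega

end IsOctahedral

/-- An element extending a quaternion triple to the binary icosahedral group. -/
structure IsIcosahedral (I J W S : SL(2, F)) : Prop extends IsQuatTriple I J W where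
  sqS : S * S = -1
  conjSW : S * W = W⁻¹ * S
  cubeSI : S * I * (S * I) * (S * I) = -1
  five : (S * J) ^ 5 = 1

namespace IsIcosahedral

variable {I J W S : SL(2, F)}

theorem T_le (I W S : SL(2, F)) : Subgroup.closure {I, W} ≤ Subgroup.closure {I, W, S} :=
  Subgroup.closure_mono (by intro x; simp; tauto)

/-- The cosets T, TS, TSI, TSJ, TSIJ of the tetrahedral group T = ⟨I, W⟩ are permuted by the
generators, giving at most 120 elements; SJ, of order 5, gives the missing divisor. -/
theorem card_closure [Finite F] (h2 : (2 : F) ≠ 0) (h : IsIcosahedral I J W S) :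
    Nat.card (Subgroup.closure {I, W, S}) = 120 := by
  classical
  have hT := h.toIsQuatTriple.card_closure h2
  set T := Subgroup.closure {I, W} with hTdef
  have hI : I ∈ T := Subgroup.subset_closure (by simp)
  have hW : W ∈ T := Subgroup.subset_closure (by simp)
  have hJ : J ∈ T := h.J_mem (by simp) (by simp)
  have hneg : -1 ∈ T := h.toIsQuatTriple.neg_one_mem (by simp)
  have hSW : W⁻¹ * S = S * W := h.conjSW.symm
  -- The entries of the coset table: e1–e3 record right multiplication by W, using SW = W⁻¹S and the
  -- action of W on I, J, IJ; f1–f3 record right multiplication by S, starting from (SI)³ = -1 and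
  -- transporting by W.
  have e1 : S * I * W = W⁻¹ * (S * (I * J)) := by
    rw [mul_assoc, ← h.conjK, ← mul_assoc, h.conjSW, mul_assoc]
  have e2 : S * J * W = W⁻¹ * (S * I) := by
    rw [mul_assoc, ← h.conjI, ← mul_assoc, h.conjSW, mul_assoc]
  have e3 : S * (I * J) * W = W⁻¹ * (S * J) := by
    rw [mul_assoc, ← h.conjJ, ← mul_assoc, h.conjSW, mul_assoc]
  have f1 : S * I * S = I * (S * I) := by
    apply mul_right_cancel (b := I * S * I)
    have l1 : S * I * S * (I * S * I) = -1 := by rw [← h.cubeSI]; simp only [mul_assoc]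
    have l2 : I * (S * I) * (I * S * I) = -1 := by
      rw [show I * (S * I) * (I * S * I) = I * (S * (I * I) * S) * I by simp only [mul_assoc],
        h.sqI, mul_neg, neg_mul, mul_one, h.sqS]
      simp [h.sqI]
    rw [l1, l2]
  have f2 : S * J * S = W⁻¹ * I * W⁻¹ * (S * (I * J)) := by
    calc S * J * S = S * W * I * (W⁻¹ * S) := by
          nth_rewrite 1 [h.W_mul_I]; simp only [mul_assoc]
      _ = W⁻¹ * (S * I * S) * W := by
          rw [h.conjSW]; nth_rewrite 2 [hSW]; simp only [mul_assoc]
      _ = W⁻¹ * I * (S * I * W) := by rw [f1]; simp only [mul_assoc]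
      _ = W⁻¹ * I * W⁻¹ * (S * (I * J)) := by rw [e1]; simp only [mul_assoc]
  have f3 : S * (I * J) * S = W⁻¹ * (W⁻¹ * I * W⁻¹) * W⁻¹ * (S * J) := by
    have hK : I * J = W * J * W⁻¹ := by rw [h.conjJ, mul_inv_cancel_right]
    calc S * (I * J) * S = S * W * J * (W⁻¹ * S) := by
          rw [hK]; simp only [mul_assoc]
      _ = W⁻¹ * (S * J * S) * W := by
          rw [h.conjSW]; nth_rewrite 2 [hSW]; simp only [mul_assoc]
      _ = W⁻¹ * (W⁻¹ * I * W⁻¹) * (S * (I * J) * W) := by rw [f2]; simp only [mul_assoc]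
      _ = _ := by rw [e3]; simp only [mul_assoc]
  have hmem : ∀ {x t r : SL(2, F)}, x = t * r → t ∈ T → x * r⁻¹ ∈ T := by
    rintro x t r rfl ht
    rwa [mul_inv_cancel_right]
  have hWi := inv_mem hW
  have hle : Nat.card (Subgroup.closure {I, W, S}) ≤
      24 * ({1, S, S * I, S * J, S * (I * J)} : Finset SL(2, F)).card := by
    rw [← hT]
    refine card_closure_le _ _ _ (by simp) ?_
    intro r hr g hg
    simp only [Finset.mem_insert, Finset.mem_singleton] at hr
    simp only [Set.mem_insert_iff, Set.mem_singleton_iff] at hg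
    rcases hr with rfl | rfl | rfl | rfl | rfl <;> rcases hg with rfl | rfl | rfl
    · exact ⟨1, by simp, by simpa using hI⟩
    · exact ⟨1, by simp, by simpa using hW⟩
    · exact ⟨g, by simp, by simp⟩
    · exact ⟨r * g, by simp, by simp⟩
    · exact ⟨r, by simp, by rw [h.conjSW, mul_inv_cancel_right]; exact inv_mem hW⟩
    · exact ⟨1, by simp, by rw [h.sqS]; simpa using hneg⟩
    · refine ⟨S, by simp, ?_⟩
      rw [mul_assoc S, h.sqI]; simpa using hneg
    · exact ⟨_, by simp, hmem e1 hWi⟩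
    · exact ⟨_, by simp, hmem f1 hI⟩
    · refine ⟨_, by simp, hmem (t := -1) (r := S * (g * J)) ?_ hneg⟩
      rw [mul_assoc, h.anti]; simp
    · exact ⟨_, by simp, hmem e2 hWi⟩
    · exact ⟨_, by simp, hmem f2 (mul_mem (mul_mem hWi hI) hWi)⟩
    · refine ⟨_, by simp, hmem (t := 1) (r := S * J) ?_ (one_mem _)⟩
      rw [mul_assoc S, mul_assoc, h.anti, mul_neg, ← mul_assoc, h.sqI]; simp
    · exact ⟨_, by simp, hmem e3 hWi⟩
    · exact ⟨_, by simp, hmem f3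
        (mul_mem (mul_mem hWi (mul_mem (mul_mem hWi hI) hWi)) hWi)⟩
  have hle' := hle.trans (Nat.mul_le_mul_left 24 Finset.card_le_five)
  have h24 := Subgroup.card_dvd_of_le (T_le I W S)
  rw [hT] at h24
  have h5 : 5 ∣ Nat.card (Subgroup.closure {I, W, S}) := by
    have : Fact (Nat.Prime 5) := ⟨Nat.prime_five⟩
    have hord : orderOf (S * J) = 5 := by
      apply orderOf_eq_prime h.five
      intro h1
      have hS : S = -J := by rw [← h.inv_J]; exact eq_inv_of_mul_eq_one_left h1
      have hc := h.cubeSI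
      rw [hS, neg_mul, h.anti, neg_neg, h.sqK] at hc
      have hx : I * J = 1 := by simpa using hc
      exact IsQuatPair.ne_one_of_sq h2 h.sqK hx
    have hm : S * J ∈ Subgroup.closure {I, W, S} :=
      mul_mem (Subgroup.subset_closure (by simp)) (T_le I W S hJ)
    have := orderOf_dvd_natCard (⟨S * J, hm⟩ : Subgroup.closure {I, W, S})
    rwa [Subgroup.orderOf_mk, hord] at this
  have : 0 < Nat.card (Subgroup.closure {I, W, S}) := Nat.card_pos
  omega

end IsIcosahedral

end QuatGroups

end HallPi


namespace HallPi

/-! ### Explicit quaternion generators, and the exclusion of unipotent elements. -/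

section PolyhedralGroups

open Matrix
open scoped MatrixGroups Quaternion

variable {F : Type*} [Field F]

namespace IsQuatPair

variable {I J : SL(2, F)}

/-- The device for checking relations among the explicit generators: they become polynomial
identities in quaternion coordinates. -/
theorem eq_of_hom (h : IsQuatPair I J) {g g' : SL(2, F)} {x x' : ℍ[F,-1,-1]}
    (hg : mat g = h.hom x) (hg' : mat g' = h.hom x') (hx : x = x') : g = g' := by
  apply mat_injective; rw [hg, hg', hx]

theorem mat_mul_hom (h : IsQuatPair I J) {g g' : SL(2, F)} {x x' : ℍ[F,-1,-1]}
    (hg : mat g = h.hom x) (hg' : mat g' = h.hom x') : mat (g * g') = h.hom (x * x') := by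
  rw [map_mul, map_mul, hg, hg']

theorem mat_neg_hom (h : IsQuatPair I J) {g : SL(2, F)} {x : ℍ[F,-1,-1]}
    (hg : mat g = h.hom x) : mat (-g) = h.hom (-x) := by
  rw [mat_neg, map_neg, hg]

theorem mat_one_hom (h : IsQuatPair I J) : mat 1 = h.hom 1 := by
  rw [map_one, map_one]

theorem mat_inv_hom (h2 : (2 : F) ≠ 0) (h : IsQuatPair I J) {g : SL(2, F)} {x : ℍ[F,-1,-1]}
    (hg : mat g = h.hom x) : mat g⁻¹ = h.hom (star x) := by
  rw [mat_inv, hg, h.trace_hom h2, hom_apply, hom_apply]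
  simp only [QuaternionAlgebra.re_star, QuaternionAlgebra.imI_star, QuaternionAlgebra.imJ_star,
      QuaternionAlgebra.imK_star]
  module

theorem quatNorm_of_mat (h2 : (2 : F) ≠ 0) (h : IsQuatPair I J) {g : SL(2, F)} {x : ℍ[F,-1,-1]}
    (hg : mat g = h.hom x) : quatNorm x = 1 := by
  rw [← h.det_hom h2, ← hg, det_mat]

theorem quatNorm_half (h2 : (2 : F) ≠ 0) :
    quatNorm (⟨2⁻¹, 2⁻¹, 2⁻¹, 2⁻¹⟩ : ℍ[F,-1,-1]) = 1 := by
  simp only [quatNorm]; field_simp; norm_num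

/-- The element `(1 + i + j + k) / 2`. -/
noncomputable def eltW (h2 : (2 : F) ≠ 0) (h : IsQuatPair I J) : SL(2, F) :=
  h.ofQuat h2 _ (quatNorm_half h2)

theorem mat_eltW (h2 : (2 : F) ≠ 0) (h : IsQuatPair I J) :
    mat (h.eltW h2) = h.hom ⟨2⁻¹, 2⁻¹, 2⁻¹, 2⁻¹⟩ := rfl

theorem isQuatTriple (h2 : (2 : F) ≠ 0) (h : IsQuatPair I J) :
    IsQuatTriple I J (h.eltW h2) where
  toIsQuatPair := h
  conjI := by
    refine h.eq_of_hom (h.mat_mul_hom (h.mat_eltW h2) h.hom_i.symm)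
      (h.mat_mul_hom h.hom_j.symm (h.mat_eltW h2)) ?_
    ext <;> simp
  conjJ := by
    refine h.eq_of_hom (h.mat_mul_hom (h.mat_eltW h2) h.hom_j.symm)
      (h.mat_mul_hom h.hom_k.symm (h.mat_eltW h2)) ?_
    ext <;> simp
  cube := by
    refine h.eq_of_hom (h.mat_mul_hom (h.mat_mul_hom (h.mat_eltW h2) (h.mat_eltW h2))
      (h.mat_eltW h2)) (h.mat_neg_hom h.mat_one_hom) ?_
    ext <;> simp <;> field_simp <;> norm_num

theorem quatNorm_octahedral {c : F} (hc : 2 * c ^ 2 = 1) :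
    quatNorm (⟨c, c, 0, 0⟩ : ℍ[F,-1,-1]) = 1 := by
  simp only [quatNorm]; linear_combination hc

/-- The element `c (1 + i)`. -/
noncomputable def eltR (h2 : (2 : F) ≠ 0) (h : IsQuatPair I J) {c : F} (hc : 2 * c ^ 2 = 1) :
    SL(2, F) :=
  h.ofQuat h2 _ (quatNorm_octahedral hc)

theorem mat_eltR (h2 : (2 : F) ≠ 0) (h : IsQuatPair I J) {c : F} (hc : 2 * c ^ 2 = 1) :
    mat (h.eltR h2 hc) = h.hom ⟨c, c, 0, 0⟩ := rfl

theorem isOctahedral (h2 : (2 : F) ≠ 0) (h : IsQuatPair I J) {c : F} (hc : 2 * c ^ 2 = 1) :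
    IsOctahedral I J (h.eltW h2) (h.eltR h2 hc) where
  toIsQuatTriple := h.isQuatTriple h2
  sqR := by
    refine h.eq_of_hom (h.mat_mul_hom (h.mat_eltR h2 hc) (h.mat_eltR h2 hc)) h.hom_i.symm ?_
    ext <;> simp
    linear_combination hc
  conjRI := by
    refine h.eq_of_hom (h.mat_mul_hom (h.mat_eltR h2 hc) h.hom_i.symm)
      (h.mat_mul_hom h.hom_i.symm (h.mat_eltR h2 hc)) ?_
    ext <;> simp
  conjRJ := by
    refine h.eq_of_hom (h.mat_mul_hom (h.mat_eltR h2 hc) h.hom_j.symm)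
      (h.mat_mul_hom h.hom_k.symm (h.mat_eltR h2 hc)) ?_
    ext <;> simp
  conjRW := by
    refine h.eq_of_hom (h.mat_mul_hom (h.mat_eltR h2 hc) (h.mat_eltW h2))
      (h.mat_mul_hom (h.mat_mul_hom (h.mat_mul_hom h.hom_j.symm
        (h.mat_inv_hom h2 (h.mat_eltW h2))) (h.mat_inv_hom h2 h.hom_j.symm))
        (h.mat_eltR h2 hc)) ?_
    ext <;> simp <;> ring

theorem quatNorm_icosahedral (h2 : (2 : F) ≠ 0) {c : F} (hc : c ^ 2 = c + 1) :
    quatNorm (⟨0, -2⁻¹, 2⁻¹ * c, 2⁻¹ * (1 - c)⟩ : ℍ[F,-1,-1]) = 1 := by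
  simp only [quatNorm]; field_simp; linear_combination 2 * hc

/-- The element `(-i + c j + (1 - c) k) / 2`. -/
noncomputable def eltS (h2 : (2 : F) ≠ 0) (h : IsQuatPair I J) {c : F} (hc : c ^ 2 = c + 1) :
    SL(2, F) :=
  h.ofQuat h2 _ (quatNorm_icosahedral h2 hc)

theorem mat_eltS (h2 : (2 : F) ≠ 0) (h : IsQuatPair I J) {c : F} (hc : c ^ 2 = c + 1) :
    mat (h.eltS h2 hc) = h.hom ⟨0, -2⁻¹, 2⁻¹ * c, 2⁻¹ * (1 - c)⟩ := rfl

theorem isIcosahedral (h2 : (2 : F) ≠ 0) (h : IsQuatPair I J) {c : F} (hc : c ^ 2 = c + 1) :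
    IsIcosahedral I J (h.eltW h2) (h.eltS h2 hc) where
  toIsQuatTriple := h.isQuatTriple h2
  sqS := by
    refine h.eq_of_hom (h.mat_mul_hom (h.mat_eltS h2 hc) (h.mat_eltS h2 hc))
      (h.mat_neg_hom h.mat_one_hom) ?_
    ext <;> simp
    · field_simp; linear_combination -2 * hc
    · ring
    · ring
    · ring
  conjSW := by
    refine h.eq_of_hom (h.mat_mul_hom (h.mat_eltS h2 hc) (h.mat_eltW h2))
      (h.mat_mul_hom (h.mat_inv_hom h2 (h.mat_eltW h2)) (h.mat_eltS h2 hc)) ?_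
    ext <;> simp <;> ring
  -- The last two relations are read off from traces: tr(SI) = 1 gives (SI)³ = -1 by
  -- Cayley–Hamilton, and tr(SJ) = -c with c² = c + 1 gives (SJ)⁵ = 1.
  cubeSI := by
    have hm := h.mat_mul_hom (h.mat_eltS h2 hc) h.hom_i.symm
    apply mat_injective
    have ht := h.trace_hom h2 (⟨0, -2⁻¹, 2⁻¹ * c, 2⁻¹ * (1 - c)⟩ * ⟨0, 1, 0, 0⟩)
    rw [← hm] at ht
    have ht1 : (mat (h.eltS h2 hc * I)).trace = 1 := by
      rw [ht]; simp [h2]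
    rw [show h.eltS h2 hc * I * (h.eltS h2 hc * I) * (h.eltS h2 hc * I) =
      (h.eltS h2 hc * I) ^ 3 by rw [pow_three, mul_assoc], mat_cube, ht1, mat_neg, map_one]
    simp
  five := by
    have hm := h.mat_mul_hom (h.mat_eltS h2 hc) h.hom_j.symm
    apply mat_injective
    have ht := h.trace_hom h2 (⟨0, -2⁻¹, 2⁻¹ * c, 2⁻¹ * (1 - c)⟩ * ⟨0, 0, 1, 0⟩)
    rw [← hm] at ht
    have ht1 : (mat (h.eltS h2 hc * J)).trace = -c := by
      rw [ht]; simp; field_simp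
    rw [mat_pow_five, ht1, map_one]
    have e1 : (-c) ^ 4 - 3 * (-c) ^ 2 + 1 = 0 := by linear_combination (c ^ 2 + c - 1) * hc
    have e2 : (-c) ^ 3 - 2 * (-c) = -1 := by linear_combination (-c - 1) * hc
    rw [e1, e2]
    simp

end IsQuatPair

/-- With trace 2c and c² = 1 one has (g - c)² = 0, so gᵖ = cᵖ is scalar and the order of g divides
2p. If p did not divide it, then g² = 1, which for noncentral g makes the trace 0. -/
theorem dvd_orderOf_of_trace_sq_eq {p : ℕ} [hp : Fact p.Prime] [CharP F p] {g : SL(2, F)}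
    (h2 : (2 : F) ≠ 0) (ht : (mat g).trace ^ 2 = 4) (h1 : g ≠ 1) (h1' : g ≠ -1) :
    p ∣ orderOf g := by
  obtain ⟨c, hc, hct⟩ : ∃ c : F, c ^ 2 = 1 ∧ (mat g).trace = 2 * c := by
    refine ⟨(mat g).trace / 2, ?_, ?_⟩
    · field_simp; linear_combination ht
    · field_simp
  have hnil : (mat g - c • 1) ^ 2 = 0 := by
    rw [sq, sub_mul, mul_sub, mul_sub, mat_mul_self, hct, smul_mul_smul_comm, ← sq, hc]
    simp only [mul_smul_comm, smul_mul_assoc, one_mul, mul_one]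
    module
  have hpow : (mat g - c • 1) ^ p = 0 := by
    obtain ⟨m, hm⟩ := Nat.exists_eq_add_of_le hp.out.two_le
    rw [hm, pow_add, hnil, zero_mul]
  have : CharP (Matrix (Fin 2) (Fin 2) F) p := Matrix.charP p
  have hcomm : Commute (mat g) (c • 1) := (Commute.one_right _).smul_right c
  rw [sub_pow_char_of_commute p hcomm, sub_eq_zero, ← map_pow, smul_pow, one_pow] at hpow
  have hpm : g ^ p = 1 ∨ g ^ p = -1 := by
    refine SL2_eq_one_or_neg_one_of_scalar (c := c ^ p) ?_
    rw [hpow, scalar_apply, smul_one_eq_diagonal]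
  have h2p : orderOf g ∣ p * 2 := by
    apply orderOf_dvd_of_pow_eq_one
    rw [pow_mul]; rcases hpm with h | h <;> rw [h] <;> simp
  by_contra hnd
  have : orderOf g ∣ 2 := by
    refine Nat.Coprime.dvd_of_dvd_mul_left ?_ h2p
    exact ((Nat.Prime.coprime_iff_not_dvd hp.out).2 hnd).symm
  have h0 := trace_eq_zero_of_sq h1 h1' (Or.inl (orderOf_dvd_iff_pow_eq_one.1 this))
  rw [h0] at ht
  have : (2 : F) * 2 = 0 := by linear_combination -ht
  rcases mul_eq_zero.1 this with h | h <;> exact h2 h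

theorem central_of_trace_sq {p : ℕ} [hp : Fact p.Prime] [CharP F p] (h2 : (2 : F) ≠ 0)
    {H : Subgroup SL(2, F)} (hH : ¬ p ∣ Nat.card H) :
    ∀ h ∈ H, (mat h).trace ^ 2 = 4 → h = 1 ∨ h = -1 := by
  intro h hh ht
  by_contra hne
  rw [not_or] at hne
  apply hH
  refine (dvd_orderOf_of_trace_sq_eq h2 ht hne.1 hne.2).trans ?_
  have := orderOf_dvd_natCard (⟨h, hh⟩ : H)
  rwa [Subgroup.orderOf_mk] at this

theorem sq_mem_of_card_le {G : Type*} [Group G] {C H : Subgroup G} [Finite H] (hC : C ≤ H)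
    (hle : Nat.card H ≤ 2 * Nat.card C) {x : G} (hx : x ∈ H) : x ^ 2 ∈ C := by
  have hi := Subgroup.index_mul_card (C.subgroupOf H)
  rw [Nat.card_congr (Subgroup.subgroupOfEquivOfLe hC).toEquiv] at hi
  have : Finite C := Finite.of_injective _ (Subgroup.inclusion_injective hC)
  have hpos : 0 < Nat.card C := Nat.card_pos
  have hpos' : 0 < Nat.card H := Nat.card_pos
  have hi2 : (C.subgroupOf H).index ≤ 2 := by
    rw [← hi] at hle
    exact Nat.le_of_mul_le_mul_right hle hpos
  have hi0 : (C.subgroupOf H).index ≠ 0 := by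
    intro h0; rw [h0, zero_mul] at hi; omega
  have : (⟨x, hx⟩ : H) ^ 2 ∈ C.subgroupOf H := by
    rcases (show (C.subgroupOf H).index = 1 ∨ (C.subgroupOf H).index = 2 by omega) with h | h
    · rw [Subgroup.index_eq_one.1 h]; trivial
    · exact Subgroup.sq_mem_of_index_two h _
  exact this

/-- An abelian C of index at most 2 would contain the squares of W and of IWI⁻¹. Since W² = -W⁻¹,
these two elements would themselves commute; as IWI⁻¹ = -(IJ)W, this makes W commute with IJ,
whereas it conjugates IJ to I. This separates the polyhedral groups from the dihedral ones. -/
theorem IsQuatTriple.not_abelian_index_two {I J W : SL(2, F)} (h2 : (2 : F) ≠ 0)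
    (h : IsQuatTriple I J W) {H : Subgroup SL(2, F)} [Finite H] (hI : I ∈ H) (hW : W ∈ H) :
    ¬ ∃ C ≤ H, (∀ a ∈ C, ∀ b ∈ C, a * b = b * a) ∧ Nat.card H ≤ 2 * Nat.card C := by
  rintro ⟨C, hC, hcomm, hle⟩
  have hsq : W ^ 2 = -W⁻¹ := by
    rw [eq_comm, neg_eq_iff_eq_neg, inv_eq_iff_mul_eq_one, sq, mul_neg, ← mul_assoc, h.cube,
      neg_neg]
  have hI' : I * W * I⁻¹ = -(I * J) * W := by
    rw [h.inv_I, mul_neg, mul_assoc, h.conjI, neg_mul, mul_assoc]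
  have h1 := sq_mem_of_card_le hC hle hW
  have h3 := sq_mem_of_card_le hC hle (mul_mem (mul_mem hI hW) (inv_mem hI))
  have hc := hcomm _ h1 _ h3
  have hsq' : (I * W * I⁻¹) ^ 2 = -(I * W * I⁻¹)⁻¹ := by
    rw [conj_pow, hsq, mul_neg, neg_mul, neg_inj]
    group
  rw [hsq, hsq', neg_mul_neg, neg_mul_neg, ← _root_.mul_inv_rev, ← _root_.mul_inv_rev,
    _root_.inv_inj, hI'] at hc
  have : I * J * W = W * (I * J) := by
    have h4 : -(I * J) * W * W = W * -(I * J) * W := by rw [hc, mul_assoc]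
    have := mul_right_cancel h4
    simpa using this
  rw [h.conjK, mul_assoc] at this
  have hJ : J = 1 := by
    have := mul_left_cancel this
    simpa using this
  exact IsQuatPair.ne_one_of_sq h2 h.sqJ hJ

theorem IsQuatTriple.projIso [Finite F] {p : ℕ} [hp : Fact p.Prime] [CharP F p] (hp3 : 3 < p)
    {I J W : SL(2, F)} (h2 : (2 : F) ≠ 0) (h : IsQuatTriple I J W) :
    ProjIso (alternatingGroup (Fin 4)) (Subgroup.closure {I, W}) := by
  have hc := h.card_closure h2
  have hnd : ¬ p ∣ Nat.card (Subgroup.closure {I, W}) := by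
    rw [hc, show 24 = 2 ^ 3 * 3 by norm_num, hp.out.dvd_mul]
    rintro (h | h)
    · have := Nat.le_of_dvd (by norm_num) (hp.out.dvd_of_dvd_pow h); omega
    · have := Nat.le_of_dvd (by norm_num) h; omega
  rcases finite_subgroup_alternatives h2 (Subgroup.closure {I, W}) (h.neg_one_mem (by simp))
    (central_of_trace_sq h2 hnd) with h' | h' | h' | h'
  · exact absurd h' (h.not_abelian_index_two h2 (Subgroup.subset_closure (by simp))
      (Subgroup.subset_closure (by simp)))
  · exact h'.2
  · omega
  · omega

theorem IsOctahedral.projIso [Finite F] {p : ℕ} [hp : Fact p.Prime] [CharP F p] (hp3 : 3 < p)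
    {I J W R : SL(2, F)} (h2 : (2 : F) ≠ 0) (h : IsOctahedral I J W R) :
    ProjIso (Equiv.Perm (Fin 4)) (Subgroup.closure {I, W, R}) := by
  have hc := h.card_closure h2
  have hnd : ¬ p ∣ Nat.card (Subgroup.closure {I, W, R}) := by
    rw [hc, show 48 = 2 ^ 4 * 3 by norm_num, hp.out.dvd_mul]
    rintro (h | h)
    · have := Nat.le_of_dvd (by norm_num) (hp.out.dvd_of_dvd_pow h); omega
    · have := Nat.le_of_dvd (by norm_num) h; omega
  rcases finite_subgroup_alternatives h2 (Subgroup.closure {I, W, R})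
    (h.toIsQuatTriple.neg_one_mem (by simp))
    (central_of_trace_sq h2 hnd) with h' | h' | h' | h'
  · exact absurd h' (h.toIsQuatTriple.not_abelian_index_two h2 (Subgroup.subset_closure (by simp))
      (Subgroup.subset_closure (by simp)))
  · omega
  · exact h'.2
  · omega

theorem IsIcosahedral.projIso [Finite F] {p : ℕ} [hp : Fact p.Prime] [CharP F p] (hp3 : 5 < p)
    {I J W S : SL(2, F)} (h2 : (2 : F) ≠ 0) (h : IsIcosahedral I J W S) :
    ProjIso (alternatingGroup (Fin 5)) (Subgroup.closure {I, W, S}) := by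
  have hc := h.card_closure h2
  have hnd : ¬ p ∣ Nat.card (Subgroup.closure {I, W, S}) := by
    rw [hc, show 120 = Nat.factorial 5 by rfl, hp.out.dvd_factorial]
    omega
  rcases finite_subgroup_alternatives h2 (Subgroup.closure {I, W, S})
    (h.toIsQuatTriple.neg_one_mem (by simp))
    (central_of_trace_sq h2 hnd) with h' | h' | h' | h'
  · exact absurd h' (h.toIsQuatTriple.not_abelian_index_two h2 (Subgroup.subset_closure (by simp))
      (Subgroup.subset_closure (by simp)))
  · omega
  · omega
  · exact h'.2

end PolyhedralGroups

end HallPi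


namespace HallPi

/-! ### Recovering the standard generators from the isomorphism type of PH. -/

section Lifting

open Matrix
open scoped MatrixGroups Quaternion

variable {F : Type*} [Field F] {X : Type*} [Group X] {H : Subgroup SL(2, F)}

/-- The element `g` of `H` is a lift of `x` with respect to the identification `f` of `PH` with
`X`. -/
def Lifts (f : proj H ≃* X) (g : SL(2, F)) (x : X) : Prop :=
  ∃ hg : g ∈ H, f ⟨QuotientGroup.mk' (Subgroup.center SL(2, F)) g,
    Subgroup.mem_map_of_mem _ hg⟩ = x

theorem exists_lifts (f : proj H ≃* X) (x : X) : ∃ g, Lifts f g x := by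
  obtain ⟨g, hg, h⟩ := (f.symm x).2
  refine ⟨g, hg, ?_⟩
  rw [← f.apply_symm_apply x]
  congr 1
  exact Subtype.ext h

namespace Lifts

variable {f : proj H ≃* X} {g g' : SL(2, F)} {x x' : X}

theorem mem (h : Lifts f g x) : g ∈ H := h.1

theorem mul (h : Lifts f g x) (h' : Lifts f g' x') : Lifts f (g * g') (x * x') := by
  obtain ⟨hg, rfl⟩ := h
  obtain ⟨hg', rfl⟩ := h'
  exact ⟨mul_mem hg hg', by rw [← map_mul]; rfl⟩

theorem inv (h : Lifts f g x) : Lifts f g⁻¹ x⁻¹ := by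
  obtain ⟨hg, rfl⟩ := h
  exact ⟨inv_mem hg, by rw [← map_inv]; rfl⟩

theorem eq_one_iff (h : Lifts f g x) : x = 1 ↔ g = 1 ∨ g = -1 := by
  obtain ⟨hg, rfl⟩ := h
  rw [MulEquiv.map_eq_one_iff, ← SL2_mk_eq_one_iff, ← Subtype.coe_inj]
  rfl

theorem eq_or_eq_neg (h : Lifts f g x) (h' : Lifts f g' x) : g = g' ∨ g = -g' := by
  have := (h.mul h'.inv).eq_one_iff.1 (mul_inv_cancel x)
  rcases this with h | h
  · exact Or.inl (mul_inv_eq_one.1 h)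
  · right
    rw [mul_inv_eq_iff_eq_mul] at h
    rw [h, neg_one_mul]

theorem neg (hneg : -1 ∈ H) (h : Lifts f g x) : Lifts f (-g) x := by
  have h1 : Lifts f (-1) 1 := by
    refine ⟨hneg, ?_⟩
    rw [MulEquiv.map_eq_one_iff, ← Subtype.coe_inj]
    exact SL2_mk_eq_one_iff.2 (Or.inr rfl)
  simpa using h1.mul h

theorem sq_eq_neg_one (h : Lifts f g x) (hx : x * x = 1) (hx1 : x ≠ 1) : g * g = -1 := by
  have h1 := fun h' => hx1 (h.eq_one_iff.2 h')
  have h1 := not_or.1 h1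
  have h2 := (h.mul h).eq_one_iff.1 hx
  rw [← sq] at h2
  exact mul_self_eq_neg_one_of_trace (trace_eq_zero_of_sq h1.1 h1.2 h2)

/-- Lifts of the involutions i, j, ij all square to -1, and I² = J² = (IJ)² = -1 forces JI = -IJ. -/
theorem isQuatPair {i j : X} {I J : SL(2, F)} (hI : Lifts f I i) (hJ : Lifts f J j)
    (hi : i * i = 1) (hi1 : i ≠ 1) (hj : j * j = 1) (hj1 : j ≠ 1) (hij : i * j = j * i)
    (hij1 : i * j ≠ 1) : IsQuatPair I J := by
  have sI := hI.sq_eq_neg_one hi hi1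
  have sJ := hJ.sq_eq_neg_one hj hj1
  have hK := (hI.mul hJ).sq_eq_neg_one 
    (by rw [mul_assoc, ← mul_assoc j, ← hij, mul_assoc, hj, mul_one, hi]) hij1
  refine ⟨sI, sJ, ?_⟩
  have : (I * I) * (J * I) * (J * J) = -(I * J) := by
    calc (I * I) * (J * I) * (J * J) = I * ((I * J) * (I * J)) * J := by simp only [mul_assoc]
      _ = _ := by rw [hK]; simp
  simpa [sI, sJ] using this

end Lifts

/-- Put J = WIW⁻¹. Then WJW⁻¹ = ±IJ, and replacing I by -I negates J and WJW⁻¹ but not IJ, so the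
sign can be made +. The relations now force all four quaternion coordinates of W to be equal, and
the norm makes them ±1/2. -/
theorem exists_eltW_mem {f : proj H ≃* X} (h2 : (2 : F) ≠ 0) (hneg : -1 ∈ H) {i j w : X}
    (hi : i * i = 1) (hi1 : i ≠ 1) (hj : j * j = 1) (hj1 : j ≠ 1) (hij : i * j = j * i)
    (hij1 : i * j ≠ 1) (hwi : w * i = j * w) (hwj : w * j = i * j * w) :
    ∃ (I J : SL(2, F)) (h : IsQuatPair I J), Lifts f I i ∧ Lifts f J j ∧
      Lifts f (h.eltW h2) w := by
  obtain ⟨I, hI⟩ := exists_lifts f i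
  obtain ⟨W, hW⟩ := exists_lifts f w
  have key : ∃ (I J : SL(2, F)), Lifts f I i ∧ Lifts f J j ∧ W * I = J * W ∧
      W * J = I * J * W := by
    have hJ : Lifts f (W * I * W⁻¹) j := by
      have := (hW.mul hI).mul hW.inv
      rwa [hwi, mul_inv_cancel_right] at this
    have hK : Lifts f (W * (W * I * W⁻¹) * W⁻¹) (i * j) := by
      have := (hW.mul hJ).mul hW.inv
      rwa [hwj, mul_inv_cancel_right] at this
    rcases hK.eq_or_eq_neg (hI.mul hJ) with h | h
    · exact ⟨I, _, hI, hJ, by simp, by rw [← h]; simp⟩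
    · refine ⟨-I, _, hI.neg hneg, hJ.neg hneg, by simp, ?_⟩
      rw [neg_mul_neg, ← neg_neg (I * _), ← h]; simp
  obtain ⟨I, J, hI, hJ, h1, h3⟩ := key
  have h := hI.isQuatPair hJ hi hi1 hj hj1 hij hij1
  refine ⟨I, J, h, hI, hJ, ?_⟩
  have hW' := hW
  obtain ⟨⟨a, b, c, d⟩, hx, hn⟩ := h.exists_mat_eq h2 W
  have e1 := h.hom_injective h2 (((h.mat_mul_hom hx h.hom_i.symm).symm.trans
    (congrArg mat h1)).trans (h.mat_mul_hom h.hom_j.symm hx))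
  have e2 := h.hom_injective h2 (((h.mat_mul_hom hx h.hom_j.symm).symm.trans
    (congrArg mat h3)).trans (h.mat_mul_hom h.hom_k.symm hx))
  simp only [QuaternionAlgebra.mk_mul_mk, QuaternionAlgebra.mk.injEq] at e1 e2
  have hb : b = a := by linear_combination e2.2.2.2
  have hc : c = b := by linear_combination e1.1
  have hd : d = a := by linear_combination e1.2.2.1
  subst hc; subst hb; subst hd
  have hd2 : (2 * d) ^ 2 = 1 := by simp only [quatNorm] at hn; linear_combination hn
  rcases (show 2 * d = 1 ∨ 2 * d = -1 by simpa using hd2) with hd | hd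
  · have : h.eltW h2 = W := h.eq_of_hom (h.mat_eltW h2) hx
      (by rw [(eq_inv_of_mul_eq_one_right hd)])
    rwa [this]
  · have : h.eltW h2 = -W := by
      refine h.eq_of_hom (h.mat_eltW h2) (h.mat_neg_hom hx) ?_
      rw [QuaternionAlgebra.neg_mk, ← eq_inv_of_mul_eq_one_right (show 2 * -d = 1 by
        linear_combination -hd)]
    rw [this]
    exact hW'.neg hneg

/-- For a lift R of r with trace t, Cayley–Hamilton and R² = ±I give tR = 1 ± I, and the norm forces
t⁻¹ = ±c. Up to sign and inversion, R is the standard element. -/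
theorem eltR_mem {f : proj H ≃* X} (h2 : (2 : F) ≠ 0) (hneg : -1 ∈ H) {i r : X}
    (hr : r * r = i) (hi1 : i ≠ 1) {I J : SL(2, F)} (h : IsQuatPair I J) (hI : Lifts f I i)
    {c : F} (hc : 2 * c ^ 2 = 1) : h.eltR h2 hc ∈ H := by
  obtain ⟨R, hR⟩ := exists_lifts f r
  obtain ⟨t, ht⟩ : ∃ t, (mat R).trace = t := ⟨_, rfl⟩
  have hRR : Lifts f (R * R) i := hr ▸ hR.mul hR
  have hm := mat_mul_self R
  rw [ht] at hm
  have ht0 : t ≠ 0 := by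
    intro h0
    have := mul_self_eq_neg_one_of_trace (ht.trans h0)
    exact hi1 (hRR.eq_one_iff.2 (Or.inr this))
  obtain ⟨x, hx, hn⟩ := h.exists_mat_eq h2 R
  have key : ∀ s : F, mat (R * R) = s • mat I → x = ⟨t⁻¹, s * t⁻¹, 0, 0⟩ := by
    intro s hs
    apply h.hom_injective h2
    rw [← hx, h.hom_apply]
    rw [← map_mul, hs] at hm
    have : mat R = t⁻¹ • (s • mat I + 1) := by
      rw [hm, sub_add_cancel, smul_smul, inv_mul_cancel₀ ht0, one_smul]
    rw [this]
    simp only [zero_smul, add_zero]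
    module
  have fin : ∀ R' : SL(2, F), R' ∈ H → mat R' = h.hom ⟨t⁻¹, t⁻¹, 0, 0⟩ →
      h.eltR h2 hc ∈ H := by
    intro R' hR' hm'
    have hn' := h.quatNorm_of_mat h2 hm'
    have : t⁻¹ ^ 2 = c ^ 2 := by
      apply mul_left_cancel₀ h2
      simp only [quatNorm] at hn'
      linear_combination hn' - hc
    rcases sq_eq_sq_iff_eq_or_eq_neg.1 this with h' | h'
    · rwa [h.eq_of_hom (h.mat_eltR h2 hc) hm' (by rw [h'])]
    · rw [h.eq_of_hom (h.mat_eltR h2 hc) (h.mat_neg_hom hm') (by simp [h'])]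
      simpa using mul_mem hneg hR'
  rcases hRR.eq_or_eq_neg hI with h' | h'
  · have := key 1 (by rw [h', one_smul])
    rw [one_mul] at this
    exact fin R hR.mem (this ▸ hx)
  · have := key (-1) (by rw [h', mat_neg, neg_one_smul])
    refine fin R⁻¹ (inv_mem hR.mem) ?_
    rw [h.mat_inv_hom h2 hx, this]
    congr 1
    ext <;> simp

/-- A lift of s is a pure quaternion xi + yj + zk. The order of si gives 2x = ±1, inversion of w
gives x + y + z = 0, and the norm then gives a quadratic equation for 2y with roots c and 1 - c. The
second root requires another pair inside the same group. -/
theorem exists_eltS_mem {f : proj H ≃* X} (h2 : (2 : F) ≠ 0) (hneg : -1 ∈ H) {i w s : X}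
    (hs : s * s = 1) (hs1 : s ≠ 1) (hsw : s * w = w⁻¹ * s) (hsi : (s * i) ^ 3 = 1)
    (hsi1 : s * i ≠ 1) {I J : SL(2, F)} (h : IsQuatPair I J) (hI : Lifts f I i)
    (hW : Lifts f (h.eltW h2) w) {c : F} (hc : c ^ 2 = c + 1) :
    ∃ (I J : SL(2, F)) (h : IsQuatPair I J), I ∈ H ∧ h.eltW h2 ∈ H ∧ h.eltS h2 hc ∈ H := by
  obtain ⟨S, hS⟩ := exists_lifts f s
  have key : ∀ S, Lifts f S s → ∃ x y z : F, mat S = h.hom ⟨0, x, y, z⟩ ∧ x + y + z = 0 ∧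
      (2 * x = 1 ∨ 2 * x = -1) := by
    intro S hS
    have hS2 := hS.sq_eq_neg_one hs hs1
    obtain ⟨⟨t, x, y, z⟩, hx, hn⟩ := h.exists_mat_eq h2 S
    have ht := trace_eq_zero_of_mul_self_eq_neg_one h2 hS2
    rw [hx, h.trace_hom h2] at ht
    have ht0 : t = 0 := (mul_eq_zero.1 ht).resolve_left h2
    subst ht0
    have hSI : Lifts f (S * I) (s * i) := hS.mul hI
    have hne := not_or.1 (fun h' => hsi1 (hSI.eq_one_iff.2 h'))
    have h3 : (S * I) ^ 3 = 1 ∨ (S * I) ^ 3 = -1 := by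
      have := ((hSI.mul hSI).mul hSI).eq_one_iff.1 (by rw [← hsi, pow_three, mul_assoc])
      rwa [show S * I * (S * I) * (S * I) = (S * I) ^ 3 by rw [pow_three, mul_assoc]] at this
    have htr := trace_sq_eq_one_of_cube hne.1 hne.2 h3
    rw [h.mat_mul_hom hx h.hom_i.symm, h.trace_hom h2] at htr
    refine ⟨x, y, z, hx, ?_, ?_⟩
    · have hW' := h.mat_inv_hom h2 (h.mat_eltW h2)
      have l1 := h.mat_mul_hom hx (h.mat_eltW h2)
      have l2 := h.mat_mul_hom hW' hx
      have hl : Lifts f (S * h.eltW h2) (w⁻¹ * s) := hsw ▸ hS.mul hW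
      rcases hl.eq_or_eq_neg (hW.inv.mul hS) with h' | h'
      · have e := h.hom_injective h2 (l1.symm.trans ((congrArg mat h').trans l2))
        have e := congrArg QuaternionAlgebra.re e
        simp at e
        field_simp at e
        have : 2 * (x + y + z) = 0 := by linear_combination -e
        exact (mul_eq_zero.1 this).resolve_left h2
      · have e := h.hom_injective h2 (l1.symm.trans ((congrArg mat h').trans (h.mat_neg_hom l2)))
        have e1 := congrArg QuaternionAlgebra.imI e
        have e2 := congrArg QuaternionAlgebra.imJ e
        have e3 := congrArg QuaternionAlgebra.imK e
        simp at e1 e2 e3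
        field_simp at e1 e2 e3
        have : 2 * (x + y + z) = 0 := by linear_combination e1 + e2 + e3
        exact (mul_eq_zero.1 this).resolve_left h2
    · simpa using htr
  have key' : ∃ (S : SL(2, F)) (x y z : F), Lifts f S s ∧ mat S = h.hom ⟨0, x, y, z⟩ ∧
      x + y + z = 0 ∧ 2 * x = -1 := by
    obtain ⟨x, y, z, hx, h0, h1 | h1⟩ := key S hS
    · refine ⟨-S, -x, -y, -z, hS.neg hneg, ?_, by linear_combination -h0, by
        linear_combination -h1⟩
      rw [h.mat_neg_hom hx, QuaternionAlgebra.neg_mk, neg_zero]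
    · exact ⟨S, x, y, z, hS, hx, h0, h1⟩
  obtain ⟨S, x, y, z, hS, hx, h0, h1⟩ := key'
  have hn := h.quatNorm_of_mat h2 hx
  simp only [quatNorm] at hn
  have hxe : x = -2⁻¹ := by field_simp; linear_combination h1
  have hz : z = 2⁻¹ - y := by rw [hxe] at h0; linear_combination h0
  have hy : (2 * y - c) * (2 * y - (1 - c)) = 0 := by
    rw [hxe, hz] at hn
    field_simp at hn
    have : 2 * ((2 * y - c) * (2 * y - (1 - c))) = 0 := by linear_combination hn - 2 * hc
    exact (mul_eq_zero.1 this).resolve_left h2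
  rcases mul_eq_zero.1 hy with hy | hy
  · refine ⟨I, J, h, hI.mem, hW.mem, ?_⟩
    have hy' : y = 2⁻¹ * c := by field_simp; linear_combination hy
    rw [h.eq_of_hom (h.mat_eltS h2 hc) hx (by rw [hxe, hz, hy']; ext <;> simp; ring)]
    exact hS.mem
  · have hy' : y = 2⁻¹ * (1 - c) := by field_simp; linear_combination hy
    -- The pair (-I, IJ) has third element J, so it interchanges the last two coordinates and turns
    -- the root 1 - c into c. Its standard generators are IW⁻¹I⁻¹ and -ISI⁻¹, which lie in H.
    have h' : IsQuatPair (-I) (I * J) :=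
      ⟨by simp [h.sqI], h.sqK, by
        rw [mul_neg, neg_mul, neg_neg, mul_assoc, h.anti, mul_neg, ← mul_assoc, h.sqI, neg_neg]⟩
    have hK' : -I * (I * J) = J := by rw [neg_mul, ← mul_assoc, h.sqI, neg_one_mul, neg_neg]
    have hII := h.mat_inv_hom h2 h.hom_i.symm
    refine ⟨-I, I * J, h', (hI.neg hneg).mem, ?_, ?_⟩
    · have : h'.eltW h2 = I * (h.eltW h2)⁻¹ * I⁻¹ := by
        apply mat_injective
        rw [h.mat_mul_hom (h.mat_mul_hom h.hom_i.symm (h.mat_inv_hom h2 (h.mat_eltW h2))) hII,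
          h'.mat_eltW, h.hom_apply, h'.hom_apply, hK', mat_neg]
        simp [-map_mul]
        module
      rw [this]
      exact mul_mem (mul_mem hI.mem (inv_mem hW.mem)) (inv_mem hI.mem)
    · have : h'.eltS h2 hc = -(I * S * I⁻¹) := by
        apply mat_injective
        rw [h.mat_neg_hom (h.mat_mul_hom (h.mat_mul_hom h.hom_i.symm hx) hII),
          h'.mat_eltS, h.hom_apply, h'.hom_apply, hK', mat_neg, hxe, hz, hy']
        simp [-map_mul]
        rw [show 2⁻¹ - 2⁻¹ * (1 - c) = 2⁻¹ * c by ring]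
        abel
      rw [this]
      exact ((hI.mul hS).mul hI.inv |>.neg hneg).mem
theorem eq_closure_of_projIso_alternatingGroup_four [Finite F] (h2 : (2 : F) ≠ 0) (hneg : -1 ∈ H)
    (hH : ProjIso (alternatingGroup (Fin 4)) H) (hc : Nat.card H = 24) :
    ∃ (I J : SL(2, F)) (h : IsQuatPair I J), H = Subgroup.closure {I, h.eltW h2} := by
  obtain ⟨f⟩ := hH
  -- Two generators of the Klein four-group, and a 3-cycle w carrying i to j and j to ij under
  -- conjugation.
  let i : Equiv.Perm (Fin 4) := Equiv.swap 0 1 * Equiv.swap 2 3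
  let j : Equiv.Perm (Fin 4) := Equiv.swap 0 2 * Equiv.swap 1 3
  let w : Equiv.Perm (Fin 4) := Equiv.swap 1 2 * Equiv.swap 2 3
  obtain ⟨I, J, h, hI, hJ, hW⟩ := exists_eltW_mem (f := f) h2 hneg
    (i := ⟨i, Equiv.Perm.mem_alternatingGroup.2 (by decide)⟩) (j := ⟨j, Equiv.Perm.mem_alternatingGroup.2 (by decide)⟩) (w := ⟨w, Equiv.Perm.mem_alternatingGroup.2 (by decide)⟩)
    (by decide) (by decide) (by decide) (by decide) (by decide) (by decide) (by decide) (by decide)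
  have hle : Subgroup.closure {I, h.eltW h2} ≤ H := by
    rw [Subgroup.closure_le]
    rintro x (rfl | rfl)
    exacts [hI.mem, hW.mem]
  have : Finite H := Nat.finite_of_card_ne_zero (by omega)
  exact ⟨I, J, h, (Subgroup.eq_of_le_of_card_ge hle (by
    rw [hc, (h.isQuatTriple h2).card_closure h2])).symm⟩

theorem eq_closure_of_projIso_perm_four [Finite F] (h2 : (2 : F) ≠ 0) (hneg : -1 ∈ H)
    (hH : ProjIso (Equiv.Perm (Fin 4)) H) (hc : Nat.card H = 48) {c : F} (hcc : 2 * c ^ 2 = 1) :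
    ∃ (I J : SL(2, F)) (h : IsQuatPair I J),
      H = Subgroup.closure {I, h.eltW h2, h.eltR h2 hcc} := by
  obtain ⟨f⟩ := hH
  obtain ⟨I, J, h, hI, hJ, hW⟩ := exists_eltW_mem (f := f) h2 hneg
    (i := Equiv.swap 0 1 * Equiv.swap 2 3) (j := Equiv.swap 0 2 * Equiv.swap 1 3)
    (w := Equiv.swap 1 2 * Equiv.swap 2 3)
    (by decide) (by decide) (by decide) (by decide) (by decide) (by decide) (by decide) (by decide)
  have hR := eltR_mem (f := f) h2 hneg
    -- A 4-cycle with square i.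
    (r := Equiv.swap 0 1 * Equiv.swap 0 2 * Equiv.swap 1 3) (by decide) (by decide) h hI hcc
  have hle : Subgroup.closure {I, h.eltW h2, h.eltR h2 hcc} ≤ H := by
    rw [Subgroup.closure_le]
    rintro x (rfl | rfl | rfl)
    exacts [hI.mem, hW.mem, hR]
  have : Finite H := Nat.finite_of_card_ne_zero (by omega)
  exact ⟨I, J, h, (Subgroup.eq_of_le_of_card_ge hle (by
    rw [hc, (h.isOctahedral h2 hcc).card_closure h2])).symm⟩

theorem eq_closure_of_projIso_alternatingGroup_five [Finite F] (h2 : (2 : F) ≠ 0) (hneg : -1 ∈ H)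
    (hH : ProjIso (alternatingGroup (Fin 5)) H) (hc : Nat.card H = 120) {c : F}
    (hcc : c ^ 2 = c + 1) :
    ∃ (I J : SL(2, F)) (h : IsQuatPair I J),
      H = Subgroup.closure {I, h.eltW h2, h.eltS h2 hcc} := by
  obtain ⟨f⟩ := hH
  let i : Equiv.Perm (Fin 5) := Equiv.swap 0 1 * Equiv.swap 2 3
  let j : Equiv.Perm (Fin 5) := Equiv.swap 0 2 * Equiv.swap 1 3
  let w : Equiv.Perm (Fin 5) := Equiv.swap 1 2 * Equiv.swap 2 3
  -- An involution moving the point 4, inverting w and with si of order 3.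
  let s : Equiv.Perm (Fin 5) := Equiv.swap 0 4 * Equiv.swap 2 3
  obtain ⟨I, J, h, hI, hJ, hW⟩ := exists_eltW_mem (f := f) h2 hneg
    (i := ⟨i, Equiv.Perm.mem_alternatingGroup.2 (by decide)⟩) (j := ⟨j, Equiv.Perm.mem_alternatingGroup.2 (by decide)⟩) (w := ⟨w, Equiv.Perm.mem_alternatingGroup.2 (by decide)⟩)
    (by decide) (by decide) (by decide) (by decide) (by decide) (by decide) (by decide) (by decide)
  obtain ⟨I, J, h, hI, hW, hS⟩ := exists_eltS_mem (f := f) h2 hneg (s := ⟨s, Equiv.Perm.mem_alternatingGroup.2 (by decide)⟩)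
    (by decide) (by decide) (by decide) (by decide) (by decide) h hI hW hcc
  have hle : Subgroup.closure {I, h.eltW h2, h.eltS h2 hcc} ≤ H := by
    rw [Subgroup.closure_le]
    rintro x (rfl | rfl | rfl)
    exacts [hI, hW, hS]
  have : Finite H := Nat.finite_of_card_ne_zero (by omega)
  exact ⟨I, J, h, (Subgroup.eq_of_le_of_card_ge hle (by
    rw [hc, (h.isIcosahedral h2 hcc).card_closure h2])).symm⟩

end Lifting

end HallPi


namespace HallPi

/-! ### Determinants modulo squares, and how GL₂-orbits split in SL₂. -/

section Squares

variable {F : Type*} [Field F]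

theorem isSquare_mul_of_not_isSquare [Finite F] {a b : F} (ha : ¬ IsSquare a) (hb : ¬ IsSquare b) :
    IsSquare (a * b) := by
  classical
  have := Fintype.ofFinite F
  have ha0 : a ≠ 0 := by rintro rfl; exact ha (IsSquare.zero)
  have hb0 : b ≠ 0 := by rintro rfl; exact hb (IsSquare.zero)
  rw [← quadraticChar_one_iff_isSquare (mul_ne_zero ha0 hb0), map_mul,
    (quadraticChar_neg_one_iff_not_isSquare).2 ha, (quadraticChar_neg_one_iff_not_isSquare).2 hb]
  norm_num

theorem not_isSquare_mul {a b : F} (ha : IsSquare a) (ha0 : a ≠ 0) (hb : ¬ IsSquare b) :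
    ¬ IsSquare (a * b) := by
  intro h
  apply hb
  have := h.mul ha.inv
  rwa [mul_comm, inv_mul_cancel_left₀ ha0] at this

end Squares

section Conjugacy

open Matrix
open scoped MatrixGroups Quaternion

variable {F : Type*} [Field F]

theorem card_map_conjGL (u : GL (Fin 2) F) (H : Subgroup SL(2, F)) :
    Nat.card (H.map (conjGL u).toMonoidHom) = Nat.card H :=
  (Nat.card_congr ((conjGL u).subgroupMap H).toEquiv).symm

theorem map_conjGL_mul (u v : GL (Fin 2) F) (H : Subgroup SL(2, F)) :
    H.map (conjGL (u * v)).toMonoidHom =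
      (H.map (conjGL v).toMonoidHom).map (conjGL u).toMonoidHom := by
  rw [Subgroup.map_map, map_mul]; rfl

theorem map_conjGL_one (H : Subgroup SL(2, F)) : H.map (conjGL 1).toMonoidHom = H := by
  rw [map_one]; exact Subgroup.map_id H

theorem map_conjGL_toGL_of_mem {H : Subgroup SL(2, F)} {g : SL(2, F)} (hg : g ∈ H) :
    H.map (conjGL (toGL g)).toMonoidHom = H := by
  rw [conjGL_toGL]
  exact Subgroup.conj_smul_eq_self_of_mem hg

theorem map_conjGL_eq_of_le [Finite F] {u : GL (Fin 2) F} {H : Subgroup SL(2, F)}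
    (h : H.map (conjGL u).toMonoidHom ≤ H) : H.map (conjGL u).toMonoidHom = H :=
  Subgroup.eq_of_le_of_card_ge h (card_map_conjGL u H).ge

theorem det_ne_zero (u : GL (Fin 2) F) : u.1.det ≠ 0 :=
  ((isUnit_iff_isUnit_det u.1).1 u.isUnit).ne_zero

theorem det_toGL (g : SL(2, F)) : (toGL g).1.det = 1 := det_mat g

/-- The subgroups with property `T` form two conjugacy classes, which are fused in `GL₂`. -/
def TwoGLClasses (T : Subgroup SL(2, F) → Prop) : Prop :=
  ∃ H₁ H₂ : Subgroup SL(2, F), T H₁ ∧ T H₂ ∧ ¬ ConjSub H₁ H₂ ∧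
    (∀ K, T K ↔ ConjSub H₁ K ∨ ConjSub H₂ K) ∧
    ∃ u : GL (Fin 2) F, H₁.map (conjGL u).toMonoidHom = H₂ ∧
      ConjSub H₁ (H₂.map (conjGL u).toMonoidHom)

theorem exists_det_eq (a : F) (ha : a ≠ 0) : ∃ u : GL (Fin 2) F, u.1.det = a := by
  refine ⟨GeneralLinearGroup.mkOfDetNeZero !![a, 0; 0, 1] (by simpa using ha), ?_⟩
  simp [GeneralLinearGroup.mkOfDetNeZero]

/-- Squares have index 2 in the multiplicative group. If every matrix stabilizing H has square
determinant, then the GL₂-orbit of H breaks into two SL₂-classes, exchanged by any v of nonsquare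
determinant. -/
theorem twoGLClasses_of_normalizer [Finite F] (h2 : (2 : F) ≠ 0) {T : Subgroup SL(2, F) → Prop}
    {H : Subgroup SL(2, F)} (hT : ∀ K, T K ↔ ∃ u, H.map (conjGL u).toMonoidHom = K)
    (hH : ∀ u, H.map (conjGL u).toMonoidHom = H → IsSquare u.1.det) : TwoGLClasses T := by
  obtain ⟨a, ha⟩ := FiniteField.exists_nonsquare (F := F) (by
    intro h
    have := ringChar.Nat.cast_ringChar (R := F)
    rw [h] at this
    exact h2 (by exact_mod_cast this))
  obtain ⟨v, hv⟩ := exists_det_eq a (by rintro rfl; exact ha IsSquare.zero)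
  refine ⟨H, H.map (conjGL v).toMonoidHom, (hT _).2 ⟨1, map_conjGL_one H⟩, (hT _).2 ⟨v, rfl⟩,
    ?_, ?_, v, rfl, ?_⟩
  · rintro ⟨g, hg⟩
    have := hH (toGL g⁻¹ * v) (by
      rw [map_conjGL_mul, hg, ← conjGL_toGL, ← map_conjGL_mul]
      convert map_conjGL_one H
      ext1
      change mat g⁻¹ * mat g = 1
      rw [← map_mul]; simp)
    rw [Units.val_mul, det_mul, det_toGL, one_mul, hv] at this
    exact ha this
  · intro K
    rw [hT]
    constructor
    · rintro ⟨u, rfl⟩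
      by_cases hu : IsSquare u.1.det
      · exact Or.inl (ConjSub.of_conjGL hu rfl)
      · right
        refine ConjSub.of_conjGL (u := u * v⁻¹) ?_ (by
          rw [← map_conjGL_mul, inv_mul_cancel_right])
        have h1 : (u * v⁻¹).1.det * (v.1.det * v.1.det) = u.1.det * v.1.det := by
          rw [← mul_assoc, ← det_mul, ← Units.val_mul, inv_mul_cancel_right]
        have h3 := isSquare_mul_of_not_isSquare hu (hv ▸ ha)
        rw [← h1] at h3
        by_contra hns
        refine not_isSquare_mul (⟨v.1.det, rfl⟩ : IsSquare (v.1.det * v.1.det)) ?_ hns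
          (by rwa [mul_comm])
        exact mul_ne_zero (det_ne_zero v) (det_ne_zero v)
    · rintro (⟨g, rfl⟩ | ⟨g, rfl⟩)
      · exact ⟨toGL g, by rw [conjGL_toGL]⟩
      · exact ⟨toGL g * v, by rw [map_conjGL_mul, conjGL_toGL]⟩
  · rw [← map_conjGL_mul]
    exact ConjSub.of_conjGL (u := v * v) (by rw [Units.val_mul, det_mul]; exact ⟨_, rfl⟩) rfl

theorem exists_conj_of_card_eq_sylow {G : Type*} [Group G] [Finite G] {p : ℕ} [Fact p.Prime]
    {A Q Q' : Subgroup G} (hQ : Q ≤ A) (hQ' : Q' ≤ A)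
    (hc : Nat.card Q = p ^ (Nat.card A).factorization p)
    (hc' : Nat.card Q' = p ^ (Nat.card A).factorization p) :
    ∃ a ∈ A, Q.map (MulAut.conj a).toMonoidHom = Q' := by
  have e := Nat.card_congr (Subgroup.subgroupOfEquivOfLe hQ).toEquiv
  have e' := Nat.card_congr (Subgroup.subgroupOfEquivOfLe hQ').toEquiv
  obtain ⟨a, ha⟩ := MulAction.exists_smul_eq A (Sylow.ofCard (Q.subgroupOf A) (e.trans hc))
    (Sylow.ofCard (Q'.subgroupOf A) (e'.trans hc'))
  refine ⟨a, a.2, ?_⟩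
  have h1 : (Q.subgroupOf A).map (MulAut.conj a).toMonoidHom = Q'.subgroupOf A :=
    congrArg Sylow.toSubgroup ha
  have h2 := congrArg (Subgroup.map A.subtype) h1
  rw [Subgroup.map_subgroupOf_eq_of_le hQ', Subgroup.map_map] at h2
  rw [← h2, show Q.map (MulAut.conj (a : G)).toMonoidHom =
    ((Q.subgroupOf A).map A.subtype).map (MulAut.conj (a : G)).toMonoidHom by
      rw [Subgroup.map_subgroupOf_eq_of_le hQ], Subgroup.map_map]
  rfl

namespace IsQuatPair

variable {I J : SL(2, F)}

theorem conjGL_eltW (h2 : (2 : F) ≠ 0) (h : IsQuatPair I J) (u : GL (Fin 2) F) :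
    conjGL u (h.eltW h2) = (h.map_conjGL u).eltW h2 := by
  apply mat_injective
  rw [mat_conjGL, mat_eltW, mat_eltW, conjGL_hom]

theorem conjGL_eltR (h2 : (2 : F) ≠ 0) (h : IsQuatPair I J) (u : GL (Fin 2) F) {c : F}
    (hc : 2 * c ^ 2 = 1) : conjGL u (h.eltR h2 hc) = (h.map_conjGL u).eltR h2 hc := by
  apply mat_injective
  rw [mat_conjGL, mat_eltR, mat_eltR, conjGL_hom]

theorem conjGL_eltS (h2 : (2 : F) ≠ 0) (h : IsQuatPair I J) (u : GL (Fin 2) F) {c : F}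
    (hc : c ^ 2 = c + 1) : conjGL u (h.eltS h2 hc) = (h.map_conjGL u).eltS h2 hc := by
  apply mat_injective
  rw [mat_conjGL, mat_eltS, mat_eltS, conjGL_hom]

theorem map_tetrahedral (h2 : (2 : F) ≠ 0) (h : IsQuatPair I J) (u : GL (Fin 2) F) :
    (Subgroup.closure {I, h.eltW h2}).map (conjGL u).toMonoidHom =
      Subgroup.closure {conjGL u I, (h.map_conjGL u).eltW h2} := by
  rw [MonoidHom.map_closure, Set.image_pair, ← conjGL_eltW]; rfl

theorem map_octahedral (h2 : (2 : F) ≠ 0) (h : IsQuatPair I J) (u : GL (Fin 2) F) {c : F}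
    (hc : 2 * c ^ 2 = 1) :
    (Subgroup.closure {I, h.eltW h2, h.eltR h2 hc}).map (conjGL u).toMonoidHom =
      Subgroup.closure {conjGL u I, (h.map_conjGL u).eltW h2, (h.map_conjGL u).eltR h2 hc} := by
  rw [MonoidHom.map_closure, Set.image_insert_eq, Set.image_pair, ← conjGL_eltW, ← conjGL_eltR]
  rfl

theorem map_icosahedral (h2 : (2 : F) ≠ 0) (h : IsQuatPair I J) (u : GL (Fin 2) F) {c : F}
    (hc : c ^ 2 = c + 1) :
    (Subgroup.closure {I, h.eltW h2, h.eltS h2 hc}).map (conjGL u).toMonoidHom =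
      Subgroup.closure {conjGL u I, (h.map_conjGL u).eltW h2, (h.map_conjGL u).eltS h2 hc} := by
  rw [MonoidHom.map_closure, Set.image_insert_eq, Set.image_pair, ← conjGL_eltW, ← conjGL_eltS]
  rfl

theorem exists_unit (h2 : (2 : F) ≠ 0) (h : IsQuatPair I J) :
    ∃ v : GL (Fin 2) F, v.1 = h.hom ⟨1, 1, 0, 0⟩ := by
  have : IsUnit (h.hom ⟨1, 1, 0, 0⟩) := by
    rw [isUnit_iff_isUnit_det, h.det_hom h2]
    simp only [quatNorm]
    rw [isUnit_iff_ne_zero]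
    convert h2 using 1; norm_num
  exact this

/-- The element `1 + i`, of determinant `2`. -/
noncomputable def eltV (h2 : (2 : F) ≠ 0) (h : IsQuatPair I J) : GL (Fin 2) F :=
  (h.exists_unit h2).choose

theorem eltV_val (h2 : (2 : F) ≠ 0) (h : IsQuatPair I J) :
    (h.eltV h2).1 = h.hom ⟨1, 1, 0, 0⟩ :=
  (h.exists_unit h2).choose_spec

theorem det_eltV (h2 : (2 : F) ≠ 0) (h : IsQuatPair I J) : (h.eltV h2).1.det = 2 := by
  rw [h.eltV_val, h.det_hom h2]; simp only [quatNorm]; norm_num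

theorem conjGL_eltV (h2 : (2 : F) ≠ 0) (h : IsQuatPair I J) {g g' : SL(2, F)}
    {x x' : ℍ[F,-1,-1]} (hg : mat g = h.hom x) (hg' : mat g' = h.hom x')
    (hx : ⟨1, 1, 0, 0⟩ * x = x' * ⟨1, 1, 0, 0⟩) : conjGL (h.eltV h2) g = g' := by
  rw [conjGL_eq_iff, hg, hg', eltV_val, ← map_mul, ← map_mul, hx]

theorem conjGL_eltV_I (h2 : (2 : F) ≠ 0) (h : IsQuatPair I J) : conjGL (h.eltV h2) I = I :=
  h.conjGL_eltV h2 h.hom_i.symm h.hom_i.symm (by ext <;> simp)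

theorem conjGL_eltV_J (h2 : (2 : F) ≠ 0) (h : IsQuatPair I J) : conjGL (h.eltV h2) J = I * J :=
  h.conjGL_eltV h2 h.hom_j.symm h.hom_k.symm (by ext <;> simp)

theorem conjGL_eltV_W (h2 : (2 : F) ≠ 0) (h : IsQuatPair I J) :
    conjGL (h.eltV h2) (h.eltW h2) = J * (h.eltW h2)⁻¹ * J⁻¹ :=
  h.conjGL_eltV h2 (h.mat_eltW h2) (h.mat_mul_hom (h.mat_mul_hom h.hom_j.symm
    (h.mat_inv_hom h2 (h.mat_eltW h2))) (h.mat_inv_hom h2 h.hom_j.symm))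
    (by ext <;> simp)

theorem map_eltV_tetrahedral [Finite F] (h2 : (2 : F) ≠ 0) (h : IsQuatPair I J) :
    (Subgroup.closure {I, h.eltW h2}).map (conjGL (h.eltV h2)).toMonoidHom =
      Subgroup.closure {I, h.eltW h2} := by
  apply map_conjGL_eq_of_le
  have hI : I ∈ Subgroup.closure {I, h.eltW h2} := Subgroup.subset_closure (by simp)
  have hW : h.eltW h2 ∈ Subgroup.closure {I, h.eltW h2} := Subgroup.subset_closure (by simp)
  have hJ : J ∈ Subgroup.closure {I, h.eltW h2} := (h.isQuatTriple h2).J_mem (by simp) (by simp)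
  rw [Subgroup.map_le_iff_le_comap, Subgroup.closure_le]
  rintro x (rfl | rfl)
  · rw [SetLike.mem_coe, Subgroup.mem_comap]
    change conjGL (h.eltV h2) x ∈ Subgroup.closure {x, h.eltW h2}
    rwa [h.conjGL_eltV_I h2]
  · rw [SetLike.mem_coe, Subgroup.mem_comap]
    change conjGL (h.eltV h2) (h.eltW h2) ∈ Subgroup.closure {I, h.eltW h2}
    rw [h.conjGL_eltV_W h2]
    exact mul_mem (mul_mem hJ (inv_mem hW)) (inv_mem hJ)

/-- The matrix 1 + i normalizes the tetrahedral group and has determinant 2. When 2 is a nonsquare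
it corrects a conjugating matrix of nonsquare determinant. -/
theorem conjSub_tetrahedral [Finite F] (h2 : (2 : F) ≠ 0) (hns : ¬ IsSquare (2 : F))
    (h : IsQuatPair I J) {I' J' : SL(2, F)} (h' : IsQuatPair I' J') :
    ConjSub (Subgroup.closure {I, h.eltW h2}) (Subgroup.closure {I', h'.eltW h2}) := by
  obtain ⟨u, rfl, rfl⟩ := exists_conjGL_pair h2 h h'
  by_cases hu : IsSquare u.1.det
  · exact ConjSub.of_conjGL hu (h.map_tetrahedral h2 u)
  · refine ConjSub.of_conjGL (u := u * h.eltV h2) ?_ ?_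
    · rw [Units.val_mul, det_mul, h.det_eltV h2]
      exact isSquare_mul_of_not_isSquare hu hns
    · rw [map_conjGL_mul, h.map_eltV_tetrahedral h2, h.map_tetrahedral h2]

/-- A matrix commuting with I and J is a scalar a, of determinant a². -/
theorem conjGL_eq_one (h2 : (2 : F) ≠ 0) (h : IsQuatPair I J) {u : GL (Fin 2) F}
    (hI : conjGL u I = I) (hJ : conjGL u J = J) : conjGL u = 1 ∧ IsSquare u.1.det := by
  obtain ⟨⟨a, b, c, d⟩, hx⟩ := h.hom_surjective h2 u.1
  rw [conjGL_eq_iff, ← hx] at hI hJ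
  rw [← h.hom_i, ← map_mul, ← map_mul] at hI
  rw [← h.hom_j, ← map_mul, ← map_mul] at hJ
  have e1 := h.hom_injective h2 hI
  have e2 := h.hom_injective h2 hJ
  simp only [QuaternionAlgebra.mk_mul_mk, QuaternionAlgebra.mk.injEq] at e1 e2
  have hb : b = 0 := by
    refine (mul_eq_zero.1 (?_ : 2 * b = 0)).resolve_left h2; linear_combination e2.2.2.2
  have hc : c = 0 := by
    refine (mul_eq_zero.1 (?_ : 2 * c = 0)).resolve_left h2; linear_combination -e1.2.2.2
  have hd : d = 0 := by
    refine (mul_eq_zero.1 (?_ : 2 * d = 0)).resolve_left h2; linear_combination e1.2.2.1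
  subst hb hc hd
  constructor
  · ext1 g
    change conjGL u g = g
    rw [conjGL_eq_iff, ← hx, h.hom_apply]
    simp
  · rw [← hx, h.det_hom h2]
    exact ⟨a, by simp only [quatNorm]; ring⟩

theorem mem_quat [Finite F] (h2 : (2 : F) ≠ 0) (h : IsQuatPair I J) {g : SL(2, F)}
    (hg : g ∈ Subgroup.closure {I, J}) (hsq : g * g = -1) :
    g = I ∨ g = -I ∨ g = J ∨ g = -J ∨ g = I * J ∨ g = -(I * J) := by
  have key : (Subgroup.closure {I, J} : Set SL(2, F)) ⊆
      {1, -1, I, -I, J, -J, I * J, -(I * J)} := by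
    have hII : I * J * I = J := by rw [mul_assoc, h.anti, mul_neg, ← mul_assoc, h.sqI]; simp
    have hJJ : I * J * J = -I := by rw [mul_assoc, h.sqJ]; simp
    refine closure_subset_of_mul_right (by simp) ?_
    intro x hx y hy
    simp only [Set.mem_insert_iff, Set.mem_singleton_iff] at hx hy ⊢
    rcases hy with rfl | rfl <;>
      rcases hx with rfl | rfl | rfl | rfl | rfl | rfl | rfl | rfl <;>
      simp [h.sqI, h.sqJ, h.anti, hII, hJJ]
  have hg := key hg
  simp only [Set.mem_insert_iff, Set.mem_singleton_iff] at hg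
  rcases hg with rfl | rfl | h' | h' | h' | h' | h' | h'
  · exact absurd hsq (by simpa using SL2_one_ne_neg_one h2)
  · exact absurd hsq (by simpa using SL2_one_ne_neg_one h2)
  all_goals simp [h']

/-- A matrix normalizing ⟨I, J⟩ permutes ±I, ±J, ±IJ. The tetrahedral group acts transitively on
these six elements: powers of W bring the image of I to ±I, then J and I correct signs. Only J ↦ J
or J ↦ IJ remains, reflecting Sym₄ modulo Alt₄. -/
theorem exists_conjGL_standard [Finite F] (h2 : (2 : F) ≠ 0) (h : IsQuatPair I J)
    {u : GL (Fin 2) F} (hI : conjGL u I ∈ Subgroup.closure {I, J})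
    (hJ : conjGL u J ∈ Subgroup.closure {I, J}) :
    ∃ t ∈ Subgroup.closure {I, h.eltW h2}, conjGL (toGL t * u) I = I ∧
      (conjGL (toGL t * u) J = J ∨ conjGL (toGL t * u) J = I * J) := by
  have hT := h.isQuatTriple h2
  have mI : I ∈ Subgroup.closure {I, h.eltW h2} := Subgroup.subset_closure (by simp)
  have mW : h.eltW h2 ∈ Subgroup.closure {I, h.eltW h2} := Subgroup.subset_closure (by simp)
  have mJ : J ∈ Subgroup.closure {I, h.eltW h2} := hT.J_mem (by simp) (by simp)
  have qI : I ∈ Subgroup.closure {I, J} := Subgroup.subset_closure (by simp)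
  have qJ : J ∈ Subgroup.closure {I, J} := Subgroup.subset_closure (by simp)
  have hmul : ∀ (t : SL(2, F)) (u : GL (Fin 2) F) (g : SL(2, F)),
      conjGL (toGL t * u) g = t * conjGL u g * t⁻¹ := by
    intro t u g
    rw [map_mul, MulAut.mul_apply, conjGL_toGL, MulAut.conj_apply]
  have hstep : ∀ (u : GL (Fin 2) F), ∀ t ∈ Subgroup.closure {I, h.eltW h2},
      (∃ t' ∈ Subgroup.closure {I, h.eltW h2}, conjGL (toGL t' * (toGL t * u)) I = I ∧
        (conjGL (toGL t' * (toGL t * u)) J = J ∨ conjGL (toGL t' * (toGL t * u)) J = I * J)) →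
      ∃ t ∈ Subgroup.closure {I, h.eltW h2}, conjGL (toGL t * u) I = I ∧
        (conjGL (toGL t * u) J = J ∨ conjGL (toGL t * u) J = I * J) := by
    rintro u t ht ⟨t', ht', h'⟩
    refine ⟨t' * t, mul_mem ht' ht, ?_⟩
    simp only [hmul] at h' ⊢
    simpa only [_root_.mul_inv_rev, mul_assoc] using h'
  have hQ : ∀ (t : SL(2, F)) (u : GL (Fin 2) F),
      t ∈ Subgroup.normalizer (Subgroup.closure {I, J} : Set SL(2, F)) → ∀ g,
      conjGL u g ∈ Subgroup.closure {I, J} → conjGL (toGL t * u) g ∈ Subgroup.closure {I, J} := by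
    intro t u ht g hg
    rw [hmul]
    exact (Subgroup.mem_normalizer_iff.1 ht _).1 hg
  have hsq : ∀ (u : GL (Fin 2) F) {g : SL(2, F)}, g * g = -1 →
      conjGL u g * conjGL u g = -1 := by
    intro u g hg
    rw [← map_mul, hg, conjGL_neg, map_one]
  have hIJ : I * J * I⁻¹ = -J := by rw [mul_inv_eq_iff_eq_mul, neg_mul, h.anti, neg_neg]
  have hJI : J * I * J⁻¹ = -I := by rw [mul_inv_eq_iff_eq_mul, neg_mul, h.anti]
  have nI := Subgroup.le_normalizer qI
  have nJ := Subgroup.le_normalizer qJ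
  have nW := hT.W_mem_normalizer
  have s1 : ∀ u : GL (Fin 2) F, conjGL u I = I → conjGL u J ∈ Subgroup.closure {I, J} →
      ∃ t ∈ Subgroup.closure {I, h.eltW h2}, conjGL (toGL t * u) I = I ∧
        (conjGL (toGL t * u) J = J ∨ conjGL (toGL t * u) J = I * J) := by
    intro u hI hJ
    have hanti : conjGL u J * I = -(I * conjGL u J) := by
      have := congrArg (conjGL u) h.anti
      rwa [conjGL_neg, map_mul, map_mul, hI] at this
    rcases h.mem_quat h2 hJ (hsq u h.sqJ) with h' | h' | h' | h' | h' | h'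
    · rw [h', h.sqI] at hanti
      exact absurd hanti (by simpa using (SL2_one_ne_neg_one h2).symm)
    · rw [h', neg_mul, mul_neg, h.sqI] at hanti
      exact absurd hanti (by simpa using SL2_one_ne_neg_one h2)
    · exact ⟨1, one_mem _, by rw [hmul, hI]; simp, Or.inl (by rw [hmul, h']; simp)⟩
    · refine ⟨I, mI, by rw [hmul, hI]; simp, Or.inl ?_⟩
      rw [hmul, h', mul_neg, neg_mul, hIJ, neg_neg]
    · exact ⟨1, one_mem _, by rw [hmul, hI]; simp, Or.inr (by rw [hmul, h']; simp)⟩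
    · refine ⟨I, mI, by rw [hmul, hI]; simp, Or.inr ?_⟩
      rw [hmul, h', mul_neg, neg_mul, mul_assoc, mul_assoc, ← mul_assoc I J, hIJ, mul_neg, neg_neg]
  have s2 : ∀ u : GL (Fin 2) F, conjGL u I = I ∨ conjGL u I = -I →
      conjGL u J ∈ Subgroup.closure {I, J} →
      ∃ t ∈ Subgroup.closure {I, h.eltW h2}, conjGL (toGL t * u) I = I ∧
        (conjGL (toGL t * u) J = J ∨ conjGL (toGL t * u) J = I * J) := by
    rintro u (hI | hI) hJ
    · exact s1 u hI hJ
    · refine hstep u J mJ (s1 _ ?_ (hQ _ _ nJ _ hJ))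
      rw [hmul, hI, mul_neg, neg_mul, hJI, neg_neg]
  rcases h.mem_quat h2 hI (hsq u h.sqI) with h' | h' | h' | h' | h' | h'
  · exact s2 u (Or.inl h') hJ
  · exact s2 u (Or.inr h') hJ
  · refine hstep u _ (inv_mem mW) (s2 _ (Or.inl ?_) (hQ _ _ (inv_mem nW) _ hJ))
    rw [hmul, h']; nth_rw 2 [hT.W_mul_I]; group
  · refine hstep u _ (inv_mem mW) (s2 _ (Or.inr ?_) (hQ _ _ (inv_mem nW) _ hJ))
    rw [hmul, h', mul_neg, neg_mul]; nth_rw 2 [hT.W_mul_I]; group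
  · refine hstep u _ mW (s2 _ (Or.inl ?_) (hQ _ _ nW _ hJ))
    rw [hmul, h', hT.conjK, mul_inv_cancel_right]
  · refine hstep u _ mW (s2 _ (Or.inr ?_) (hQ _ _ nW _ hJ))
    rw [hmul, h', mul_neg, neg_mul, hT.conjK, mul_inv_cancel_right]

/-- After correction by the tetrahedral group the matrix acts as 1 or as 1 + i, hence equals one of
these up to a scalar; its determinant is a square or twice a square. -/
theorem exists_conjGL_eq [Finite F] (h2 : (2 : F) ≠ 0) (h : IsQuatPair I J)
    {u : GL (Fin 2) F} (hI : conjGL u I ∈ Subgroup.closure {I, J})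
    (hJ : conjGL u J ∈ Subgroup.closure {I, J}) :
    IsSquare u.1.det ∨ IsSquare (2 * u.1.det) ∧ ∃ t ∈ Subgroup.closure {I, h.eltW h2},
      conjGL (toGL t * u) = conjGL (h.eltV h2) := by
  obtain ⟨t, ht, htI, htJ | htJ⟩ := h.exists_conjGL_standard h2 hI hJ
  · left
    have := (h.conjGL_eq_one h2 htI htJ).2
    rwa [Units.val_mul, det_mul, det_toGL, one_mul] at this
  · right
    have key : ∀ g g', conjGL (toGL t * u) g = g' → conjGL (h.eltV h2) g = g' →
        conjGL ((h.eltV h2)⁻¹ * (toGL t * u)) g = g := by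
      intro g g' hg hg'
      rw [map_mul, MulAut.mul_apply, hg, map_inv, ← hg', MulAut.inv_apply_self]
    have h1 := h.conjGL_eq_one h2 (key _ _ htI (h.conjGL_eltV_I h2))
      (key _ _ htJ (h.conjGL_eltV_J h2))
    refine ⟨?_, t, ht, ?_⟩
    · have h3 : (h.eltV h2).1.det * ((h.eltV h2)⁻¹ * (toGL t * u)).1.det = u.1.det := by
        rw [← det_mul, ← Units.val_mul, mul_inv_cancel_left, Units.val_mul, det_mul, det_toGL,
          one_mul]
      rw [← h3, h.det_eltV, ← mul_assoc]
      exact IsSquare.mul ⟨2, rfl⟩ h1.2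
    · have := h1.1
      rwa [map_mul, map_inv, inv_mul_eq_one, eq_comm] at this

end IsQuatPair

end Conjugacy

end HallPi


namespace HallPi

/-! ### Normalizers of the octahedral and icosahedral groups in GL₂. -/

section Fusion

open Matrix
open scoped MatrixGroups Quaternion

variable {F : Type*} [Field F]

theorem alternatingGroup_five_pow (x : alternatingGroup (Fin 5)) :
    x ^ 2 = 1 ∨ x ^ 3 = 1 ∨ x ^ 5 = 1 := by
  have key : ∀ y : Equiv.Perm (Fin 5), Equiv.Perm.sign y = 1 → y ^ 2 = 1 ∨ y ^ 3 = 1 ∨ y ^ 5 = 1 := by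
    decide +kernel
  have := key x.1 (Equiv.Perm.mem_alternatingGroup.1 x.2)
  exact_mod_cast this

theorem Lifts.pow {X : Type*} [Group X] {H : Subgroup SL(2, F)} {f : proj H ≃* X} {g : SL(2, F)}
    {x : X} (h : Lifts f g x) (n : ℕ) : Lifts f (g ^ n) (x ^ n) := by
  obtain ⟨hg, rfl⟩ := h
  exact ⟨pow_mem hg n, by rw [← map_pow]; rfl⟩

theorem trace_of_projIso_alternatingGroup_five {H : Subgroup SL(2, F)}
    (hH : ProjIso (alternatingGroup (Fin 5)) H) {g : SL(2, F)} (hg : g ∈ H)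
    (h1 : g ≠ 1) (h1' : g ≠ -1) :
    (mat g).trace = 0 ∨ (mat g).trace ^ 2 = 1 ∨
      (mat g).trace ^ 4 - 3 * (mat g).trace ^ 2 + 1 = 0 := by
  obtain ⟨f⟩ := hH
  obtain ⟨x, hx⟩ : ∃ x, Lifts f g x := ⟨_, hg, rfl⟩
  rcases alternatingGroup_five_pow x with h | h | h
  · exact Or.inl (trace_eq_zero_of_sq h1 h1' ((hx.pow 2).eq_one_iff.1 h))
  · exact Or.inr (Or.inl (trace_sq_eq_one_of_cube h1 h1' ((hx.pow 3).eq_one_iff.1 h)))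
  · exact Or.inr (Or.inr (trace_of_pow_five h1 h1' ((hx.pow 5).eq_one_iff.1 h)))

namespace IsQuatPair

variable {I J : SL(2, F)}

/-- The quaternion group is normal of index 6, so it contains all sixth powers. As I and J are
squares of elements of order 8, applying u and taking sixth powers shows that u maps I and J into
it. Since 2 is a square, both possible determinants are squares. -/
theorem isSquare_det_of_map_octahedral [Finite F] (h2 : (2 : F) ≠ 0) (h : IsQuatPair I J) {c : F}
    (hc : 2 * c ^ 2 = 1) {u : GL (Fin 2) F}
    (hu : (Subgroup.closure {I, h.eltW h2, h.eltR h2 hc}).map (conjGL u).toMonoidHom =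
      Subgroup.closure {I, h.eltW h2, h.eltR h2 hc}) : IsSquare u.1.det := by
  have hO := h.isOctahedral h2 hc
  have hsq2 : IsSquare (2 : F) := by
    have hc0 : c ≠ 0 := by rintro rfl; simp at hc
    refine ⟨c⁻¹, ?_⟩
    field_simp
    linear_combination hc
  have mW : h.eltW h2 ∈ Subgroup.closure {I, h.eltW h2, h.eltR h2 hc} :=
    Subgroup.subset_closure (by simp)
  have mR : h.eltR h2 hc ∈ Subgroup.closure {I, h.eltW h2, h.eltR h2 hc} :=
    Subgroup.subset_closure (by simp)
  have hle := hO.le_normalizer_quat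
  have hQO := hO.quat_le.trans (IsOctahedral.T_le I _ (h.eltR h2 hc))
  have hneg : -1 ∈ Subgroup.closure {I, J} := by
    rw [← h.sqI]
    exact mul_mem (Subgroup.subset_closure (by simp)) (Subgroup.subset_closure (by simp))
  have key : ∀ x ∈ Subgroup.closure {I, h.eltW h2, h.eltR h2 hc}, ∀ y, x * x = y → y * y = -1 →
      conjGL u y ∈ Subgroup.closure {I, J} := by
    intro x hx y hxy hy
    have hmem : conjGL u x ∈ Subgroup.closure {I, h.eltW h2, h.eltR h2 hc} := by
      rw [← hu]; exact ⟨x, hx, rfl⟩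
    have h6 := pow_mem_of_le_normalizer hQO hle (m := 6) (by
      rw [hO.card_closure h2, h.card_closure h2]) hmem
    rw [show 6 = 2 * 3 by norm_num, pow_mul, sq, ← map_mul, hxy, pow_three, ← map_mul, hy,
      conjGL_neg, map_one, mul_neg_one] at h6
    simpa using mul_mem hneg h6
  have hI : conjGL u I ∈ Subgroup.closure {I, J} := key _ mR I hO.sqR h.sqI
  have hJ : conjGL u J ∈ Subgroup.closure {I, J} := by
    refine key _ (mul_mem (mul_mem mW mR) (inv_mem mW)) J ?_ h.sqJ
    rw [← sq, conj_pow, sq, hO.sqR]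
    exact hO.W_mul_I.symm
  rcases h.exists_conjGL_eq h2 hI hJ with h' | ⟨h', -⟩
  · exact h'
  · by_contra hns
    exact not_isSquare_mul hsq2 h2 hns h'

/-- The quaternion group is a Sylow 2-subgroup here, so u may be corrected inside the icosahedral
group to normalize it. If it then acts like 1 + i, the matrix 1 + i normalizes the icosahedral
group, which a trace computation refutes. -/
theorem isSquare_det_of_map_icosahedral [Finite F] {p : ℕ} [Fact p.Prime] [CharP F p]
    (hp5 : 5 < p) (h2 : (2 : F) ≠ 0)
    (h : IsQuatPair I J) {c : F} (hc : c ^ 2 = c + 1) {u : GL (Fin 2) F}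
    (hu : (Subgroup.closure {I, h.eltW h2, h.eltS h2 hc}).map (conjGL u).toMonoidHom =
      Subgroup.closure {I, h.eltW h2, h.eltS h2 hc}) : IsSquare u.1.det := by
  have hA := h.isIcosahedral h2 hc
  set A := Subgroup.closure {I, h.eltW h2, h.eltS h2 hc} with hAdef
  have hQA : Subgroup.closure {I, J} ≤ A := hA.quat_le.trans (IsIcosahedral.T_le I _ (h.eltS h2 hc))
  have hQA' : (Subgroup.closure {I, J}).map (conjGL u).toMonoidHom ≤ A := by
    rw [← hu]; exact Subgroup.map_mono hQA
  have hfac : 2 ^ (Nat.card A).factorization 2 = 8 := by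
    rw [hA.card_closure h2, show 120 = 2 ^ 3 * 15 by norm_num]
    rw [Nat.factorization_mul (by norm_num) (by norm_num), Finsupp.add_apply,
      Nat.factorization_pow, Finsupp.smul_apply, Nat.Prime.factorization_self Nat.prime_two,
      Nat.factorization_eq_zero_of_not_dvd (n := 15) (by norm_num)]
    rfl
  obtain ⟨a, ha, hQ⟩ := exists_conj_of_card_eq_sylow (p := 2) hQA' hQA
    (by rw [card_map_conjGL, h.card_closure h2, hfac]) (by rw [h.card_closure h2, hfac])
  rw [← conjGL_toGL, ← map_conjGL_mul] at hQ
  have hmem : ∀ g ∈ Subgroup.closure {I, J}, conjGL (toGL a * u) g ∈ Subgroup.closure {I, J} := by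
    intro g hg
    have : conjGL (toGL a * u) g ∈
        (Subgroup.closure {I, J}).map (conjGL (toGL a * u)).toMonoidHom := ⟨g, hg, rfl⟩
    rwa [hQ] at this
  have hdet : (toGL a * u).1.det = u.1.det := by
    rw [Units.val_mul, det_mul, det_toGL, one_mul]
  rcases h.exists_conjGL_eq h2 (hmem _ (Subgroup.subset_closure (by simp)))
    (hmem _ (Subgroup.subset_closure (by simp))) with h' | ⟨-, t, ht, hv⟩
  · rwa [hdet] at h'
  exfalso
  have htA : t ∈ A := IsIcosahedral.T_le I _ _ ht
  have mS : h.eltS h2 hc ∈ A := Subgroup.subset_closure (by simp)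
  have hmap : A.map (conjGL (h.eltV h2)).toMonoidHom = A := by
    rw [← hv, map_conjGL_mul, map_conjGL_mul, hu, map_conjGL_toGL_of_mem ha,
      map_conjGL_toGL_of_mem htA]
  have mS' : conjGL (h.eltV h2) (h.eltS h2 hc) ∈ A := by
    have : conjGL (h.eltV h2) (h.eltS h2 hc) ∈ A.map (conjGL (h.eltV h2)).toMonoidHom :=
      ⟨_, mS, rfl⟩
    rwa [hmap] at this
  have hS' : conjGL (h.eltV h2) (h.eltS h2 hc) =
      h.ofQuat h2 ⟨0, -2⁻¹, -(2⁻¹ * (1 - c)), 2⁻¹ * c⟩ (by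
        have := quatNorm_icosahedral h2 hc
        simp only [quatNorm] at this ⊢
        linear_combination this) :=
    h.conjGL_eltV h2 (h.mat_eltS h2 hc) (h.mat_ofQuat h2 _ _) (by ext <;> simp [add_comm])
  have hm := h.mat_mul_hom (h.mat_eltS h2 hc) (h.mat_ofQuat h2 ⟨0, -2⁻¹, -(2⁻¹ * (1 - c)), 2⁻¹ * c⟩ (by
        have := quatNorm_icosahedral h2 hc
        simp only [quatNorm] at this ⊢
        linear_combination this))
  rw [← hS'] at hm
  -- Noncentral elements of the icosahedral group have trace t with t = 0, t² = 1 or t⁴ - 3t² + 1 =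
  -- 0. The value -1/2 satisfies one of these, or t² = 4, only if 2, 3 or 5 vanishes in F.
  have htr : (mat (h.eltS h2 hc * conjGL (h.eltV h2) (h.eltS h2 hc))).trace = -2⁻¹ := by
    rw [hm, h.trace_hom h2]
    simp
    field_simp
    ring
  have hchar : ∀ n : ℕ, 0 < n → n ≤ 5 → (n : F) ≠ 0 := by
    intro n hn hn5 h0
    have := Nat.le_of_dvd hn ((CharP.cast_eq_zero_iff F p n).1 h0)
    omega
  have h3 : (3 : F) ≠ 0 := by exact_mod_cast hchar 3 (by norm_num) (by norm_num)
  have h5 : (5 : F) ≠ 0 := by exact_mod_cast hchar 5 (by norm_num) (by norm_num)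
  have hA5 : ProjIso (alternatingGroup (Fin 5)) A := hA.projIso hp5 h2
  have hne : ∀ g : SL(2, F), (mat g).trace = -2⁻¹ → (mat g).trace ^ 2 ≠ 4 := by
    intro g hg h4
    rw [hg] at h4
    field_simp at h4
    have : (3 : F) * 5 = 0 := by linear_combination -h4
    exact mul_ne_zero h3 h5 this
  have hne1 : ∀ g : SL(2, F), (mat g).trace = -2⁻¹ → g ≠ 1 ∧ g ≠ -1 := by
    intro g hg
    refine ⟨?_, ?_⟩ <;> rintro rfl <;> apply hne _ hg <;> simp <;> norm_num
  rcases trace_of_projIso_alternatingGroup_five hA5 (mul_mem mS mS') (hne1 _ htr).1 (hne1 _ htr).2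
    with h' | h' | h' <;> rw [htr] at h'
  · simp [h2] at h'
  · field_simp at h'
    exact h3 (by linear_combination -h')
  · field_simp at h'
    exact h5 (by linear_combination h')

end IsQuatPair

theorem twoGLClasses_octahedral [Finite F] (h2 : (2 : F) ≠ 0) {c : F} (hc : 2 * c ^ 2 = 1) :
    TwoGLClasses fun K : Subgroup SL(2, F) => ∃ (I J : SL(2, F)) (h : IsQuatPair I J),
      K = Subgroup.closure {I, h.eltW h2, h.eltR h2 hc} := by
  obtain ⟨I, J, h⟩ := exists_isQuatPair (F := F)
  refine twoGLClasses_of_normalizer h2 (H := Subgroup.closure {I, h.eltW h2, h.eltR h2 hc}) ?_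
    fun u => h.isSquare_det_of_map_octahedral h2 hc
  intro K
  constructor
  · rintro ⟨I', J', h', rfl⟩
    obtain ⟨u, rfl, rfl⟩ := exists_conjGL_pair h2 h h'
    exact ⟨u, h.map_octahedral h2 u hc⟩
  · rintro ⟨u, rfl⟩
    exact ⟨_, _, h.map_conjGL u, h.map_octahedral h2 u hc⟩

theorem twoGLClasses_icosahedral [Finite F] {p : ℕ} [Fact p.Prime] [CharP F p]
    (hp5 : 5 < p) (h2 : (2 : F) ≠ 0) {c : F} (hc : c ^ 2 = c + 1) :
    TwoGLClasses fun K : Subgroup SL(2, F) => ∃ (I J : SL(2, F)) (h : IsQuatPair I J),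
      K = Subgroup.closure {I, h.eltW h2, h.eltS h2 hc} := by
  obtain ⟨I, J, h⟩ := exists_isQuatPair (F := F)
  refine twoGLClasses_of_normalizer h2 (H := Subgroup.closure {I, h.eltW h2, h.eltS h2 hc}) ?_
    fun u => h.isSquare_det_of_map_icosahedral hp5 h2 hc
  intro K
  constructor
  · rintro ⟨I', J', h', rfl⟩
    obtain ⟨u, rfl, rfl⟩ := exists_conjGL_pair h2 h h'
    exact ⟨u, h.map_icosahedral h2 u hc⟩
  · rintro ⟨u, rfl⟩
    exact ⟨_, _, h.map_conjGL u, h.map_icosahedral h2 u hc⟩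

end Fusion

end HallPi


namespace HallPi

/-! ### Dihedral groups. -/

section Dihedral

theorem exists_dihedralGroup_hom {P : Type*} [Group P] {c y : P} {n : ℕ} (hc : orderOf c = n)
    (hy : y * y = 1) (hcy : y * c = c⁻¹ * y) (hyc : y ∉ Subgroup.zpowers c) :
    ∃ θ : DihedralGroup n →* P, Function.Injective θ ∧ Subgroup.zpowers c ≤ θ.range ∧
      y ∈ θ.range := by
  let f : ZMod n →+ Additive P := ZMod.lift n ⟨zmultiplesHom (Additive P) (Additive.ofMul c), by
    rw [zmultiplesHom_apply, natCast_zsmul, ← ofMul_pow, ← hc, pow_orderOf_eq_one, ofMul_one]⟩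
  let g : ZMod n → P := fun i => (f i).toMul
  have gint : ∀ k : ℤ, g (k : ZMod n) = c ^ k := by
    intro k
    change (f (k : ZMod n)).toMul = c ^ k
    rw [ZMod.lift_coe]; rfl
  have gadd : ∀ i j, g (i + j) = g i * g j := by
    intro i j
    change (f (i + j)).toMul = _
    rw [map_add]; rfl
  have gzero : g 0 = 1 := by simpa using gint 0
  have gneg : ∀ i, g (-i) = (g i)⁻¹ := by
    intro i
    rw [eq_inv_iff_mul_eq_one, ← gadd, neg_add_cancel, gzero]
  have gmem : ∀ i, g i ∈ Subgroup.zpowers c := by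
    intro i
    obtain ⟨k, rfl⟩ := ZMod.intCast_surjective i
    exact ⟨k, (gint k).symm⟩
  have gy : ∀ i, g i * y = y * (g i)⁻¹ := by
    intro i
    obtain ⟨k, rfl⟩ := ZMod.intCast_surjective i
    rw [gint]
    have : SemiconjBy y c c⁻¹ := hcy
    have := (this.zpow_right (-k)).eq
    rw [inv_zpow', neg_neg] at this
    rw [← this, zpow_neg]
  have ginj : ∀ i, g i = 1 → i = 0 := by
    intro i hi
    obtain ⟨k, rfl⟩ := ZMod.intCast_surjective i
    rw [gint, ← orderOf_dvd_iff_zpow_eq_one, hc] at hi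
    exact (ZMod.intCast_zmod_eq_zero_iff_dvd k n).2 hi
  let F : DihedralGroup n → P := fun d =>
    match d with
    | .r i => g i
    | .sr i => y * g i
  have Fr : ∀ i, F (.r i) = g i := fun _ => rfl
  have Fsr : ∀ i, F (.sr i) = y * g i := fun _ => rfl
  let θ : DihedralGroup n →* P :=
    { toFun := F
      map_one' := by rw [DihedralGroup.one_def, Fr, gzero]
      map_mul' := by
        rintro (i | i) (j | j)
        · rw [DihedralGroup.r_mul_r, Fr, Fr, Fr, gadd]
        · rw [DihedralGroup.r_mul_sr, Fr, Fsr, Fsr, ← mul_assoc, gy, mul_assoc, ← gneg, ← gadd,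
            sub_eq_neg_add]
        · rw [DihedralGroup.sr_mul_r, Fr, Fsr, Fsr, gadd, mul_assoc]
        · rw [DihedralGroup.sr_mul_sr, Fr, Fsr, Fsr, mul_assoc, ← mul_assoc (g i), gy, mul_assoc,
            ← mul_assoc, hy, one_mul, ← gneg, ← gadd, sub_eq_neg_add] }
  refine ⟨θ, ?_, ?_, ⟨.sr 0, ?_⟩⟩
  · rw [injective_iff_map_eq_one]
    rintro (i | i) hd
    · rw [ginj i hd, DihedralGroup.r_zero]
    · exact absurd ((eq_inv_of_mul_eq_one_left hd) ▸ inv_mem (gmem i)) hyc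
  · rintro _ ⟨k, rfl⟩
    exact ⟨.r (k : ZMod n), gint k⟩
  · change y * g 0 = y
    rw [gzero, mul_one]

/-- Squares are rotations. The identity passes to subgroups and fails in Alt₄, Sym₄ and Alt₅, so it
tells type (a) from the others. -/
theorem dihedralGroup_commute_sq {n : ℕ} (a b : DihedralGroup n) :
    a * a * (b * b) = b * b * (a * a) := by
  rcases a with i | i <;> rcases b with j | j <;> simp [add_comm]

end Dihedral

/-! ### The centralizer of an element of square -1. -/

section Torus

open Matrix
open scoped MatrixGroups Quaternion

variable {F : Type*} [Field F]

theorem exists_isQuatPair_left [Finite F] (h2 : (2 : F) ≠ 0) {I : SL(2, F)} (hI : I * I = -1) :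
    ∃ J, IsQuatPair I J := by
  obtain ⟨I', J', h⟩ := exists_isQuatPair (F := F)
  obtain ⟨u, rfl⟩ := exists_conjGL_pair_left h2 h hI
  exact ⟨_, h.map_conjGL u⟩

theorem sq_eq_one_iff_SL2 (h2 : (2 : F) ≠ 0) {g : SL(2, F)} : g * g = 1 ↔ g = 1 ∨ g = -1 := by
  constructor
  · intro h
    by_contra hne
    rw [not_or] at hne
    have := mul_self_eq_neg_one_of_trace (trace_eq_zero_of_sq hne.1 hne.2 (Or.inl (by rw [sq, h])))
    rw [h] at this
    exact SL2_one_ne_neg_one h2 this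
  · rintro (rfl | rfl) <;> simp

namespace IsQuatPair

variable {I J : SL(2, F)}

theorem exists_of_mem_centralizer (h2 : (2 : F) ≠ 0) (h : IsQuatPair I J) {g : SL(2, F)}
    (hg : g ∈ Subgroup.centralizer {I}) :
    ∃ a b : F, mat g = h.hom ⟨a, b, 0, 0⟩ ∧ a ^ 2 + b ^ 2 = 1 := by
  obtain ⟨⟨a, b, c, d⟩, hx, hn⟩ := h.exists_mat_eq h2 g
  have hgI : g * I = I * g := by
    rw [Subgroup.mem_centralizer_singleton_iff] at hg; exact hg
  have e := h.hom_injective h2 (((h.mat_mul_hom hx h.hom_i.symm).symm.trans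
    (congrArg mat hgI)).trans (h.mat_mul_hom h.hom_i.symm hx))
  simp only [QuaternionAlgebra.mk_mul_mk, QuaternionAlgebra.mk.injEq] at e
  have hc : c = 0 := by
    refine (mul_eq_zero.1 (?_ : 2 * c = 0)).resolve_left h2; linear_combination -e.2.2.2
  have hd : d = 0 := by
    refine (mul_eq_zero.1 (?_ : 2 * d = 0)).resolve_left h2; linear_combination e.2.2.1
  subst hc hd
  exact ⟨a, b, hx, by simp only [quatNorm] at hn; linear_combination hn⟩

theorem mem_centralizer (h : IsQuatPair I J) {g : SL(2, F)} {a b : F}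
    (hg : mat g = h.hom ⟨a, b, 0, 0⟩) : g ∈ Subgroup.centralizer {I} := by
  rw [Subgroup.mem_centralizer_singleton_iff]
  exact h.eq_of_hom (h.mat_mul_hom hg h.hom_i.symm) (h.mat_mul_hom h.hom_i.symm hg)
    (by ext <;> simp)

theorem J_mul_of_mem (h2 : (2 : F) ≠ 0) (h : IsQuatPair I J) {g : SL(2, F)}
    (hg : g ∈ Subgroup.centralizer {I}) : J * g = g⁻¹ * J := by
  obtain ⟨a, b, hx, -⟩ := h.exists_of_mem_centralizer h2 hg
  exact h.eq_of_hom (h.mat_mul_hom h.hom_j.symm hx)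
    (h.mat_mul_hom (h.mat_inv_hom h2 hx) h.hom_j.symm) (by ext <;> simp)

theorem comm_of_mem (h2 : (2 : F) ≠ 0) (h : IsQuatPair I J) {g g' : SL(2, F)}
    (hg : g ∈ Subgroup.centralizer {I}) (hg' : g' ∈ Subgroup.centralizer {I}) :
    g * g' = g' * g := by
  obtain ⟨a, b, hx, -⟩ := h.exists_of_mem_centralizer h2 hg
  obtain ⟨a', b', hx', -⟩ := h.exists_of_mem_centralizer h2 hg'
  exact h.eq_of_hom (h.mat_mul_hom hx hx') (h.mat_mul_hom hx' hx) (by ext <;> simp <;> ring)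

theorem eq_or_eq_neg_of_mem_centralizer (h2 : (2 : F) ≠ 0) (h : IsQuatPair I J) {g : SL(2, F)}
    (hg : g ∈ Subgroup.centralizer {I}) (hsq : g * g = -1) : g = I ∨ g = -I := by
  obtain ⟨a, b, hx, hab⟩ := h.exists_of_mem_centralizer h2 hg
  have ht := trace_eq_zero_of_mul_self_eq_neg_one h2 hsq
  rw [hx, h.trace_hom h2] at ht
  have ha : a = 0 := (mul_eq_zero.1 ht).resolve_left h2
  subst ha
  rcases (show b = 1 ∨ b = -1 by simpa using hab) with rfl | rfl
  · exact Or.inl (h.eq_of_hom hx h.hom_i.symm rfl)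
  · exact Or.inr (h.eq_of_hom hx (h.mat_neg_hom h.hom_i.symm) (by ext <;> simp))

theorem J_not_mem (h2 : (2 : F) ≠ 0) (h : IsQuatPair I J) : J ∉ Subgroup.centralizer {I} := by
  intro hJ
  rw [Subgroup.mem_centralizer_singleton_iff, h.anti] at hJ
  have h1 : -((I * J) * (I * J)) = (I * J) * (I * J) := by
    nth_rw 3 [← hJ]; rw [neg_mul]
  rw [h.sqK, neg_neg] at h1
  exact SL2_one_ne_neg_one h2 h1

theorem exists_mul_of_conj (h : IsQuatPair I J) {g : SL(2, F)}
    (hg : g * I = I * g ∨ g * I = -(I * g)) :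
    g ∈ Subgroup.centralizer {I} ∨ ∃ c ∈ Subgroup.centralizer {I}, g = J * c := by
  rcases hg with hg | hg
  · exact Or.inl (Subgroup.mem_centralizer_singleton_iff.2 hg)
  · right
    refine ⟨J⁻¹ * g, ?_, by simp⟩
    rw [Subgroup.mem_centralizer_singleton_iff, h.inv_J, neg_mul, neg_mul, mul_neg, mul_assoc, hg,
      mul_neg, ← mul_assoc, ← mul_assoc, h.anti]
    simp [mul_assoc]

end IsQuatPair

/-- The two elements are conjugate by some u in GL₂. Every element of a finite field of odd order is
a sum of two squares, so some a + bI, which commutes with I, has the determinant of u; multiplying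
by it makes the determinant a square. -/
theorem conjSub_centralizer_of_sq [Finite F] (h2 : (2 : F) ≠ 0) {I I' : SL(2, F)}
    (hI : I * I = -1) (hI' : I' * I' = -1) : ∃ g : SL(2, F), g * I * g⁻¹ = I' := by
  obtain ⟨J, h⟩ := exists_isQuatPair_left h2 hI
  obtain ⟨u, hu⟩ := exists_conjGL_pair_left h2 h hI'
  have := Fintype.ofFinite F
  obtain ⟨a, b, hab⟩ : ∃ a b : F, a ^ 2 + b ^ 2 = u.1.det := by
    by_cases hs : IsSquare u.1.det
    · obtain ⟨a, ha⟩ := hs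
      exact ⟨a, 0, by rw [ha]; ring⟩
    · have hodd : Fintype.card F % 2 = 1 := FiniteField.odd_card_of_char_ne_two (by
        intro h
        have := ringChar.Nat.cast_ringChar (R := F)
        rw [h] at this
        exact h2 (by exact_mod_cast this))
      obtain ⟨a, b, hab⟩ := FiniteField.exists_root_sum_quadratic
        (f := (Polynomial.X ^ 2 : Polynomial F))
        (g := Polynomial.X ^ 2 - Polynomial.C u.1.det)
        (Polynomial.degree_X_pow 2) (Polynomial.degree_X_pow_sub_C (by decide) _) hodd
      refine ⟨a, b, ?_⟩
      rw [← sub_eq_zero]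
      simpa only [Polynomial.eval_C, Polynomial.eval_X, Polynomial.eval_pow, Polynomial.eval_sub,
        ← add_sub_assoc] using hab
  have hdet : (h.hom ⟨a, b, 0, 0⟩).det = u.1.det := by
    rw [h.det_hom h2]; simp only [quatNorm]; linear_combination hab
  obtain ⟨v, hv⟩ : IsUnit (h.hom ⟨a, b, 0, 0⟩) := by
    rw [isUnit_iff_isUnit_det, hdet, isUnit_iff_ne_zero]; exact det_ne_zero u
  have hvI : conjGL v I = I := by
    rw [conjGL_eq_iff, hv, ← h.hom_i, ← map_mul, ← map_mul]
    congr 1; ext <;> simp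
  obtain ⟨g, hg⟩ := exists_conj_eq_conjGL_of_isSquare_det (u := u * v) (by
    rw [Units.val_mul, det_mul, hv, hdet]; exact ⟨_, rfl⟩)
  refine ⟨g, ?_⟩
  rw [← MulAut.conj_apply, ← hg, map_mul, MulAut.mul_apply, hvI, hu]

end Torus

end HallPi


namespace HallPi

/-! ### The torus is cyclic of order q - ε. -/

section TorusOrder

open Matrix
open scoped MatrixGroups Quaternion

variable {F : Type*} [Field F]

namespace IsQuatPair

variable {I J : SL(2, F)}

/-- The coordinates of an element of `SL₂` with respect to a pair. -/
noncomputable def toQuat (h2 : (2 : F) ≠ 0) (h : IsQuatPair I J) : SL(2, F) →* ℍ[F,-1,-1] where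
  toFun g := (h.exists_mat_eq h2 g).choose
  map_one' := h.hom_injective h2
    ((h.exists_mat_eq h2 1).choose_spec.1.symm.trans h.mat_one_hom)
  map_mul' g g' := h.hom_injective h2
    ((h.exists_mat_eq h2 (g * g')).choose_spec.1.symm.trans
      (h.mat_mul_hom (h.exists_mat_eq h2 g).choose_spec.1 (h.exists_mat_eq h2 g').choose_spec.1))

theorem toQuat_eq (h2 : (2 : F) ≠ 0) (h : IsQuatPair I J) {g : SL(2, F)} {x : ℍ[F,-1,-1]}
    (hg : mat g = h.hom x) : h.toQuat h2 g = x :=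
  h.hom_injective h2 ((h.exists_mat_eq h2 g).choose_spec.1.symm.trans hg)

/-- The homomorphism `a + b I ↦ a + b i` on the centralizer of `I`, for a square root `i` of `-1`
in an extension field. -/
noncomputable def torusHom (h2 : (2 : F) ≠ 0) (h : IsQuatPair I J) {E : Type*} [Field E]
    [Algebra F E] {i : E} (hi : i ^ 2 = -1) : Subgroup.centralizer {I} →* E where
  toFun g := algebraMap F E (h.toQuat h2 g).re + algebraMap F E (h.toQuat h2 g).imI * i
  map_one' := by simp
  map_mul' := by
    intro g g'
    obtain ⟨a, b, hab, -⟩ := h.exists_of_mem_centralizer h2 g.2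
    obtain ⟨a', b', hab', -⟩ := h.exists_of_mem_centralizer h2 g'.2
    rw [Subgroup.coe_mul, map_mul, h.toQuat_eq h2 hab, h.toQuat_eq h2 hab']
    simp
    linear_combination (- algebraMap F E b * algebraMap F E b') * hi

theorem torusHom_apply (h2 : (2 : F) ≠ 0) (h : IsQuatPair I J) {E : Type*} [Field E]
    [Algebra F E] {i : E} (hi : i ^ 2 = -1) (g : Subgroup.centralizer {I}) {a b : F}
    (hg : mat (g : SL(2, F)) = h.hom ⟨a, b, 0, 0⟩) :
    h.torusHom h2 hi g = algebraMap F E a + algebraMap F E b * i := by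
  change algebraMap F E (h.toQuat h2 g).re + algebraMap F E (h.toQuat h2 g).imI * i = _
  rw [h.toQuat_eq h2 hg]

theorem torusHom_injective (h2 : (2 : F) ≠ 0) (h : IsQuatPair I J) {E : Type*} [Field E]
    [Algebra F E] {i : E} (hi : i ^ 2 = -1) : Function.Injective (h.torusHom h2 hi) := by
  have h2E : (2 : E) ≠ 0 := by
    rw [show (2 : E) = algebraMap F E 2 from (map_ofNat _ 2).symm]
    exact (map_ne_zero _).2 h2
  rw [injective_iff_map_eq_one]
  intro g hg
  obtain ⟨a, b, hab, hn⟩ := h.exists_of_mem_centralizer h2 g.2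
  rw [h.torusHom_apply h2 hi g hab] at hg
  have hn' : algebraMap F E a ^ 2 + algebraMap F E b ^ 2 = 1 := by
    rw [← map_pow, ← map_pow, ← map_add, hn, map_one]
  have hinv : algebraMap F E a - algebraMap F E b * i = 1 := by
    linear_combination hn' - (algebraMap F E a - algebraMap F E b * i) * hg
      - algebraMap F E b ^ 2 * hi
  have ha : algebraMap F E a = 1 := by
    apply mul_left_cancel₀ h2E; linear_combination hg + hinv
  have ha' : a = 1 := (algebraMap F E).injective (by rw [ha, map_one])
  subst ha'
  have hb : b = 0 := by simpa using hn
  subst hb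
  ext1
  exact h.eq_of_hom hab h.mat_one_hom rfl

end IsQuatPair

theorem exists_algebraMap_eq_of_pow_card_eq [Fintype F] {E : Type*} [Field E] [Algebra F E] {x : E}
    (hx : x ^ Fintype.card F = x) : ∃ a : F, algebraMap F E a = x := by
  classical
  have h1 : 1 < Fintype.card F := Fintype.one_lt_card
  have hp0 := FiniteField.X_pow_card_sub_X_ne_zero E h1
  have hsub : Finset.univ.image (algebraMap F E) ⊆
      (Polynomial.X ^ Fintype.card F - Polynomial.X : Polynomial E).roots.toFinset := by
    intro y hy
    obtain ⟨a, -, rfl⟩ := Finset.mem_image.1 hy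
    rw [Multiset.mem_toFinset, Polynomial.mem_roots hp0]
    simp [← map_pow, FiniteField.pow_card]
  have heq := Finset.eq_of_subset_of_card_le hsub (by
    rw [Finset.card_image_of_injective _ (algebraMap F E).injective, Finset.card_univ]
    refine (Multiset.toFinset_card_le _).trans ((Polynomial.card_roots' _).trans ?_)
    rw [FiniteField.X_pow_card_sub_X_natDegree_eq E h1])
  have : x ∈ Finset.univ.image (algebraMap F E) := by
    rw [heq, Multiset.mem_toFinset, Polynomial.mem_roots hp0]
    simp [hx]
  obtain ⟨a, -, ha⟩ := Finset.mem_image.1 this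
  exact ⟨a, ha⟩

theorem qSubEps_eq_of_mod_one {q : ℕ} (h : q % 4 = 1) : qSubEps q = q - 1 := by
  rw [qSubEps, eps, if_pos h]; omega

theorem qSubEps_eq_of_mod_three {q : ℕ} (h : q % 4 = 3) : qSubEps q = q + 1 := by
  rw [qSubEps, eps, if_neg (by omega)]; omega

/-- The map a + bI ↦ a + bi is injective on the centralizer, where a² + b² = 1. Since i^q = εi, the
image z satisfies z^q = z or z^q = z⁻¹ according to ε, and conversely every (q - ε)-th root of unity
arises. So the centralizer is the group of (q - ε)-th roots of unity. -/
theorem isCyclic_centralizer_aux [Finite F] (E : Type*) [Field E] [Algebra F E] [IsAlgClosed E]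
    (h2 : (2 : F) ≠ 0) {I : SL(2, F)} (hI : I * I = -1) : IsCyclic (Subgroup.centralizer {I}) ∧
      Nat.card (Subgroup.centralizer {I}) = qSubEps (Nat.card F) := by
  have := Fintype.ofFinite F
  obtain ⟨J, h⟩ := exists_isQuatPair_left h2 hI
  have h2E : (2 : E) ≠ 0 := by
    rw [show (2 : E) = algebraMap F E 2 from (map_ofNat _ 2).symm]
    exact (map_ne_zero _).2 h2
  obtain ⟨i, hi⟩ : ∃ i : E, i ^ 2 = -1 := IsAlgClosed.exists_pow_nat_eq (-1 : E) (by norm_num)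
  have hi0 : i ≠ 0 := by rintro rfl; simp at hi
  obtain ⟨p, hpc⟩ := CharP.exists F
  have hp : Fact p.Prime := ⟨CharP.char_is_prime F p⟩
  have : CharP E p := charP_of_injective_algebraMap (algebraMap F E).injective p
  obtain ⟨n, -, hn⟩ := FiniteField.card F p
  set q := Fintype.card F with hq
  rw [Nat.card_eq_fintype_card (α := F), ← hq]
  have hq1 : 1 < q := Fintype.one_lt_card
  have hodd : q % 2 = 1 := FiniteField.odd_card_of_char_ne_two (by
    intro h
    have := ringChar.Nat.cast_ringChar (R := F)
    rw [h] at this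
    exact h2 (by exact_mod_cast this))
  have hadd : ∀ x y : E, (x + y) ^ q = x ^ q + y ^ q := by
    intro x y; rw [hn]; exact add_pow_char_pow x y p n
  have hfix : ∀ a : F, algebraMap F E a ^ q = algebraMap F E a := by
    intro a; rw [← map_pow, FiniteField.pow_card]
  have hq0 : (q : E) = 0 := by
    rw [hn, Nat.cast_pow, CharP.cast_eq_zero, zero_pow n.ne_zero]
  have hneg1 : (-1 : E) ^ q = -1 := Odd.neg_one_pow (Nat.odd_iff.2 hodd)
  -- Here s is ε in E. The last expression is z for s = 1 and z⁻¹ for s = -1, which treats both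
  -- cases at once; the value -s of q - ε shows it is invertible in E, so that there are enough
  -- roots of unity.
  have key : (∃ s : E, (s = 1 ∨ s = -1) ∧ i ^ q = s * i ∧ ((qSubEps q : ℕ) : E) = -s ∧
      qSubEps q ≠ 0 ∧ ∀ z : E, z ≠ 0 → (z ^ qSubEps q = 1 ↔ z ^ q = ((1 + s) / 2) * z +
        ((1 - s) / 2) * z⁻¹)) := by
    rcases (show q % 4 = 1 ∨ q % 4 = 3 by omega) with h4 | h4
    · refine ⟨1, Or.inl rfl, ?_, ?_, ?_, ?_⟩
      · obtain ⟨k, hk⟩ : ∃ k, q = 4 * k + 1 := ⟨q / 4, by omega⟩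
        rw [hk, pow_succ, pow_mul, show i ^ 4 = (i ^ 2) ^ 2 by ring, hi]; simp
      · rw [qSubEps_eq_of_mod_one h4, Nat.cast_sub hq1.le, hq0]; simp
      · rw [qSubEps_eq_of_mod_one h4]; omega
      · intro z hz
        rw [qSubEps_eq_of_mod_one h4]
        obtain ⟨k, hk⟩ : ∃ k, q = k + 1 := ⟨q - 1, by omega⟩
        rw [hk, Nat.add_sub_cancel, pow_succ]
        rw [sub_self, zero_div, zero_mul, add_zero, one_add_one_eq_two, div_self h2E]
        exact ⟨fun h => by rw [h], fun h => mul_right_cancel₀ hz h⟩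
    · refine ⟨-1, Or.inr rfl, ?_, ?_, ?_, ?_⟩
      · obtain ⟨k, hk⟩ : ∃ k, q = 4 * k + 3 := ⟨q / 4, by omega⟩
        rw [hk, pow_add, pow_mul, show i ^ 4 = (i ^ 2) ^ 2 by ring,
          show i ^ 3 = i ^ 2 * i by ring, hi]
        simp
      · rw [qSubEps_eq_of_mod_three h4, Nat.cast_add, hq0, neg_neg, zero_add, Nat.cast_one]
      · rw [qSubEps_eq_of_mod_three h4]; omega
      · intro z hz
        rw [qSubEps_eq_of_mod_three h4, pow_succ, ← eq_mul_inv_iff_mul_eq₀ hz, one_mul]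
        rw [add_neg_cancel, zero_div, zero_mul, zero_add, sub_neg_eq_add, one_add_one_eq_two,
          div_self h2E, one_mul]
  obtain ⟨s, hs, his, hns, hn0, hz⟩ := key
  set m := qSubEps q
  have hs2 : s ^ 2 = 1 := by rcases hs with rfl | rfl <;> simp
  have hm : NeZero (m : E) := ⟨by rw [hns]; rcases hs with rfl | rfl <;> simp⟩
  have hm' : NeZero m := ⟨hn0⟩
  have hval : ∀ (g : Subgroup.centralizer {I}), (h.torusHom h2 hi) g ^ m = 1 := by
    intro g
    obtain ⟨a, b, hab, hn⟩ := h.exists_of_mem_centralizer h2 g.2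
    rw [h.torusHom_apply h2 hi g hab]
    have hn' : algebraMap F E a ^ 2 + algebraMap F E b ^ 2 = 1 := by
      rw [← map_pow, ← map_pow, ← map_add, hn, map_one]
    have hmul : (algebraMap F E a + algebraMap F E b * i) *
        (algebraMap F E a - algebraMap F E b * i) = 1 := by
      linear_combination hn' - algebraMap F E b ^ 2 * hi
    rw [hz _ (left_ne_zero_of_mul_eq_one hmul), ← eq_inv_of_mul_eq_one_right hmul, hadd, mul_pow,
      hfix, hfix, his]
    field_simp
    ring
  have hrange : (h.torusHom h2 hi).toHomUnits.range = rootsOfUnity m E := by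
    ext z
    rw [mem_rootsOfUnity]
    constructor
    · rintro ⟨g, rfl⟩
      ext1
      rw [Units.val_pow_eq_pow_val, MonoidHom.coe_toHomUnits, hval g, Units.val_one]
    · intro hzm
      have hzm' : (z : E) ^ m = 1 := by
        rw [← Units.val_pow_eq_pow_val, hzm, Units.val_one]
      rw [hz _ z.ne_zero] at hzm'
      have hzi : (z : E) ^ q * ((z : E)⁻¹) ^ q = 1 := by
        rw [← mul_pow, mul_inv_cancel₀ z.ne_zero, one_pow]
      have hzinv : ((z : E)⁻¹) ^ q = ((1 + s) / 2) * (z : E)⁻¹ + ((1 - s) / 2) * z := by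
        have h12 : ((1 : E) + 1) / 2 = 1 := by rw [one_add_one_eq_two, div_self h2E]
        rw [inv_pow, hzm']
        rcases hs with rfl | rfl <;> simp [h12]
      -- The coordinates of a root of unity z are (z + z⁻¹)/2 and (z - z⁻¹)/(2i); both are fixed by
      -- the q-th power map, hence come from F.
      obtain ⟨a, ha⟩ := exists_algebraMap_eq_of_pow_card_eq (F := F)
        (x := ((z : E) + (z : E)⁻¹) / 2) (by
          rw [← hq, div_pow, hadd, hzm', hzinv, show (2 : E) ^ q = 2 by
            have := hfix 2; rwa [map_ofNat] at this]
          field_simp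
          ring)
      obtain ⟨b, hb⟩ := exists_algebraMap_eq_of_pow_card_eq (F := F)
        (x := ((z : E) + -(z : E)⁻¹) / (2 * i)) (by
          rw [← hq, div_pow, hadd, Odd.neg_pow (Nat.odd_iff.2 hodd), hzm', hzinv, mul_pow,
            show (2 : E) ^ q = 2 by have := hfix 2; rwa [map_ofNat] at this, his]
          rcases hs with rfl | rfl
          · field_simp
            ring
          · field_simp
            ring)
      have hn : a ^ 2 + b ^ 2 = 1 := by
        apply (algebraMap F E).injective
        rw [map_add, map_pow, map_pow, ha, hb, map_one, div_pow, div_pow, mul_pow, hi]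
        field_simp
        ring
      have hN : quatNorm (⟨a, b, 0, 0⟩ : ℍ[F,-1,-1]) = 1 := by
        simp only [quatNorm]; linear_combination hn
      refine ⟨⟨h.ofQuat h2 ⟨a, b, 0, 0⟩ hN, h.mem_centralizer (h.mat_ofQuat h2 _ hN)⟩, ?_⟩
      ext1
      rw [MonoidHom.coe_toHomUnits, h.torusHom_apply h2 hi _ (h.mat_ofQuat h2 _ hN), ha, hb]
      field_simp
      ring
  have hinj : Function.Injective (h.torusHom h2 hi).toHomUnits := by
    intro g g' hgg
    apply h.torusHom_injective h2 hi
    exact congrArg Units.val hgg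
  have e := (MonoidHom.ofInjective hinj).trans (MulEquiv.subgroupCongr hrange)
  refine ⟨?_, ?_⟩
  · have := rootsOfUnity.isCyclic E m
    exact isCyclic_of_injective e.toMonoidHom e.injective
  · rw [Nat.card_congr e.toEquiv]
    exact HasEnoughRootsOfUnity.natCard_rootsOfUnity E m

theorem isCyclic_centralizer [Finite F] (h2 : (2 : F) ≠ 0) {I : SL(2, F)} (hI : I * I = -1) :
    IsCyclic (Subgroup.centralizer {I}) :=
  (isCyclic_centralizer_aux (AlgebraicClosure F) h2 hI).1

theorem card_centralizer [Finite F] (h2 : (2 : F) ≠ 0) {I : SL(2, F)} (hI : I * I = -1) :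
    Nat.card (Subgroup.centralizer {I}) = qSubEps (Nat.card F) :=
  (isCyclic_centralizer_aux (AlgebraicClosure F) h2 hI).2

end TorusOrder

end HallPi


namespace HallPi

/-! ### Arithmetic of q² - 1 and of Hall orders. -/

section Arithmetic

theorem exists_eq_mul_of_primeFactors (π : Set ℕ) {n : ℕ} (hn : n ≠ 0) :
    ∃ h m : ℕ, n = h * m ∧ (∀ r ∈ h.primeFactors, r ∈ π) ∧ ∀ r ∈ m.primeFactors, r ∉ π := by
  induction n using induction_on_primes with
  | zero => exact absurd rfl hn
  | one => exact ⟨1, 1, by simp⟩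
  | prime_mul p a hp ih =>
    obtain ⟨h, m, rfl, hh, hm⟩ := ih (right_ne_zero_of_mul hn)
    have hm0 := right_ne_zero_of_mul (right_ne_zero_of_mul hn)
    have hh0 := left_ne_zero_of_mul (right_ne_zero_of_mul hn)
    by_cases hpπ : p ∈ π
    · refine ⟨p * h, m, by ring, ?_, hm⟩
      intro r hr
      rw [Nat.primeFactors_mul hp.ne_zero hh0, Finset.mem_union, hp.primeFactors,
        Finset.mem_singleton] at hr
      rcases hr with rfl | hr
      exacts [hpπ, hh r hr]
    · refine ⟨h, p * m, by ring, hh, ?_⟩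
      intro r hr
      rw [Nat.primeFactors_mul hp.ne_zero hm0, Finset.mem_union, hp.primeFactors,
        Finset.mem_singleton] at hr
      rcases hr with rfl | hr
      exacts [hpπ, hm r hr]

theorem coprime_of_primeFactors {π : Set ℕ} {h m : ℕ}
    (hh : ∀ r ∈ h.primeFactors, r ∈ π) (hm : ∀ r ∈ m.primeFactors, r ∉ π) (hh0 : h ≠ 0)
    (hm0 : m ≠ 0) : Nat.Coprime h m := by
  rw [← Nat.disjoint_primeFactors hh0 hm0, Finset.disjoint_left]
  exact fun r hr hr' => hm r hr' (hh r hr)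

theorem piPart_eq {S : Set ℕ} {h m : ℕ} (hh : ∀ r ∈ h.primeFactors, r ∈ S)
    (hm : ∀ r ∈ m.primeFactors, r ∉ S) (h0 : h * m ≠ 0) : piPart S (h * m) = h := by
  have hh0 := left_ne_zero_of_mul h0
  have hm0 := right_ne_zero_of_mul h0
  refine IsGreatest.csSup_eq ⟨⟨dvd_mul_right h m, hh⟩, ?_⟩
  rintro t ⟨ht, htS⟩
  have ht0 : t ≠ 0 := fun h' => h0 (by rw [h'] at ht; exact zero_dvd_iff.1 ht)
  exact Nat.le_of_dvd (Nat.pos_of_ne_zero hh0)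
    ((coprime_of_primeFactors htS hm ht0 hm0).dvd_of_dvd_mul_right ht)

theorem isHall_iff_card {G : Type*} [Group G] [Finite G] {π : Set ℕ} {h m : ℕ}
    (hc : Nat.card G = h * m) (hh : ∀ r ∈ h.primeFactors, r ∈ π)
    (hm : ∀ r ∈ m.primeFactors, r ∉ π) (H : Subgroup G) : IsHall π H ↔ Nat.card H = h := by
  have hG : h * m ≠ 0 := by rw [← hc]; exact Nat.card_pos.ne'
  have hh0 := left_ne_zero_of_mul hG
  have hm0 := right_ne_zero_of_mul hG
  have hmul := H.card_mul_index
  rw [hc] at hmul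
  constructor
  · rintro ⟨h1, h2⟩
    have hi : H.index ≠ 0 := Subgroup.index_ne_zero_of_finite
    apply Nat.dvd_antisymm
    · exact (coprime_of_primeFactors h1 hm Nat.card_pos.ne' hm0).dvd_of_dvd_mul_right
        (hmul ▸ dvd_mul_right _ _)
    · exact (coprime_of_primeFactors hh h2 hh0 hi).dvd_of_dvd_mul_right
        (hmul ▸ dvd_mul_right _ _)
  · intro hH
    have hi : H.index = m := by
      rw [hH] at hmul
      exact Nat.eq_of_mul_eq_mul_left (Nat.pos_of_ne_zero hh0) hmul
    exact ⟨by rw [IsPiSubgroup, hH]; exact hh, by rw [hi]; exact hm⟩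

/-- The factorization q² - 1 = (q - ε)(q + ε) with q + ε = 2s: as q + ε is 2 modulo 4, s is odd, and
the two factors share only the prime 2. -/
theorem exists_sq_sub_one_eq {q : ℕ} (hq : q % 2 = 1) (hq1 : 1 < q) :
    ∃ s : ℕ, q ^ 2 - 1 = qSubEps q * (2 * s) ∧ Odd s ∧ 4 ∣ qSubEps q ∧ 0 < qSubEps q ∧
      Nat.Coprime (qSubEps q) s := by
  rcases (show q % 4 = 1 ∨ q % 4 = 3 by omega) with h | h
  · rw [qSubEps_eq_of_mod_one h]
    obtain ⟨k, rfl⟩ : ∃ k, q = 4 * k + 1 := ⟨q / 4, by omega⟩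
    refine ⟨2 * k + 1, ?_, ⟨k, rfl⟩, by simp, by omega, ?_⟩
    · rw [Nat.add_sub_cancel, show (4 * k + 1) ^ 2 = 4 * k * (2 * (2 * k + 1)) + 1 by ring,
        Nat.add_sub_cancel]
    · rw [Nat.add_sub_cancel, show 4 * k = 2 * (2 * k) by ring, Nat.coprime_mul_iff_left]
      exact ⟨by simp, by simp⟩
  · rw [qSubEps_eq_of_mod_three h]
    obtain ⟨k, rfl⟩ : ∃ k, q = 4 * k + 3 := ⟨q / 4, by omega⟩
    refine ⟨2 * k + 1, ?_, ⟨k, rfl⟩, by omega, by omega, ?_⟩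
    · rw [show (4 * k + 3) ^ 2 = (4 * k + 3 + 1) * (2 * (2 * k + 1)) + 1 by ring,
        Nat.add_sub_cancel]
    · rw [show 4 * k + 3 + 1 = 2 * (2 * k + 1 + 1) by ring, Nat.coprime_mul_iff_left]
      exact ⟨by simp, by simp⟩

theorem twentyFour_dvd {q : ℕ} (hq : q % 2 = 1) (hq3 : q % 3 ≠ 0) : 24 ∣ q ^ 2 - 1 := by
  have h8 : 8 ∣ q ^ 2 - 1 := Nat.eight_dvd_sq_sub_one_of_odd (Nat.odd_iff.2 hq)
  have h3 : 3 ∣ q ^ 2 - 1 := by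
    have : q ^ 2 % 3 = 1 := by
      rcases (show q % 3 = 1 ∨ q % 3 = 2 by omega) with h | h <;> rw [Nat.pow_mod, h]
    omega
  exact Nat.Coprime.mul_dvd_of_dvd_of_dvd (by norm_num : Nat.Coprime 8 3) h8 h3

end Arithmetic

/-! ### Extensions of index two, and subgroups of cyclic groups. -/

section Groups

theorem exists_subgroup_card_eq_two_mul {G : Type*} [Group G] [Finite G] {C : Subgroup G} {y : G}
    (hy : y ∉ C) (hy2 : y * y ∈ C) (hn : ∀ c ∈ C, y * c * y⁻¹ ∈ C) :
    ∃ H : Subgroup G, C ≤ H ∧ y ∈ H ∧ Nat.card H = 2 * Nat.card C := by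
  have hyn : y ∈ Subgroup.normalizer (C : Set G) := by
    rw [Subgroup.mem_normalizer_iff]
    have hle : C.map (MulAut.conj y).toMonoidHom ≤ C := by
      rintro _ ⟨c, hc, rfl⟩
      exact hn c hc
    have heq : C.map (MulAut.conj y).toMonoidHom = C :=
      Subgroup.eq_of_le_of_card_ge hle
        (Nat.card_congr ((MulAut.conj y).subgroupMap C).toEquiv).le
    intro c
    refine ⟨hn c, fun h => ?_⟩
    have hc : y * c * y⁻¹ ∈ C.map (MulAut.conj y).toMonoidHom := by rw [heq]; exact h
    obtain ⟨c', hc', h'⟩ := hc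
    have h'' : y * c' * y⁻¹ = y * c * y⁻¹ := h'
    have : c' = c := by simpa using h''
    exact this ▸ hc'
  have hle : C ⊔ Subgroup.zpowers y ≤ Subgroup.normalizer (C : Set G) :=
    sup_le Subgroup.le_normalizer (by rwa [Subgroup.zpowers_le])
  refine ⟨C ⊔ Subgroup.zpowers y, le_sup_left, Subgroup.mem_sup_right (Subgroup.mem_zpowers y), ?_⟩
  have hcl : C ⊔ Subgroup.zpowers y = Subgroup.closure (C ∪ {y}) := by
    rw [Subgroup.closure_union, Subgroup.closure_eq, Subgroup.zpowers_eq_closure]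
  have hbound : Nat.card (C ⊔ Subgroup.zpowers y : Subgroup G) ≤ Nat.card C * 2 := by
    classical
    have hy1 : (1 : G) ≠ y := by rintro rfl; exact hy (one_mem C)
    have h2 : ({1, y} : Finset G).card = 2 := Finset.card_pair hy1
    rw [hcl, ← h2]
    refine card_closure_le _ _ _ (by simp) ?_
    intro r hr g hg
    simp only [Finset.mem_insert, Finset.mem_singleton] at hr
    rcases hr with rfl | rfl <;> rcases hg with hg | hg
    · exact ⟨1, by simp, by simpa using hg⟩
    · rw [Set.mem_singleton_iff] at hg
      exact ⟨y, by simp, by simp [hg]⟩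
    · exact ⟨r, by simp, hn g hg⟩
    · rw [Set.mem_singleton_iff] at hg
      exact ⟨1, by simp, by simpa [hg] using hy2⟩
  have hdvd := Subgroup.card_dvd_of_le (le_sup_left : C ≤ C ⊔ Subgroup.zpowers y)
  obtain ⟨k, hk⟩ := hdvd
  have hC : 0 < Nat.card C := Nat.card_pos
  have hk2 : k ≤ 2 := by
    rw [hk] at hbound; exact Nat.le_of_mul_le_mul_left hbound hC
  have hk0 : k ≠ 0 := by
    rintro rfl
    have : 0 < Nat.card (C ⊔ Subgroup.zpowers y : Subgroup G) := Nat.card_pos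
    omega
  have hk1 : k ≠ 1 := by
    rintro rfl
    rw [mul_one] at hk
    have := Subgroup.eq_of_le_of_card_ge (le_sup_left : C ≤ C ⊔ Subgroup.zpowers y) hk.le
    exact hy (by rw [this]; exact Subgroup.mem_sup_right (Subgroup.mem_zpowers y))
  have : k = 2 := by omega
  rw [hk, this, mul_comm]

/-- In a finite cyclic group subgroups are determined by their order. -/
theorem eq_of_card_eq_of_le_isCyclic {G : Type*} [Group G] [Finite G] {T A B : Subgroup G}
    [IsCyclic T] (hA : A ≤ T) (hB : B ≤ T) (h : Nat.card A = Nat.card B) : A = B := by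
  classical
  have key : ∀ A ≤ T, (A : Set G) = {g | g ∈ T ∧ g ^ Nat.card A = 1} := by
    intro A hA
    have := Fintype.ofFinite T
    have hle := IsCyclic.card_pow_eq_one_le (α := T) (n := Nat.card A) Nat.card_pos
    have hsub : (A : Set G) ⊆ {g | g ∈ T ∧ g ^ Nat.card A = 1} := by
      intro g hg
      refine ⟨hA hg, ?_⟩
      have := pow_card_eq_one' (x := (⟨g, hg⟩ : A))
      exact congrArg Subtype.val this
    refine Set.eq_of_subset_of_ncard_le hsub ?_ (Set.toFinite _)
    have himg : {g | g ∈ T ∧ g ^ Nat.card A = 1} =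
        Subtype.val '' ((Finset.univ.filter fun a : T => a ^ Nat.card A = 1 : Finset T) : Set T) := by
      ext g
      constructor
      · rintro ⟨h1, h2⟩
        exact ⟨⟨g, h1⟩, by simpa [Subtype.ext_iff] using h2, rfl⟩
      · rintro ⟨⟨g, h1⟩, h2, rfl⟩
        exact ⟨h1, by simpa [Subtype.ext_iff] using h2⟩
    rw [himg, Set.ncard_image_of_injective _ Subtype.val_injective, Set.ncard_coe_finset]
    exact hle
  apply SetLike.coe_injective
  rw [key A hA, key B hB, h]

theorem exists_le_card_eq_of_isCyclic {G : Type*} [Group G] [Finite G] {T : Subgroup G}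
    [IsCyclic T] {n : ℕ} (hn : n ∣ Nat.card T) : ∃ C ≤ T, Nat.card C = n := by
  obtain ⟨g, hg⟩ := IsCyclic.exists_ofOrder_eq_natCard (α := T)
  obtain ⟨k, hk⟩ := hn
  have hT : 0 < Nat.card T := Nat.card_pos
  have hk0 : 0 < k := Nat.pos_of_ne_zero (by rintro rfl; omega)
  refine ⟨(Subgroup.zpowers (g ^ k)).map T.subtype, Subgroup.map_subtype_le _, ?_⟩
  rw [Subgroup.card_map_of_injective T.subtype_injective, Nat.card_zpowers, orderOf_pow, hg, hk,
    Nat.gcd_eq_right (dvd_mul_left k n), Nat.mul_div_cancel _ hk0]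

end Groups

end HallPi


namespace HallPi

/-! ### The π-part h of q² - 1, and the conditions (a)–(d) in terms of h. -/

section HallSetup

open Matrix
open scoped MatrixGroups Quaternion

theorem card_SL2 (F : Type*) [Field F] [Finite F] :
    Nat.card SL(2, F) = Nat.card F * (Nat.card F ^ 2 - 1) := by
  have := Fintype.ofFinite F
  have hq : 1 < Fintype.card F := Fintype.one_lt_card
  have hGL := Matrix.card_GL_field (𝔽 := F) 2
  have h1 := (GeneralLinearGroup.det (n := Fin 2) (R := F)).ker.card_mul_index
  have hsurj : (GeneralLinearGroup.det (n := Fin 2) (R := F)).range = ⊤ := by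
    rw [MonoidHom.range_eq_top]
    intro a
    obtain ⟨u, hu⟩ := exists_det_eq (a : F) a.ne_zero
    exact ⟨u, Units.ext hu⟩
  rw [Subgroup.index_ker, hsurj, Subgroup.card_top, hGL, Nat.card_units] at h1
  have hker : Nat.card (GeneralLinearGroup.det (n := Fin 2) (R := F)).ker = Nat.card SL(2, F) := by
    have hto : ∀ g : SL(2, F), toGL g ∈ (GeneralLinearGroup.det (n := Fin 2) (R := F)).ker :=
      fun g => MonoidHom.mem_ker.2 (Units.ext (det_mat g))
    refine (Nat.card_congr (Equiv.ofBijective (fun g : SL(2, F) =>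
      (⟨toGL g, hto g⟩ : (GeneralLinearGroup.det (n := Fin 2) (R := F)).ker)) ⟨?_, ?_⟩)).symm
    · intro g g' hgg
      apply mat_injective
      exact congrArg (fun u => u.1.1) hgg
    · intro u
      refine ⟨⟨u.1.1, congrArg Units.val (MonoidHom.mem_ker.1 u.2)⟩, ?_⟩
      exact Subtype.ext (Units.ext rfl)
  rw [hker, Nat.card_eq_fintype_card (α := F)] at h1
  rw [Nat.card_eq_fintype_card (α := F)]
  obtain ⟨k, hk⟩ : ∃ k, Fintype.card F = k + 2 := ⟨Fintype.card F - 2, by omega⟩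
  rw [hk] at h1 ⊢
  simp only [Fin.prod_univ_two, Fin.val_zero, Fin.val_one, pow_zero, pow_one,
    show k + 2 - 1 = k + 1 by omega] at h1
  have e1 : (k + 2) ^ 2 - (k + 2) = (k + 2) * (k + 1) := by
    rw [show (k + 2) ^ 2 = (k + 2) * (k + 1) + (k + 2) by ring, Nat.add_sub_cancel]
  rw [e1] at h1
  apply Nat.eq_of_mul_eq_mul_right (Nat.succ_pos k)
  rw [h1, Nat.succ_eq_add_one]; ring

/-- The arithmetic data attached to a set `π` of primes containing `2` and `3` but not the
characteristic `p` of `F`: `h` is the `π`-part of `q² - 1`, and `m` the `π'`-part. -/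
structure HallSetup (π : Set ℕ) (F : Type*) [Field F] (p h m : ℕ) : Prop where
  two_mem : 2 ∈ π
  three_mem : 3 ∈ π
  char_not_mem : p ∉ π
  eq_mul : Nat.card F ^ 2 - 1 = h * m
  mem : ∀ r ∈ h.primeFactors, r ∈ π
  not_mem : ∀ r ∈ m.primeFactors, r ∉ π

namespace HallSetup

set_option linter.unusedSectionVars false

variable {π : Set ℕ} {F : Type*} [Field F] [Finite F] {p h m : ℕ} [hp : Fact p.Prime] [CharP F p]

theorem ne_two (S : HallSetup π F p h m) : p ≠ 2 := by
  rintro rfl; exact S.char_not_mem S.two_mem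

theorem ne_three (S : HallSetup π F p h m) : p ≠ 3 := by
  rintro rfl; exact S.char_not_mem S.three_mem

theorem three_lt (S : HallSetup π F p h m) : 3 < p := by
  have := hp.out.two_le
  have := S.ne_two
  have := S.ne_three
  omega

theorem two_ne (S : HallSetup π F p h m) : (2 : F) ≠ 0 := by
  intro h0
  have := Nat.le_of_dvd (by norm_num) ((CharP.cast_eq_zero_iff F p 2).1 (by exact_mod_cast h0))
  have := S.three_lt
  omega

theorem card_eq_pow (_S : HallSetup π F p h m) : ∃ n : ℕ, 0 < n ∧ Nat.card F = p ^ n := by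
  have := Fintype.ofFinite F
  obtain ⟨n, -, hn⟩ := FiniteField.card F p
  exact ⟨n, n.pos, by rw [Nat.card_eq_fintype_card, hn]⟩

theorem card_odd (S : HallSetup π F p h m) : Nat.card F % 2 = 1 := by
  obtain ⟨n, -, hn⟩ := S.card_eq_pow
  rw [hn, ← Nat.odd_iff]
  exact (hp.out.odd_of_ne_two S.ne_two).pow

theorem one_lt_card (_S : HallSetup π F p h m) : 1 < Nat.card F := Finite.one_lt_card

theorem card_mod_three (S : HallSetup π F p h m) : Nat.card F % 3 ≠ 0 := by
  intro h0
  obtain ⟨n, -, hn⟩ := S.card_eq_pow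
  have h3 : 3 ∣ p ^ n := by rw [← hn]; exact Nat.dvd_of_mod_eq_zero h0
  exact S.ne_three ((Nat.prime_dvd_prime_iff_eq Nat.prime_three hp.out).1
    (Nat.prime_three.dvd_of_dvd_pow h3)).symm

theorem mul_ne_zero' (S : HallSetup π F p h m) : h * m ≠ 0 := by
  rw [← S.eq_mul]
  have := S.one_lt_card
  have : 1 < Nat.card F ^ 2 := Nat.one_lt_pow (by norm_num) this
  omega

theorem h_ne_zero (S : HallSetup π F p h m) : h ≠ 0 := left_ne_zero_of_mul S.mul_ne_zero'

theorem m_ne_zero (S : HallSetup π F p h m) : m ≠ 0 := right_ne_zero_of_mul S.mul_ne_zero'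

theorem not_mem_mul (S : HallSetup π F p h m) : ∀ r ∈ (m * Nat.card F).primeFactors, r ∉ π := by
  obtain ⟨n, hn0, hn⟩ := S.card_eq_pow
  intro r hr
  rw [Nat.primeFactors_mul S.m_ne_zero (by have := S.one_lt_card; omega), Finset.mem_union] at hr
  rcases hr with hr | hr
  · exact S.not_mem r hr
  · rw [hn, Nat.primeFactors_pow _ hn0.ne', hp.out.primeFactors, Finset.mem_singleton] at hr
    rw [hr]; exact S.char_not_mem

theorem card_group (S : HallSetup π F p h m) : Nat.card SL(2, F) = h * (m * Nat.card F) := by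
  rw [card_SL2, S.eq_mul]; ring

theorem isHall_iff (S : HallSetup π F p h m) (H : Subgroup SL(2, F)) :
    IsHall π H ↔ Nat.card H = h :=
  isHall_iff_card S.card_group S.mem S.not_mem_mul H

theorem mem_of_dvd (S : HallSetup π F p h m) {r : ℕ} (hr : r.Prime) (hd : r ∣ h) : r ∈ π :=
  S.mem r (Nat.mem_primeFactors.2 ⟨hr, hd, S.h_ne_zero⟩)

theorem not_dvd_m (S : HallSetup π F p h m) {r : ℕ} (hr : r.Prime) (hd : r ∈ π) : ¬ r ∣ m :=
  fun hm => S.not_mem r (Nat.mem_primeFactors.2 ⟨hr, hm, S.m_ne_zero⟩) hd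

theorem dvd_h (S : HallSetup π F p h m) : 24 ∣ h := by
  have h1 := twentyFour_dvd S.card_odd S.card_mod_three
  rw [S.eq_mul] at h1
  have hc : Nat.Coprime 24 m := by
    rw [show 24 = 2 ^ 3 * 3 by norm_num, Nat.coprime_mul_iff_left]
    exact ⟨Nat.Coprime.pow_left _ ((Nat.Prime.coprime_iff_not_dvd Nat.prime_two).2
      (S.not_dvd_m Nat.prime_two S.two_mem)), (Nat.Prime.coprime_iff_not_dvd Nat.prime_three).2
      (S.not_dvd_m Nat.prime_three S.three_mem)⟩
  exact hc.dvd_of_dvd_mul_right h1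

theorem not_dvd_h (S : HallSetup π F p h m) : ¬ p ∣ h :=
  fun hd => S.char_not_mem (S.mem_of_dvd hp.out hd)

theorem inter_primesOf (S : HallSetup π F p h m) :
    π ∩ primesOf SL(2, F) = {r | r ∈ h.primeFactors} := by
  ext r
  rw [Set.mem_inter_iff, primesOf, Set.mem_ofPred_eq, Set.mem_ofPred_eq, S.card_group,
    Nat.mem_primeFactors, Nat.mem_primeFactors]
  constructor
  · rintro ⟨hr, hr1, hr2, -⟩
    refine ⟨hr1, ?_, S.h_ne_zero⟩
    rcases hr1.dvd_mul.1 hr2 with h' | h'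
    · exact h'
    · exact absurd hr (S.not_mem_mul r (Nat.mem_primeFactors.2 ⟨hr1, h',
        mul_ne_zero S.m_ne_zero (by have := S.one_lt_card; omega)⟩))
  · rintro ⟨hr1, hr2, -⟩
    exact ⟨S.mem_of_dvd hr1 hr2, hr1, hr2.mul_right _,
      mul_ne_zero S.h_ne_zero (mul_ne_zero S.m_ne_zero (by have := S.one_lt_card; omega))⟩

/-- Here h divides q² - 1 = 2(q - ε)s. If every prime of h divides q - ε, which is coprime to s,
then h is coprime to s and the factor s may be dropped. -/
theorem condA_iff (S : HallSetup π F p h m) :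
    CondA π SL(2, F) (Nat.card F) ↔ h ∣ 2 * qSubEps (Nat.card F) := by
  obtain ⟨s, hs, hso, h4, h0, hcop⟩ := exists_sq_sub_one_eq S.card_odd S.one_lt_card
  rw [CondA, S.inter_primesOf]
  constructor
  · intro hsub
    have hd : h ∣ 2 * qSubEps (Nat.card F) * s := by
      rw [show 2 * qSubEps (Nat.card F) * s = h * m by rw [← S.eq_mul, hs]; ring]
      exact dvd_mul_right _ _
    refine Nat.Coprime.dvd_of_dvd_mul_right ?_ hd
    apply Nat.coprime_of_dvd
    intro r hr hrh hrs
    have h1 : r ∈ (qSubEps (Nat.card F)).primeFactors :=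
      hsub (Nat.mem_primeFactors.2 ⟨hr, hrh, S.h_ne_zero⟩)
    exact Nat.not_coprime_of_dvd_of_dvd hr.one_lt (Nat.dvd_of_mem_primeFactors h1) hrs hcop
  · intro hd r hr
    have hr' := Nat.mem_primeFactors.1 hr
    refine Nat.mem_primeFactors.2 ⟨hr'.1, ?_, h0.ne'⟩
    rcases hr'.1.dvd_mul.1 (hr'.2.1.trans hd) with h' | h'
    · exact h'.trans ((by norm_num : 2 ∣ 4).trans h4)
    · exact h'

theorem cond_iff (S : HallSetup π F p h m) {s : Set ℕ} {N : ℕ}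
    (hs : {r | r ∈ N.primeFactors} = s) (hN0 : N ≠ 0) :
    (π ∩ primesOf SL(2, F) = s ∧ piPart s (Nat.card F ^ 2 - 1) = N) ↔ h = N := by
  rw [S.inter_primesOf, S.eq_mul]
  constructor
  · rintro ⟨h1, h3⟩
    rw [← h3, piPart_eq]
    · intro r hr; rw [← h1]; exact hr
    · intro r hr hrs
      rw [← h1] at hrs
      exact S.not_mem r hr (S.mem r hrs)
    · exact S.mul_ne_zero'
  · rintro rfl
    refine ⟨hs, piPart_eq ?_ ?_ S.mul_ne_zero'⟩
    · intro r hr; rw [← hs]; exact hr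
    · intro r hr hrs
      rw [← hs] at hrs
      exact S.not_mem r hr (S.mem r hrs)

theorem condB_iff (S : HallSetup π F p h m) :
    CondB π SL(2, F) (Nat.card F) ↔ h = 24 :=
  S.cond_iff (by
    rw [show 24 = 2 ^ 3 * 3 by norm_num, Nat.primeFactors_mul (by norm_num) (by norm_num),
      Nat.primeFactors_pow _ (by norm_num), Nat.prime_two.primeFactors, Nat.prime_three.primeFactors]
    ext r; simp) (by norm_num)

theorem condC_iff (S : HallSetup π F p h m) :
    CondC π SL(2, F) (Nat.card F) ↔ h = 48 :=
  S.cond_iff (by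
    rw [show 48 = 2 ^ 4 * 3 by norm_num, Nat.primeFactors_mul (by norm_num) (by norm_num),
      Nat.primeFactors_pow _ (by norm_num), Nat.prime_two.primeFactors, Nat.prime_three.primeFactors]
    ext r; simp) (by norm_num)

theorem condD_iff (S : HallSetup π F p h m) :
    CondD π SL(2, F) (Nat.card F) ↔ h = 120 :=
  S.cond_iff (by
    rw [show 120 = 2 ^ 3 * 3 * 5 by norm_num, Nat.primeFactors_mul (by norm_num) (by norm_num),
      Nat.primeFactors_mul (by norm_num) (by norm_num),
      Nat.primeFactors_pow _ (by norm_num), Nat.prime_two.primeFactors,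
      Nat.prime_three.primeFactors, Nat.prime_five.primeFactors]
    ext r; simp) (by norm_num)

end HallSetup

theorem neg_one_mem_of_two_dvd {F : Type*} [Field F] [Finite F] (h2 : (2 : F) ≠ 0)
    {H : Subgroup SL(2, F)} (hH : 2 ∣ Nat.card H) : -1 ∈ H := by
  have : Fact (Nat.Prime 2) := ⟨Nat.prime_two⟩
  obtain ⟨g, hg⟩ := exists_prime_orderOf_dvd_card' 2 hH
  have h1 : (g : SL(2, F)) * g = 1 := by
    have := pow_orderOf_eq_one g
    rw [hg, sq] at this
    exact congrArg Subtype.val this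
  rcases (sq_eq_one_iff_SL2 h2).1 h1 with h | h
  · have : g = 1 := Subtype.ext h
    rw [this, orderOf_one] at hg; omega
  · rw [← h]; exact g.2

/-- In a subgroup of order 4 all fourth powers are 1, so x² = ±1. If -1 never occurred as a square,
all elements would be ±1, too few. -/
theorem exists_sq_eq_neg_one {F : Type*} [Field F] [Finite F] (h2 : (2 : F) ≠ 0)
    {C : Subgroup SL(2, F)} (hC : 4 ∣ Nat.card C) : ∃ I ∈ C, I * I = -1 := by
  have : Fact (Nat.Prime 2) := ⟨Nat.prime_two⟩
  obtain ⟨P, hP⟩ := Sylow.exists_subgroup_card_pow_prime (G := C) 2 (n := 2) hC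
  by_contra hno
  push Not at hno
  have key : ∀ g : P, ((g : C) : SL(2, F)) = 1 ∨ ((g : C) : SL(2, F)) = -1 := by
    intro g
    set x : SL(2, F) := ((g : C) : SL(2, F)) with hx
    have h4 : x ^ 4 = 1 := by
      have := pow_card_eq_one' (x := g)
      rw [hP] at this
      exact congrArg (fun y : P => ((y : C) : SL(2, F))) this
    have h22 : (x * x) * (x * x) = 1 := by rw [← h4]; simp only [pow_succ, pow_zero, one_mul, mul_assoc]
    rcases (sq_eq_one_iff_SL2 h2).1 h22 with h | h
    · exact (sq_eq_one_iff_SL2 h2).1 h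
    · exact absurd h (hno x (g : C).2)
  have hinj : Function.Injective (fun g : P => ((g : C) : SL(2, F))) := by
    intro a b hab
    exact Subtype.ext (Subtype.ext hab)
  have hle : Nat.card P ≤ 2 := by
    rw [← Nat.card_range_of_injective hinj]
    have hsub : Set.range (fun g : P => ((g : C) : SL(2, F))) ⊆ {1, -1} := by
      rintro _ ⟨g, rfl⟩
      exact key g
    exact (Nat.card_mono (Set.toFinite _) hsub).trans (by
      rw [Nat.card_coe_set_eq]; exact (Set.ncard_insert_le _ _).trans (by simp))
  omega

end HallSetup

end HallPi


namespace HallPi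

/-! ### Hall subgroups normalizing a torus. -/

section DihedralType

open Matrix
open scoped MatrixGroups Quaternion

set_option linter.unusedSectionVars false

variable {F : Type*} [Field F]

/-- `H` normalizes `⟨I⟩`, where `I² = -1`, contains `I`, and does not centralize it. -/
structure IsDihedralAt (I : SL(2, F)) (H : Subgroup SL(2, F)) : Prop where
  sq : I * I = -1
  comm_or_anti : ∀ g ∈ H, g * I = I * g ∨ g * I = -(I * g)
  exists_anti : ∃ y ∈ H, y * I = -(I * y)

namespace IsDihedralAt

variable [Finite F] {I : SL(2, F)} {H : Subgroup SL(2, F)}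

theorem not_comm (h2 : (2 : F) ≠ 0) {y : SL(2, F)} (hy : y * I = -(I * y)) :
    y * I ≠ I * y := by
  intro h
  rw [h] at hy
  have : (I * y)⁻¹ * (I * y) = (I * y)⁻¹ * -(I * y) := by rw [← hy]
  rw [mul_neg, inv_mul_cancel] at this
  exact SL2_one_ne_neg_one h2 this

theorem mul_eq_inv_mul (h2 : (2 : F) ≠ 0) (hI : I * I = -1) {y c : SL(2, F)}
    (hy : y * I = -(I * y)) (hc : c ∈ Subgroup.centralizer {I}) : y * c = c⁻¹ * y := by
  obtain ⟨J, h⟩ := exists_isQuatPair_left h2 hI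
  rcases h.exists_mul_of_conj (Or.inr hy) with h' | ⟨c', hc', rfl⟩
  · exact absurd (Subgroup.mem_centralizer_singleton_iff.1 h') (not_comm h2 hy)
  · rw [mul_assoc, h.comm_of_mem h2 hc' hc, ← mul_assoc, h.J_mul_of_mem h2 hc, mul_assoc]

theorem mul_inv_mem {x y : SL(2, F)} (hx : x * I = -(I * x)) (hy : y * I = -(I * y)) :
    x * y⁻¹ ∈ Subgroup.centralizer {I} := by
  rw [Subgroup.mem_centralizer_singleton_iff]
  have : y⁻¹ * I = -(I * y⁻¹) := by
    rw [inv_mul_eq_iff_eq_mul, mul_neg, ← mul_assoc, hy, neg_mul, neg_neg, mul_inv_cancel_right]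
  rw [mul_assoc, this, mul_neg, ← mul_assoc, hx, neg_mul, neg_neg, mul_assoc]

theorem card_eq (h2 : (2 : F) ≠ 0) (h : IsDihedralAt I H) :
    Nat.card H = 2 * Nat.card (H ⊓ Subgroup.centralizer {I} : Subgroup SL(2, F)) := by
  obtain ⟨y, hy, hyI⟩ := h.exists_anti
  set A := H ⊓ Subgroup.centralizer {I} with hA
  have hi : (A.subgroupOf H).index = 2 := by
    rw [Subgroup.index_eq_two_iff]
    refine ⟨⟨y, hy⟩, ?_⟩
    rintro ⟨b, hb⟩
    rw [Subgroup.mem_subgroupOf, Subgroup.mem_subgroupOf]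
    change Xor (b * y ∈ H ⊓ Subgroup.centralizer {I}) (b ∈ H ⊓ Subgroup.centralizer {I})
    rw [Subgroup.mem_inf, Subgroup.mem_inf, Subgroup.mem_centralizer_singleton_iff,
      Subgroup.mem_centralizer_singleton_iff]
    rcases h.comm_or_anti b hb with hc | hc
    · right
      refine ⟨⟨hb, hc⟩, fun h' => not_comm h2 (y := b * y) ?_ h'.2⟩
      rw [mul_assoc, hyI, mul_neg, ← mul_assoc, hc, mul_assoc]
    · left
      refine ⟨⟨mul_mem hb hy, ?_⟩, fun h' => not_comm h2 hc h'.2⟩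
      rw [mul_assoc, hyI, mul_neg, ← mul_assoc, hc, neg_mul, neg_neg, mul_assoc]
  have h1 := Subgroup.index_mul_card (A.subgroupOf H)
  rw [hi, Nat.card_congr (Subgroup.subgroupOfEquivOfLe inf_le_left).toEquiv] at h1
  exact h1.symm

theorem map_conj (h : IsDihedralAt I H) (g : SL(2, F)) :
    IsDihedralAt (g * I * g⁻¹) (H.map (MulAut.conj g).toMonoidHom) where
  sq := by
    rw [show g * I * g⁻¹ * (g * I * g⁻¹) = g * (I * I) * g⁻¹ by group, h.sq]; simp
  comm_or_anti := by
    rintro _ ⟨x, hx, rfl⟩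
    change g * x * g⁻¹ * (g * I * g⁻¹) = g * I * g⁻¹ * (g * x * g⁻¹) ∨ g * x * g⁻¹ * (g * I * g⁻¹) =
      -(g * I * g⁻¹ * (g * x * g⁻¹))
    rw [show g * x * g⁻¹ * (g * I * g⁻¹) = g * (x * I) * g⁻¹ by group,
      show g * I * g⁻¹ * (g * x * g⁻¹) = g * (I * x) * g⁻¹ by group]
    rcases h.comm_or_anti x hx with h' | h'
    · left; rw [h']
    · right; rw [h']; simp
  exists_anti := by
    obtain ⟨y, hy, hyI⟩ := h.exists_anti
    refine ⟨g * y * g⁻¹, ⟨y, hy, rfl⟩, ?_⟩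
    rw [show g * y * g⁻¹ * (g * I * g⁻¹) = g * (y * I) * g⁻¹ by group,
      show g * I * g⁻¹ * (g * y * g⁻¹) = g * (I * y) * g⁻¹ by group, hyI]
    simp

end IsDihedralAt

namespace HallSetup

variable {π : Set ℕ} [Finite F] {p h m : ℕ} [hp : Fact p.Prime] [CharP F p]

theorem four_dvd (S : HallSetup π F p h m) : 4 ∣ h := (by norm_num : 4 ∣ 24).trans S.dvd_h

/-- The number h takes the full 2-part of q² - 1, but q + ε contributes another factor 2 beyond q -
ε. -/
theorem not_dvd_qSubEps (S : HallSetup π F p h m) : ¬ h ∣ qSubEps (Nat.card F) := by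
  obtain ⟨s, hs, hso, h4, h0, hcop⟩ := exists_sq_sub_one_eq S.card_odd S.one_lt_card
  rintro ⟨t, ht⟩
  rw [S.eq_mul, ht, mul_assoc] at hs
  have hm : m = t * (2 * s) := Nat.eq_of_mul_eq_mul_left (Nat.pos_of_ne_zero S.h_ne_zero) hs
  exact S.not_dvd_m Nat.prime_two S.two_mem ⟨t * s, by rw [hm]; ring⟩

/-- The abelian subgroup C has order divisible by 4, so it contains some I with I² = -1 and lies in
the torus of order q - ε. As h does not divide q - ε, C has index exactly 2 and is normal;
conjugates of I under H lie in the torus and square to -1, hence are ±I. -/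
theorem exists_isDihedralAt (S : HallSetup π F p h m) {H C : Subgroup SL(2, F)}
    (hH : Nat.card H = h) (hC : C ≤ H) (hcomm : ∀ a ∈ C, ∀ b ∈ C, a * b = b * a)
    (hle : Nat.card H ≤ 2 * Nat.card C) :
    (∃ I, IsDihedralAt I H) ∧ h ∣ 2 * qSubEps (Nat.card F) := by
  have h2 := S.two_ne
  obtain ⟨k, hk⟩ := Subgroup.card_dvd_of_le hC
  rw [hH] at hk hle
  have hCpos : 0 < Nat.card C := Nat.card_pos
  have hk2 : k ≤ 2 := by
    rw [hk, mul_comm] at hle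
    exact Nat.le_of_mul_le_mul_right hle hCpos
  have hk0 : k ≠ 0 := by rintro rfl; exact S.h_ne_zero (by rw [hk, mul_zero])
  have h4 : 4 ∣ Nat.card C := by
    have := S.dvd_h
    rcases (show k = 1 ∨ k = 2 by omega) with rfl | rfl <;> omega
  obtain ⟨I, hIC, hI⟩ := exists_sq_eq_neg_one h2 h4
  have hCI : C ≤ Subgroup.centralizer {I} := fun c hc =>
    Subgroup.mem_centralizer_singleton_iff.2 (hcomm c hc I hIC)
  have hd := card_centralizer h2 hI
  have hCd : Nat.card C ∣ qSubEps (Nat.card F) := hd ▸ Subgroup.card_dvd_of_le hCI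
  have hk1 : k ≠ 1 := by
    rintro rfl
    rw [mul_one] at hk
    exact S.not_dvd_qSubEps (hk ▸ hCd)
  obtain rfl : k = 2 := by omega
  have hA : H ⊓ Subgroup.centralizer {I} ≤ C := by
    have hCA : C ≤ H ⊓ Subgroup.centralizer {I} := le_inf hC hCI
    obtain ⟨j, hj⟩ := Subgroup.card_dvd_of_le hCA
    have h1 : Nat.card (H ⊓ Subgroup.centralizer {I} : Subgroup SL(2, F)) ∣ h :=
      hH ▸ Subgroup.card_dvd_of_le inf_le_left
    have h3 : Nat.card (H ⊓ Subgroup.centralizer {I} : Subgroup SL(2, F)) ∣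
        qSubEps (Nat.card F) := hd ▸ Subgroup.card_dvd_of_le inf_le_right
    rw [hj, hk] at h1
    have hj2 : j ∣ 2 := Nat.dvd_of_mul_dvd_mul_left hCpos h1
    rcases (Nat.dvd_prime Nat.prime_two).1 hj2 with rfl | rfl
    · rw [mul_one] at hj
      exact (Subgroup.eq_of_le_of_card_ge hCA hj.le).ge
    · rw [hj, ← hk] at h3
      exact absurd h3 S.not_dvd_qSubEps
  have hi : (C.subgroupOf H).index = 2 := by
    have h1 := Subgroup.index_mul_card (C.subgroupOf H)
    rw [Nat.card_congr (Subgroup.subgroupOfEquivOfLe hC).toEquiv, hH, hk, mul_comm] at h1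
    exact Nat.eq_of_mul_eq_mul_left hCpos h1
  have hnorm : (C.subgroupOf H).Normal := Subgroup.normal_of_index_eq_two hi
  obtain ⟨J, hp⟩ := exists_isQuatPair_left h2 hI
  have hca : ∀ g ∈ H, g * I = I * g ∨ g * I = -(I * g) := by
    intro g hg
    have h1 : g * I * g⁻¹ ∈ C := hnorm.conj_mem ⟨I, hC hIC⟩ hIC ⟨g, hg⟩
    have h3 : g * I * g⁻¹ * (g * I * g⁻¹) = -1 := by
      rw [show g * I * g⁻¹ * (g * I * g⁻¹) = g * (I * I) * g⁻¹ by group, hI]; simp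
    rcases hp.eq_or_eq_neg_of_mem_centralizer h2 (hCI h1) h3 with h' | h'
    · left; rwa [mul_inv_eq_iff_eq_mul] at h'
    · right; rwa [mul_inv_eq_iff_eq_mul, neg_mul] at h'
  refine ⟨⟨I, hI, hca, ?_⟩, ?_⟩
  · by_contra hno
    push Not at hno
    have hHC : H ≤ C := fun g hg => hA ⟨hg, Subgroup.mem_centralizer_singleton_iff.2
      ((hca g hg).resolve_right (hno g hg))⟩
    have := Subgroup.card_le_of_le hHC
    rw [hH, hk] at this
    omega
  · rw [hk, mul_comm]
    exact Nat.mul_dvd_mul_left 2 hCd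

/-- After conjugating I to I', both subgroups meet the cyclic torus in subgroups of equal order,
hence in the same A. They differ only in the choice of an element inverting the torus, determined up
to the torus modulo A, and conjugation by s changes such an element by s². The quotient has odd
order, so every change is attained. -/
theorem conjSub_of_isDihedralAt (S : HallSetup π F p h m) {I I' : SL(2, F)}
    {H H' : Subgroup SL(2, F)} (hH : IsDihedralAt I H) (hH' : IsDihedralAt I' H')
    (hc : Nat.card H = h) (hc' : Nat.card H' = h) : ConjSub H H' := by
  have h2 := S.two_ne
  obtain ⟨g, rfl⟩ := conjSub_centralizer_of_sq h2 hH.sq hH'.sq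
  have hHg := hH.map_conj g
  have hcg : Nat.card (H.map (MulAut.conj g).toMonoidHom) = h := by
    rw [← hc]; exact (Nat.card_congr ((MulAut.conj g).subgroupMap H).toEquiv).symm
  suffices ConjSub (H.map (MulAut.conj g).toMonoidHom) H' by
    obtain ⟨s, rfl⟩ := this
    exact ⟨s * g, by rw [Subgroup.map_map, map_mul]; rfl⟩
  generalize H.map (MulAut.conj g).toMonoidHom = K at hHg hcg
  generalize g * I * g⁻¹ = L at hHg hH'
  have hL := hH'.sq
  have hcyc := isCyclic_centralizer h2 hL
  have e1 := hHg.card_eq h2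
  have e2 := hH'.card_eq h2
  have hAA : K ⊓ Subgroup.centralizer {L} = H' ⊓ Subgroup.centralizer {L} :=
    eq_of_card_eq_of_le_isCyclic inf_le_right inf_le_right (by omega)
  obtain ⟨J, hq⟩ := exists_isQuatPair_left h2 hL
  obtain ⟨y, hyK, hy⟩ := hHg.exists_anti
  obtain ⟨y', hyH', hy'⟩ := hH'.exists_anti
  obtain ⟨k, hk⟩ := Subgroup.card_dvd_of_le
    (inf_le_right : H' ⊓ Subgroup.centralizer {L} ≤ Subgroup.centralizer {L})
  -- If the index k of the intersection in the torus were even, then h, twice the order of the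
  -- intersection, would divide q - ε.
  have hkodd : k % 2 = 1 := by
    obtain ⟨s, hs, hso, h4, h0, hcop⟩ := exists_sq_sub_one_eq S.card_odd S.one_lt_card
    by_contra hk2
    obtain ⟨j, rfl⟩ : ∃ j, k = 2 * j := ⟨k / 2, by omega⟩
    rw [card_centralizer h2 hL] at hk
    refine S.not_dvd_qSubEps ⟨j, ?_⟩
    rw [hk, ← hc', e2]; ring
  set t := y * y'⁻¹ with ht
  have htC : t ∈ Subgroup.centralizer {L} := IsDihedralAt.mul_inv_mem hy hy'
  have htk : t ^ k ∈ H' ⊓ Subgroup.centralizer {L} := by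
    refine pow_mem_of_le_normalizer inf_le_right ?_ (by rw [hk, mul_comm]) htC
    intro x hx
    rw [Subgroup.mem_normalizer_iff]
    intro z
    constructor
    · intro hz
      rwa [hq.comm_of_mem h2 hx hz.2, mul_inv_cancel_right]
    · intro hz
      have hzC : z ∈ Subgroup.centralizer {L} := by
        have := mul_mem (mul_mem (inv_mem hx) hz.2) hx
        simpa [mul_assoc] using this
      rwa [hq.comm_of_mem h2 hx hzC, mul_inv_cancel_right] at hz
  obtain ⟨j, rfl⟩ : ∃ j, k = 2 * j + 1 := ⟨k / 2, by omega⟩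
  -- With k = 2j + 1 one gets sys⁻¹ = s²y = t^(2j+1) y' = t^k y', which lies in H'.
  set s := t ^ j with hs
  have hsC : s ∈ Subgroup.centralizer {L} := pow_mem htC j
  have hsy : s * y * s⁻¹ ∈ H' := by
    have h1 : y * s⁻¹ = s * y := by
      rw [IsDihedralAt.mul_eq_inv_mul h2 hL hy (inv_mem hsC), inv_inv]
    have h3 : s * y * s⁻¹ = t ^ (2 * j + 1) * y' := by
      have h4 : y = t * y' := by rw [ht, inv_mul_cancel_right]
      rw [mul_assoc, h1, h4, hs, ← mul_assoc, ← mul_assoc, ← pow_add, ← pow_succ, two_mul]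
    rw [h3]
    exact H'.mul_mem htk.1 hyH'
  refine ⟨s, (Subgroup.eq_of_le_of_card_ge ?_ ?_).symm⟩
  · rintro _ ⟨x, hx, rfl⟩
    change s * x * s⁻¹ ∈ H'
    rcases hHg.comm_or_anti x hx with h' | h'
    · have hxC := Subgroup.mem_centralizer_singleton_iff.2 h'
      rw [hq.comm_of_mem h2 hsC hxC, mul_inv_cancel_right]
      have : x ∈ K ⊓ Subgroup.centralizer {L} := ⟨hx, hxC⟩
      rw [hAA] at this
      exact this.1
    · have hxC := IsDihedralAt.mul_inv_mem h' hy
      have : x * y⁻¹ ∈ K ⊓ Subgroup.centralizer {L} := ⟨K.mul_mem hx (K.inv_mem hyK), hxC⟩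
      rw [hAA] at this
      have h3 : s * x * s⁻¹ = (x * y⁻¹) * (s * y * s⁻¹) := by
        rw [← mul_assoc, ← mul_assoc, ← hq.comm_of_mem h2 hsC hxC]
        group
      rw [h3]
      exact mul_mem this.1 hsy
  · rw [hc', ← hcg]
    exact (Nat.card_congr ((MulAut.conj s).subgroupMap K).toEquiv).le

/-- The torus has a cyclic subgroup of order h/2; it contains -1 = J² and is inverted by J, so
adjoining J doubles it. -/
theorem exists_card_eq_of_dvd (S : HallSetup π F p h m) (hd : h ∣ 2 * qSubEps (Nat.card F)) :
    ∃ H : Subgroup SL(2, F), Nat.card H = h := by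
  have h2 := S.two_ne
  obtain ⟨I, J, hq⟩ := exists_isQuatPair (F := F)
  have hcyc := isCyclic_centralizer h2 hq.sqI
  obtain ⟨n, hn⟩ := (by norm_num : 2 ∣ 4).trans S.four_dvd
  have hnd : n ∣ Nat.card (Subgroup.centralizer {I}) := by
    rw [card_centralizer h2 hq.sqI]
    rw [hn] at hd
    exact Nat.dvd_of_mul_dvd_mul_left (by norm_num) hd
  obtain ⟨C, hC, hCn⟩ := exists_le_card_eq_of_isCyclic hnd
  have hneg : -1 ∈ C := neg_one_mem_of_two_dvd h2 (by
    rw [hCn]; have := S.four_dvd; omega)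
  obtain ⟨H, -, -, hH⟩ := exists_subgroup_card_eq_two_mul (C := C) (y := J)
    (fun h' => hq.J_not_mem h2 (hC h')) (by rw [hq.sqJ]; exact hneg) (by
      intro c hc
      rw [hq.J_mul_of_mem h2 (hC hc), mul_inv_cancel_right]
      exact inv_mem hc)
  exact ⟨H, by rw [hH, hCn, hn]⟩

end HallSetup

end DihedralType

end HallPi


/-! ### Matching Hall subgroups with the four types. -/

namespace HallPi

theorem not_projIso_of_not_commute_sq {G : Type*} [Group G] {H : Subgroup G} {π : Set ℕ} {q : ℕ}
    {X : Type*} [Group X] (hX : ∃ a b : X, a * a * (b * b) ≠ b * b * (a * a))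
    (hH : HallInDihedral π q H) : ¬ ProjIso X H := by
  rintro ⟨f⟩
  obtain ⟨D, ⟨e⟩, hD, -⟩ := hH
  obtain ⟨a, b, hab⟩ := hX
  let j : X →* DihedralGroup (qSubEps q / 2) :=
    e.toMonoidHom.comp ((Subgroup.inclusion hD).comp f.symm.toMonoidHom)
  have hj : Function.Injective j :=
    e.injective.comp ((Subgroup.inclusion_injective hD).comp f.symm.injective)
  exact hab (hj (by rw [map_mul, map_mul, map_mul, map_mul, map_mul, map_mul, dihedralGroup_commute_sq]))

theorem exists_not_commute_sq_alternatingGroup_four :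
    ∃ a b : alternatingGroup (Fin 4), a * a * (b * b) ≠ b * b * (a * a) :=
  ⟨⟨c[0, 1, 2], Equiv.Perm.mem_alternatingGroup.2 (by decide)⟩,
    ⟨c[0, 1, 3], Equiv.Perm.mem_alternatingGroup.2 (by decide)⟩, by
      rw [Ne, ← Subtype.coe_inj]; decide⟩

theorem exists_not_commute_sq_perm_four :
    ∃ a b : Equiv.Perm (Fin 4), a * a * (b * b) ≠ b * b * (a * a) :=
  ⟨c[0, 1, 2], c[0, 1, 3], by decide⟩

theorem exists_not_commute_sq_alternatingGroup_five :
    ∃ a b : alternatingGroup (Fin 5), a * a * (b * b) ≠ b * b * (a * a) :=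
  ⟨⟨c[0, 1, 2], Equiv.Perm.mem_alternatingGroup.2 (by decide)⟩,
    ⟨c[0, 1, 3], Equiv.Perm.mem_alternatingGroup.2 (by decide)⟩, by
      rw [Ne, ← Subtype.coe_inj]; decide⟩

section HallTypes

open Matrix
open scoped MatrixGroups Quaternion

variable {F : Type*} [Field F]

namespace HallSetup

variable {π : Set ℕ} [Finite F] {p h m : ℕ} [hp : Fact p.Prime] [CharP F p]

/-- The torus has cyclic image of order (q - ε)/2 in PG, and the image of J is an involution
inverting it; together they form a dihedral group of order q - ε containing PH. -/
theorem hallInDihedral_of_isDihedralAt (S : HallSetup π F p h m) {I : SL(2, F)}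
    {H : Subgroup SL(2, F)} (hI : IsDihedralAt I H) (hH : Nat.card H = h) :
    HallInDihedral π (Nat.card F) H := by
  have h2 := S.two_ne
  obtain ⟨J, hq⟩ := exists_isQuatPair_left h2 hI.sq
  have hcyc := isCyclic_centralizer h2 hI.sq
  set C := Subgroup.centralizer {I} with hC
  have hd := card_centralizer h2 hI.sq
  obtain ⟨g₀, hg₀⟩ := hcyc.exists_generator
  have hz : Subgroup.zpowers (g₀ : SL(2, F)) = C := by
    apply le_antisymm
    · rw [Subgroup.zpowers_le]; exact g₀.2
    · intro x hx
      obtain ⟨k, hk⟩ := Subgroup.mem_zpowers_iff.1 (hg₀ ⟨x, hx⟩)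
      exact Subgroup.mem_zpowers_iff.2 ⟨k, by rw [← Subgroup.coe_zpow, hk]⟩
  set μ := QuotientGroup.mk' (Subgroup.center SL(2, F)) with hμ
  have hzμ : Subgroup.zpowers (μ g₀) = proj C := by
    exact (MonoidHom.map_zpowers μ (g₀ : SL(2, F))).symm.trans (congrArg (Subgroup.map μ) hz)
  have hnegC : -1 ∈ C := Subgroup.mem_centralizer_singleton_iff.2 (by simp)
  have hn : orderOf (μ g₀) = qSubEps (Nat.card F) / 2 := by
    rw [← Nat.card_zpowers, hzμ, ← hd, SL2_card_proj h2 hnegC]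
    omega
  have hyy : μ J * μ J = 1 := by
    rw [← map_mul, hq.sqJ, SL2_mk_eq_one_iff]
    exact Or.inr rfl
  have hyc : μ J * μ g₀ = (μ g₀)⁻¹ * μ J := by
    rw [← map_mul, hq.J_mul_of_mem h2 g₀.2, map_mul, map_inv]
  have hyn : μ J ∉ Subgroup.zpowers (μ g₀) := by
    rw [hzμ]
    rintro ⟨c, hc, hcJ⟩
    refine hq.J_not_mem h2 ?_
    have h1 : μ (c⁻¹ * J) = 1 := by rw [map_mul, map_inv, hcJ, inv_mul_cancel]
    have h3 : J = c * (c⁻¹ * J) := by group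
    rw [h3]
    refine mul_mem hc ?_
    rcases SL2_mk_eq_one_iff.1 h1 with h' | h' <;> rw [h']
    · exact one_mem _
    · exact hnegC
  obtain ⟨θ, hθ, hθz, hθy⟩ := exists_dihedralGroup_hom hn hyy hyc hyn
  have hle : proj H ≤ θ.range := by
    rintro _ ⟨x, hx, rfl⟩
    have hmem : ∀ c ∈ C, μ c ∈ θ.range := fun c hc => hθz (hzμ ▸ ⟨c, hc, rfl⟩)
    rcases hq.exists_mul_of_conj (hI.comm_or_anti x hx) with h' | ⟨c, hc, rfl⟩
    · exact hmem x h'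
    · rw [map_mul]
      exact mul_mem hθy (hmem c hc)
  refine ⟨θ.range, ⟨(MonoidHom.ofInjective hθ).symm⟩, hle, ?_, ?_⟩
  · intro r hr
    rw [Nat.card_congr (Subgroup.subgroupOfEquivOfLe hle).toEquiv] at hr
    refine S.mem_of_dvd (Nat.prime_of_mem_primeFactors hr)
      ((Nat.dvd_of_mem_primeFactors hr).trans ?_)
    rw [← hH]
    exact Subgroup.card_map_dvd H μ
  · intro r hr
    refine ((S.isHall_iff H).2 hH).2 r (Nat.mem_primeFactors.2
      ⟨Nat.prime_of_mem_primeFactors hr, ?_, Subgroup.index_ne_zero_of_finite⟩)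
    refine (Nat.dvd_of_mem_primeFactors hr).trans
      ((Subgroup.relIndex_dvd_index_of_le hle).trans ?_)
    exact Subgroup.index_map_dvd H (QuotientGroup.mk'_surjective _)

theorem neg_one_mem (S : HallSetup π F p h m) {H : Subgroup SL(2, F)} (hH : Nat.card H = h) :
    -1 ∈ H :=
  neg_one_mem_of_two_dvd S.two_ne (hH ▸ (by norm_num : 2 ∣ 4).trans S.four_dvd)

theorem hall_alternatives (S : HallSetup π F p h m) {H : Subgroup SL(2, F)}
    (hH : Nat.card H = h) :
    ((∃ I, IsDihedralAt I H) ∧ h ∣ 2 * qSubEps (Nat.card F)) ∨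
      (h = 24 ∧ ProjIso (alternatingGroup (Fin 4)) H) ∨
      (h = 48 ∧ ProjIso (Equiv.Perm (Fin 4)) H) ∨
      (h = 120 ∧ ProjIso (alternatingGroup (Fin 5)) H) := by
  have h2 := S.two_ne
  rcases finite_subgroup_alternatives h2 H (S.neg_one_mem hH)
    (central_of_trace_sq h2 (hH ▸ S.not_dvd_h)) with ⟨C, hC, hcomm, hle⟩ | h' | h' | h'
  · exact Or.inl (S.exists_isDihedralAt hH hC hcomm hle)
  all_goals rw [hH] at h'; tauto

theorem exists_isDihedralAt_of_hallInDihedral (S : HallSetup π F p h m) {H : Subgroup SL(2, F)}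
    (hH : Nat.card H = h) (hD : HallInDihedral π (Nat.card F) H) : ∃ I, IsDihedralAt I H := by
  rcases S.hall_alternatives hH with h' | ⟨-, h'⟩ | ⟨-, h'⟩ | ⟨-, h'⟩
  · exact h'.1
  · exact absurd h' (not_projIso_of_not_commute_sq exists_not_commute_sq_alternatingGroup_four hD)
  · exact absurd h' (not_projIso_of_not_commute_sq exists_not_commute_sq_perm_four hD)
  · exact absurd h' (not_projIso_of_not_commute_sq exists_not_commute_sq_alternatingGroup_five hD)

/-- The 2-part of q² - 1 is exactly 8, that is q ≡ ±3 modulo 8. -/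
theorem not_isSquare_two (S : HallSetup π F p 24 m) : ¬ IsSquare (2 : F) := by
  have := Fintype.ofFinite F
  rw [FiniteField.isSquare_two_iff, ← Nat.card_eq_fintype_card]
  have h1 := S.eq_mul
  have h3 := S.not_dvd_m Nat.prime_two S.two_mem
  have h4 : 1 ≤ Nat.card F ^ 2 := Nat.one_le_pow _ _ Nat.card_pos
  have h5 : Nat.card F ^ 2 % 16 = 9 := by omega
  have h6 : (Nat.card F % 16) ^ 2 % 16 = 9 := by rw [← Nat.pow_mod, h5]
  have h7 : Nat.card F % 16 < 16 := Nat.mod_lt _ (by norm_num)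
  generalize hr : Nat.card F % 16 = r at h6 h7
  interval_cases r <;> omega

/-- Now 16 divides q² - 1, so q ≡ ±1 modulo 8 and 2 is a square. -/
theorem exists_two_mul_sq_eq_one (S : HallSetup π F p 48 m) : ∃ c : F, 2 * c ^ 2 = 1 := by
  have := Fintype.ofFinite F
  have hsq : IsSquare (2 : F) := by
    rw [FiniteField.isSquare_two_iff, ← Nat.card_eq_fintype_card]
    have h1 := S.eq_mul
    have h4 : 1 ≤ Nat.card F ^ 2 := Nat.one_le_pow _ _ Nat.card_pos
    have h5 : Nat.card F ^ 2 % 16 = 1 := by omega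
    have h6 : (Nat.card F % 16) ^ 2 % 16 = 1 := by rw [← Nat.pow_mod, h5]
    have h7 : Nat.card F % 16 < 16 := Nat.mod_lt _ (by norm_num)
    generalize hr : Nat.card F % 16 = r at h6 h7
    interval_cases r <;> omega
  obtain ⟨b, hb⟩ := hsq
  have hb0 : b ≠ 0 := by
    rintro rfl
    exact S.two_ne (by rw [hb, mul_zero])
  exact ⟨b⁻¹, by rw [hb]; field_simp⟩

theorem five_lt (S : HallSetup π F p 120 m) : 5 < p := by
  have h3 := S.three_lt
  have h5 : (5 : ℕ) ∈ π := S.mem_of_dvd Nat.prime_five (by norm_num)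
  have : p ≠ 5 := fun h' => S.char_not_mem (h' ▸ h5)
  have : p ≠ 4 := fun h' => by have := hp.out; rw [h'] at this; norm_num at this
  omega

/-- The trace t of an element of order 5 satisfies t⁴ - 3t² + 1 = (t² - t - 1)(t² + t - 1) = 0, so t
or -t serves. -/
theorem exists_sq_eq_add_one (S : HallSetup π F p 120 m) : ∃ c : F, c ^ 2 = c + 1 := by
  have hd : 5 ∣ Nat.card SL(2, F) := by
    rw [S.card_group]; exact Dvd.dvd.mul_right (by norm_num) _
  have : Fact (Nat.Prime 5) := ⟨Nat.prime_five⟩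
  obtain ⟨g, hg⟩ := exists_prime_orderOf_dvd_card' 5 hd
  have h1 : g ≠ 1 := by rintro rfl; simp at hg
  have h1' : g ≠ -1 := by
    rintro rfl
    have : orderOf (-1 : SL(2, F)) ∣ 2 := orderOf_dvd_of_pow_eq_one (by simp)
    rw [hg] at this
    norm_num at this
  have ht := trace_of_pow_five h1 h1' (Or.inl (by rw [← hg, pow_orderOf_eq_one]))
  generalize (mat g).trace = t at ht
  have : (t ^ 2 - t - 1) * (t ^ 2 + t - 1) = 0 := by linear_combination ht
  rcases mul_eq_zero.1 this with h' | h'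
  · exact ⟨t, by linear_combination h'⟩
  · exact ⟨-t, by linear_combination h'⟩

theorem projIso_alternatingGroup_four_iff (S : HallSetup π F p 24 m) (H : Subgroup SL(2, F)) :
    (Nat.card H = 24 ∧ ProjIso (alternatingGroup (Fin 4)) H) ↔
      ∃ (I J : SL(2, F)) (h : IsQuatPair I J), H = Subgroup.closure {I, h.eltW S.two_ne} := by
  constructor
  · rintro ⟨hc, hH⟩
    exact eq_closure_of_projIso_alternatingGroup_four S.two_ne (S.neg_one_mem hc) hH hc
  · rintro ⟨I, J, h, rfl⟩
    exact ⟨(h.isQuatTriple S.two_ne).card_closure S.two_ne,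
      (h.isQuatTriple S.two_ne).projIso S.three_lt S.two_ne⟩

theorem projIso_perm_four_iff (S : HallSetup π F p 48 m) {c : F} (hc : 2 * c ^ 2 = 1)
    (H : Subgroup SL(2, F)) :
    (Nat.card H = 48 ∧ ProjIso (Equiv.Perm (Fin 4)) H) ↔
      ∃ (I J : SL(2, F)) (h : IsQuatPair I J),
        H = Subgroup.closure {I, h.eltW S.two_ne, h.eltR S.two_ne hc} := by
  constructor
  · rintro ⟨hcard, hH⟩
    exact eq_closure_of_projIso_perm_four S.two_ne (S.neg_one_mem hcard) hH hcard hc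
  · rintro ⟨I, J, h, rfl⟩
    exact ⟨(h.isOctahedral S.two_ne hc).card_closure S.two_ne,
      (h.isOctahedral S.two_ne hc).projIso S.three_lt S.two_ne⟩

theorem projIso_alternatingGroup_five_iff (S : HallSetup π F p 120 m) {c : F}
    (hc : c ^ 2 = c + 1) (H : Subgroup SL(2, F)) :
    (Nat.card H = 120 ∧ ProjIso (alternatingGroup (Fin 5)) H) ↔
      ∃ (I J : SL(2, F)) (h : IsQuatPair I J),
        H = Subgroup.closure {I, h.eltW S.two_ne, h.eltS S.two_ne hc} := by
  constructor
  · rintro ⟨hcard, hH⟩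
    exact eq_closure_of_projIso_alternatingGroup_five S.two_ne (S.neg_one_mem hcard) hH hcard hc
  · rintro ⟨I, J, h, rfl⟩
    exact ⟨(h.isIcosahedral S.two_ne hc).card_closure S.two_ne,
      (h.isIcosahedral S.two_ne hc).projIso S.five_lt S.two_ne⟩

/-- The `π`-Hall subgroups with image `Sym₄`, if any, form two classes. -/
theorem twoGLClasses_perm_four (S : HallSetup π F p 48 m) :
    TwoGLClasses fun H : Subgroup SL(2, F) =>
      Nat.card H = 48 ∧ ProjIso (Equiv.Perm (Fin 4)) H := by
  obtain ⟨c, hc⟩ := S.exists_two_mul_sq_eq_one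
  simp only [S.projIso_perm_four_iff hc]
  exact twoGLClasses_octahedral S.two_ne hc

theorem twoGLClasses_alternatingGroup_five (S : HallSetup π F p 120 m) :
    TwoGLClasses fun H : Subgroup SL(2, F) =>
      Nat.card H = 120 ∧ ProjIso (alternatingGroup (Fin 5)) H := by
  obtain ⟨c, hc⟩ := S.exists_sq_eq_add_one
  simp only [S.projIso_alternatingGroup_five_iff hc]
  exact twoGLClasses_icosahedral S.five_lt S.two_ne hc

theorem conjSub_of_projIso_alternatingGroup_four (S : HallSetup π F p 24 m)
    {H K : Subgroup SL(2, F)} (hH : Nat.card H = 24) (hH' : ProjIso (alternatingGroup (Fin 4)) H)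
    (hK : Nat.card K = 24) (hK' : ProjIso (alternatingGroup (Fin 4)) K) : ConjSub H K := by
  obtain ⟨I, J, h, rfl⟩ := (S.projIso_alternatingGroup_four_iff H).1 ⟨hH, hH'⟩
  obtain ⟨I', J', h', rfl⟩ := (S.projIso_alternatingGroup_four_iff K).1 ⟨hK, hK'⟩
  exact IsQuatPair.conjSub_tetrahedral S.two_ne S.not_isSquare_two h h'

theorem exists_projIso_alternatingGroup_four (S : HallSetup π F p 24 m) :
    ∃ H : Subgroup SL(2, F), Nat.card H = 24 ∧ ProjIso (alternatingGroup (Fin 4)) H := by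
  obtain ⟨I, J, h⟩ := exists_isQuatPair (F := F)
  exact ⟨_, (S.projIso_alternatingGroup_four_iff _).2 ⟨I, J, h, rfl⟩⟩

end HallSetup

end HallTypes

end HallPi


namespace HallPi

/-! ### Counting classes, and preimages of Hall subgroups of PG. -/

section ConjugateSubgroups

variable {G : Type*} [Group G] {H K L : Subgroup G}

theorem ConjSub.refl (H : Subgroup G) : ConjSub H H := ⟨1, by
  rw [map_one]; exact (Subgroup.map_id H).symm⟩

theorem ConjSub.trans (h : ConjSub H K) (h' : ConjSub K L) : ConjSub H L := by
  obtain ⟨g, rfl⟩ := h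
  obtain ⟨g', rfl⟩ := h'
  exact ⟨g' * g, by rw [Subgroup.map_map, map_mul]; rfl⟩

theorem ConjSub.symm (h : ConjSub H K) : ConjSub K H := by
  obtain ⟨g, rfl⟩ := h
  refine ⟨g⁻¹, ?_⟩
  have : ((MulAut.conj g⁻¹).toMonoidHom.comp (MulAut.conj g).toMonoidHom) = MonoidHom.id G := by
    ext x; simp [mul_assoc]
  rw [Subgroup.map_map, this, Subgroup.map_id]

theorem ConjSub.card_eq (h : ConjSub H K) : Nat.card K = Nat.card H := by
  obtain ⟨g, rfl⟩ := h
  exact (Nat.card_congr ((MulAut.conj g).subgroupMap H).toEquiv).symm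

/-- If every `π`-Hall subgroup is conjugate to one of three subgroups, there are at most three
classes. -/
theorem numHallClasses_mem_of_three [Finite G] {π : Set ℕ} (hE : SatisfiesE π G)
    (K₁ K₂ K₃ : Subgroup G)
    (hK : ∀ H : Subgroup G, IsHall π H → ConjSub K₁ H ∨ ConjSub K₂ H ∨ ConjSub K₃ H) :
    numHallClasses π G = 1 ∨ numHallClasses π G = 2 ∨ numHallClasses π G = 3 := by
  classical
  set S := {C : Set (Subgroup G) | ∃ H : Subgroup G, IsHall π H ∧ C = {K | ConjSub H K}} with hS
  have hcl : ∀ {H K : Subgroup G}, ConjSub K H → {L | ConjSub H L} = {L | ConjSub K L} := by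
    intro H K h
    ext L
    exact ⟨fun h' => h.trans h', fun h' => h.symm.trans h'⟩
  have hsub : S ⊆ (({{L | ConjSub K₁ L}, {L | ConjSub K₂ L}, {L | ConjSub K₃ L}} :
      Finset (Set (Subgroup G))) : Set (Set (Subgroup G))) := by
    rintro C ⟨H, hH, rfl⟩
    rw [Finset.mem_coe, Finset.mem_insert, Finset.mem_insert, Finset.mem_singleton]
    exact (hK H hH).imp hcl (Or.imp hcl hcl)
  have h3 : S.ncard ≤ 3 := by
    refine (Set.ncard_le_ncard hsub (Finset.finite_toSet _)).trans ?_
    rw [Set.ncard_coe_finset]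
    exact Finset.card_le_three
  have h0 : 0 < S.ncard := by
    rw [Set.ncard_pos (Set.Finite.subset (Finset.finite_toSet _) hsub)]
    obtain ⟨H, hH⟩ := hE
    exact ⟨_, H, hH, rfl⟩
  change S.ncard = 1 ∨ S.ncard = 2 ∨ S.ncard = 3
  omega

theorem not_satisfiesD {π : Set ℕ} (h : ∀ H : Subgroup G, IsHall π H →
    ∃ L : Subgroup G, IsPiSubgroup π L ∧ ∀ M : Subgroup G, M ≤ H → ¬ ConjSub L M) :
    ¬ SatisfiesD π G := by
  rintro ⟨⟨⟨H, hH⟩, hC⟩, hD⟩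
  obtain ⟨L, hL, hn⟩ := h H hH
  obtain ⟨H', hH', hL'⟩ := hD L hL
  obtain ⟨g, rfl⟩ := hC H' H hH' hH
  exact hn _ (Subgroup.map_mono hL') ⟨g, rfl⟩

/-- The preimage keeps the index and doubles the order, and 2 ∈ π. -/
theorem isHall_comap_of_card_center [Finite G] {π : Set ℕ} (h2 : 2 ∈ π)
    (hc : Nat.card (Subgroup.center G) = 2) {P : Subgroup (G ⧸ Subgroup.center G)}
    (hP : IsHall π P) : IsHall π (P.comap (QuotientGroup.mk' (Subgroup.center G))) := by
  have hs := QuotientGroup.mk'_surjective (Subgroup.center G)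
  have hi : (P.comap (QuotientGroup.mk' (Subgroup.center G))).index = P.index :=
    Subgroup.index_comap_of_surjective _ hs
  refine ⟨fun r hr => ?_, fun r hr => hP.2 r (hi ▸ hr)⟩
  have h1 := Subgroup.index_mul_card (P.comap (QuotientGroup.mk' (Subgroup.center G)))
  have h3 := Subgroup.card_eq_card_quotient_mul_card_subgroup (Subgroup.center G)
  have h4 := Subgroup.index_mul_card P
  have h5 : 0 < P.index := Nat.pos_of_ne_zero Subgroup.index_ne_zero_of_finite
  have hcard : Nat.card (P.comap (QuotientGroup.mk' (Subgroup.center G))) = Nat.card P * 2 := by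
    rw [hi, h3, ← h4, hc, mul_assoc] at h1
    exact Nat.eq_of_mul_eq_mul_left h5 h1
  rw [hcard, Nat.primeFactors_mul Nat.card_pos.ne' (by norm_num), Finset.mem_union] at hr
  rcases hr with hr | hr
  · exact hP.1 r hr
  · rw [Nat.prime_two.primeFactors, Finset.mem_singleton] at hr
    exact hr ▸ h2

end ConjugateSubgroups

/-- Alt₄ contains no copy of Sym₃. -/
theorem alternatingGroup_four_not_inverting {x y : alternatingGroup (Fin 4)} (hx : x * x * x = 1)
    (hy : y * y = 1) (hxy : y * x = x⁻¹ * y) : x = 1 ∨ y = 1 := by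
  revert x y
  decide

/-! ### Every Hall subgroup misses some π-subgroup up to conjugacy. -/

section NonDominance

open Matrix
open scoped MatrixGroups Quaternion

variable {F : Type*} [Field F]

theorem exists_sum_eq_one [Finite F] (h2 : (2 : F) ≠ 0) (h3 : (3 : F) ≠ 0)
    (hodd : Nat.card F % 2 = 1) : ∃ x y : F, x ^ 2 + y ^ 2 + (-x - y) ^ 2 = 1 := by
  have := Fintype.ofFinite F
  have hd : ∀ a b : F, a ≠ 0 → (Polynomial.C a * Polynomial.X ^ 2 + Polynomial.C 0 * Polynomial.X +
      Polynomial.C b).degree = 2 := fun a b ha => Polynomial.degree_quadratic ha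
  -- Completing the square: with a = x + y/2 and b = y, the form x² + y² + (x + y)² is 2a² +
  -- (3/2)b².
  obtain ⟨a, b, hab⟩ := FiniteField.exists_root_sum_quadratic (hd 2 0 h2)
    (hd (3 / 2) (-1) (div_ne_zero h3 h2)) (by rwa [← Nat.card_eq_fintype_card])
  simp at hab
  refine ⟨a - b / 2, b, ?_⟩
  field_simp at hab ⊢
  linear_combination 2 * hab

/-- There is an element of order `4` inverting a given element of order `6`. -/
theorem IsQuatPair.exists_inverting [Finite F] (h2 : (2 : F) ≠ 0) (h3 : (3 : F) ≠ 0)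
    (hodd : Nat.card F % 2 = 1) {I J : SL(2, F)} (h : IsQuatPair I J) :
    ∃ w : SL(2, F), w * w = -1 ∧ w * h.eltW h2 = (h.eltW h2)⁻¹ * w := by
  obtain ⟨x, y, hxy⟩ := exists_sum_eq_one h2 h3 hodd
  have hn : quatNorm (⟨0, x, y, -x - y⟩ : ℍ[F,-1,-1]) = 1 := by
    simp only [quatNorm]; linear_combination hxy
  refine ⟨h.ofQuat h2 _ hn, ?_, ?_⟩
  · apply mul_self_eq_neg_one_of_trace
    rw [h.mat_ofQuat, h.trace_hom h2, mul_zero]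
  · refine h.eq_of_hom (h.mat_mul_hom (h.mat_ofQuat h2 _ hn) (h.mat_eltW h2))
      (h.mat_mul_hom (h.mat_inv_hom h2 (h.mat_eltW h2)) (h.mat_ofQuat h2 _ hn)) ?_
    ext <;> simp <;> ring

theorem IsQuatTriple.W_ne (h2 : (2 : F) ≠ 0) {I J W : SL(2, F)} (h : IsQuatTriple I J W) :
    ¬ (W = 1 ∨ W = -1) := by
  intro hW
  have h1 : W * W = 1 := by rcases hW with rfl | rfl <;> simp
  have := h.orderOf_W_sq h2
  rw [h1, orderOf_one] at this
  norm_num at this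

namespace HallSetup

variable {π : Set ℕ} [Finite F] {p h m : ℕ} [hp : Fact p.Prime] [CharP F p]

theorem three_ne (S : HallSetup π F p h m) : (3 : F) ≠ 0 := by
  intro h3
  have h4 : ((3 : ℕ) : F) = 0 := by exact_mod_cast h3
  rw [CharP.cast_eq_zero_iff F p] at h4
  exact S.ne_three ((Nat.prime_dvd_prime_iff_eq hp.out Nat.prime_three).1 h4)

theorem isPiSubgroup_of_card_dvd (S : HallSetup π F p h m) {G : Type*} [Group G] {L : Subgroup G}
    (hL : Nat.card L ∣ h) : IsPiSubgroup π L := fun _ hr =>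
  S.mem_of_dvd (Nat.prime_of_mem_primeFactors hr) ((Nat.dvd_of_mem_primeFactors hr).trans hL)

/-- The binary tetrahedral group has order 24, which divides h, but it cannot lie in a group with an
abelian subgroup of index 2. -/
theorem exists_not_conj_of_isDihedralAt (S : HallSetup π F p h m) {I : SL(2, F)}
    {H : Subgroup SL(2, F)} (hI : IsDihedralAt I H) :
    ∃ L : Subgroup SL(2, F), IsPiSubgroup π L ∧ ∀ M ≤ H, ¬ ConjSub L M := by
  have h2 := S.two_ne
  obtain ⟨I', J', hq⟩ := exists_isQuatPair (F := F)
  have ht := hq.isQuatTriple h2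
  refine ⟨Subgroup.closure {I', hq.eltW h2},
    S.isPiSubgroup_of_card_dvd (by rw [ht.card_closure h2]; exact S.dvd_h), ?_⟩
  intro M hM hc
  obtain ⟨g, hg⟩ := hc.symm
  have hI' := hI.map_conj g
  have hle : Subgroup.closure {I', hq.eltW h2} ≤ H.map (MulAut.conj g).toMonoidHom := by
    rw [hg]; exact Subgroup.map_mono hM
  obtain ⟨J, hp⟩ := exists_isQuatPair_left h2 hI'.sq
  exact ht.not_abelian_index_two h2 (hle (Subgroup.subset_closure (by simp)))
    (hle (Subgroup.subset_closure (by simp)))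
    ⟨_, inf_le_left, fun a ha b hb => hp.comm_of_mem h2 ha.2 hb.2, (hI'.card_eq h2).le⟩

/-- The group generated by W and an element w inverting it has order dividing 12, hence is a
π-group. Inside H it would give in Alt₄ a nontrivial involution inverting an element of order 3. -/
theorem exists_not_conj_of_projIso_alternatingGroup_four (S : HallSetup π F p h m)
    {H : Subgroup SL(2, F)} (hH : ProjIso (alternatingGroup (Fin 4)) H) :
    ∃ L : Subgroup SL(2, F), IsPiSubgroup π L ∧ ∀ M ≤ H, ¬ ConjSub L M := by
  have h2 := S.two_ne
  obtain ⟨I, J, hq⟩ := exists_isQuatPair (F := F)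
  have ht := hq.isQuatTriple h2
  obtain ⟨w, hw, hwW⟩ := hq.exists_inverting h2 S.three_ne S.card_odd
  set W := hq.eltW h2 with hW
  have hw1 : ¬ (w = 1 ∨ w = -1) := by
    intro h'
    rw [(sq_eq_one_iff_SL2 h2).2 h'] at hw
    exact SL2_one_ne_neg_one h2 hw
  have hinv : ∀ c ∈ Subgroup.zpowers W, w * c * w⁻¹ = c⁻¹ := by
    rintro _ ⟨k, rfl⟩
    change w * W ^ k * w⁻¹ = (W ^ k)⁻¹
    rw [← conj_zpow, hwW, mul_inv_cancel_right, _root_.inv_zpow]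
  have hW3 : W * W * W = -1 := ht.cube
  have hnegC : -1 ∈ Subgroup.zpowers W := hW3 ▸
    mul_mem (mul_mem (Subgroup.mem_zpowers W) (Subgroup.mem_zpowers W)) (Subgroup.mem_zpowers W)
  obtain ⟨L, hCL, hwL, hL⟩ := exists_subgroup_card_eq_two_mul (C := Subgroup.zpowers W) (y := w)
    (by
      intro hwC
      have h1 := hinv w hwC
      rw [mul_inv_cancel_right] at h1
      have h3 : w * w = 1 := by nth_rewrite 1 [h1]; exact inv_mul_cancel w
      exact hw1 ((sq_eq_one_iff_SL2 h2).1 h3))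
    (by rw [hw]; exact hnegC) (fun c hc => by rw [hinv c hc]; exact inv_mem hc)
  refine ⟨L, S.isPiSubgroup_of_card_dvd ?_, ?_⟩
  · have h6 : orderOf W ∣ 6 := orderOf_dvd_of_pow_eq_one (by
      rw [show (6 : ℕ) = 3 * 2 by norm_num, pow_mul, pow_three', hW3]; simp)
    rw [hL, Nat.card_zpowers]
    exact (Nat.mul_dvd_mul_left 2 h6).trans ((by norm_num : 2 * 6 ∣ 24).trans S.dvd_h)
  · rintro M hM ⟨g, rfl⟩
    obtain ⟨f⟩ := hH
    have hgm : ∀ z ∈ L, g * z * g⁻¹ ∈ H := fun z hz => hM ⟨z, hz, rfl⟩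
    obtain ⟨x, hx⟩ : ∃ x, Lifts f (g * W * g⁻¹) x :=
      ⟨_, hgm _ (hCL (Subgroup.mem_zpowers W)), rfl⟩
    obtain ⟨y, hy⟩ : ∃ y, Lifts f (g * w * g⁻¹) y := ⟨_, hgm _ hwL, rfl⟩
    have hconj : ∀ z : SL(2, F), g * z * g⁻¹ = 1 ∨ g * z * g⁻¹ = -1 → z = 1 ∨ z = -1 := by
      rintro z (h' | h')
      · left; rwa [mul_inv_eq_iff_eq_mul, one_mul, mul_eq_left] at h'
      · right
        rw [mul_inv_eq_iff_eq_mul, neg_one_mul] at h'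
        apply mul_left_cancel (a := g)
        rw [h', mul_neg, mul_one]
    have h1 : x * x * x = 1 := ((hx.mul hx).mul hx).eq_one_iff.2 (Or.inr (by
      rw [show g * W * g⁻¹ * (g * W * g⁻¹) * (g * W * g⁻¹) = g * (W * W * W) * g⁻¹ by group, hW3]
      simp))
    have h3 : y * y = 1 := (hy.mul hy).eq_one_iff.2 (Or.inr (by
      rw [show g * w * g⁻¹ * (g * w * g⁻¹) = g * (w * w) * g⁻¹ by group, hw]; simp))
    have h5 : y * x = x⁻¹ * y := by
      have h6 := ((hy.mul hx).mul (hx.inv.mul hy).inv).eq_one_iff.2 (Or.inl (by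
        rw [mul_inv_eq_one, show g * w * g⁻¹ * (g * W * g⁻¹) = g * (w * W) * g⁻¹ by group, hwW]
        group))
      exact mul_inv_eq_one.1 h6
    rcases alternatingGroup_four_not_inverting h1 h3 h5 with h' | h'
    · exact ht.W_ne h2 (hconj _ (hx.eq_one_iff.1 h'))
    · exact hw1 (hconj _ (hy.eq_one_iff.1 h'))

/-- A Hall subgroup of the other class has the same order as H, so a conjugate of it inside H would
equal H. -/
theorem exists_not_conj_of_twoGLClasses (S : HallSetup π F p h m) {T : Subgroup SL(2, F) → Prop}
    (hT : TwoGLClasses T) (hTh : ∀ H, T H → Nat.card H = h) {H : Subgroup SL(2, F)} (hH : T H) :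
    ∃ L : Subgroup SL(2, F), IsPiSubgroup π L ∧ ∀ M ≤ H, ¬ ConjSub L M := by
  obtain ⟨H₁, H₂, h1, h2, hn, hiff, -⟩ := hT
  have key : ∀ L, T L → ¬ ConjSub L H → ∃ L : Subgroup SL(2, F),
      IsPiSubgroup π L ∧ ∀ M ≤ H, ¬ ConjSub L M := by
    intro L hL hLH
    refine ⟨L, S.isPiSubgroup_of_card_dvd (by rw [hTh L hL]), fun M hM hc => hLH ?_⟩
    rwa [← Subgroup.eq_of_le_of_card_ge hM (by rw [hc.card_eq, hTh L hL, hTh H hH])]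
  rcases (hiff H).1 hH with h' | h'
  · exact key H₂ h2 fun h3 => hn (h'.trans h3.symm)
  · exact key H₁ h1 fun h3 => hn (h3.trans h'.symm)

theorem exists_not_conj (S : HallSetup π F p h m) {H : Subgroup SL(2, F)} (hH : Nat.card H = h) :
    ∃ L : Subgroup SL(2, F), IsPiSubgroup π L ∧ ∀ M ≤ H, ¬ ConjSub L M := by
  rcases S.hall_alternatives hH with ⟨⟨I, hI⟩, -⟩ | ⟨-, h'⟩ | ⟨rfl, h'⟩ | ⟨rfl, h'⟩
  · exact S.exists_not_conj_of_isDihedralAt hI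
  · exact S.exists_not_conj_of_projIso_alternatingGroup_four h'
  · exact S.exists_not_conj_of_twoGLClasses S.twoGLClasses_perm_four (fun _ h => h.1) ⟨hH, h'⟩
  · exact S.exists_not_conj_of_twoGLClasses S.twoGLClasses_alternatingGroup_five (fun _ h => h.1)
      ⟨hH, h'⟩

/-- The dihedral type contributes at most one class; h determines which polyhedral type can occur,
and that one contributes at most two. -/
theorem exists_three (S : HallSetup π F p h m) : ∃ K₁ K₂ K₃ : Subgroup SL(2, F),
    ∀ H : Subgroup SL(2, F), Nat.card H = h → ConjSub K₁ H ∨ ConjSub K₂ H ∨ ConjSub K₃ H := by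
  obtain ⟨K₁, hK₁⟩ : ∃ K₁ : Subgroup SL(2, F), ∀ H : Subgroup SL(2, F), Nat.card H = h →
      (∃ I, IsDihedralAt I H) → ConjSub K₁ H := by
    by_cases hex : ∃ K₁ : Subgroup SL(2, F), Nat.card K₁ = h ∧ ∃ I, IsDihedralAt I K₁
    · obtain ⟨K₁, hK, I, hI⟩ := hex
      exact ⟨K₁, fun H hH ⟨I', hI'⟩ => S.conjSub_of_isDihedralAt hI hI' hK hH⟩
    · exact ⟨⊥, fun H hH hI => absurd ⟨H, hH, hI⟩ hex⟩
  have h48 : ∀ {T : Subgroup SL(2, F) → Prop}, TwoGLClasses T →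
      (∀ H : Subgroup SL(2, F), Nat.card H = h → (∃ I, IsDihedralAt I H) ∨ T H) →
      ∃ K₁ K₂ K₃ : Subgroup SL(2, F), ∀ H : Subgroup SL(2, F), Nat.card H = h →
        ConjSub K₁ H ∨ ConjSub K₂ H ∨ ConjSub K₃ H := by
    rintro T ⟨H₁, H₂, -, -, -, hiff, -⟩ hT
    exact ⟨K₁, H₁, H₂, fun H hH => (hT H hH).imp (hK₁ H hH) (hiff H).1⟩
  by_cases h24 : h = 24
  · subst h24
    obtain ⟨K₂, hK₂, hK₂'⟩ := S.exists_projIso_alternatingGroup_four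
    refine ⟨K₁, K₂, K₂, fun H hH => ?_⟩
    rcases S.hall_alternatives hH with ⟨h', -⟩ | ⟨-, h'⟩ | ⟨h', -⟩ | ⟨h', -⟩
    · exact Or.inl (hK₁ H hH h')
    · exact Or.inr (Or.inl (S.conjSub_of_projIso_alternatingGroup_four hK₂ hK₂' hH h'))
    all_goals norm_num at h'
  by_cases h48' : h = 48
  · subst h48'
    refine h48 S.twoGLClasses_perm_four fun H hH => ?_
    rcases S.hall_alternatives hH with ⟨h', -⟩ | ⟨h', -⟩ | ⟨-, h'⟩ | ⟨h', -⟩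
    · exact Or.inl h'
    · norm_num at h'
    · exact Or.inr ⟨hH, h'⟩
    · norm_num at h'
  by_cases h120 : h = 120
  · subst h120
    refine h48 S.twoGLClasses_alternatingGroup_five fun H hH => ?_
    rcases S.hall_alternatives hH with ⟨h', -⟩ | ⟨h', -⟩ | ⟨h', -⟩ | ⟨-, h'⟩
    · exact Or.inl h'
    · norm_num at h'
    · norm_num at h'
    · exact Or.inr ⟨hH, h'⟩
  refine ⟨K₁, K₁, K₁, fun H hH => Or.inl (hK₁ H hH ?_)⟩
  rcases S.hall_alternatives hH with ⟨h', -⟩ | ⟨h', -⟩ | ⟨h', -⟩ | ⟨h', -⟩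
  · exact h'
  all_goals contradiction

end HallSetup

end NonDominance

end HallPi


namespace HallPi

/-! ### The field of order q² over its subfield of order q. -/

section QuadraticExtension

variable {K : Type*} [Field K] {p a q : ℕ} [hp : Fact p.Prime] [CharP K p]

theorem card_units_of_sq [Finite K] (hK : Nat.card K = q ^ 2) :
    Nat.card Kˣ = (q - 1) * (q + 1) := by
  rw [Nat.card_units, hK, mul_comm, ← Nat.sq_sub_sq, one_pow]

/-- An element of the subfield of order `q` is a norm from the field of order `q²`. -/
theorem exists_pow_eq_of_pow_eq_self [Finite K] (hq : 1 < q) (hK : Nat.card K = q ^ 2) {x : K}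
    (hx0 : x ≠ 0) (hx : x ^ q = x) : ∃ c : K, c ^ q * c = x := by
  obtain ⟨g, hg⟩ := IsCyclic.exists_generator (α := Kˣ)
  obtain ⟨n, hn⟩ := (Submonoid.mem_powers_iff _ _).1 (mem_powers_iff_mem_zpowers.2 (hg (Units.mk0 x hx0)))
  have h1 : (Units.mk0 x hx0) ^ (q - 1) = 1 := by
    have h2 : (Units.mk0 x hx0) ^ (q - 1) * Units.mk0 x hx0 = Units.mk0 x hx0 := by
      rw [← pow_succ, Nat.sub_add_cancel hq.le]
      ext; simpa using hx
    exact mul_eq_right.1 h2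
  rw [← hn, ← pow_mul, ← orderOf_dvd_iff_pow_eq_one, orderOf_eq_card_of_forall_mem_zpowers hg,
    card_units_of_sq hK, mul_comm n] at h1
  obtain ⟨k, rfl⟩ := Nat.dvd_of_mul_dvd_mul_left (by omega) h1
  refine ⟨(g ^ k : Kˣ), ?_⟩
  have h3 : ((g ^ ((q + 1) * k) : Kˣ) : K) = x := by rw [hn]; rfl
  rw [← pow_succ, ← Units.val_pow_eq_pow_val, ← pow_mul, mul_comm, h3]

theorem exists_pow_ne_self [Finite K] (hq : 1 < q) (hK : Nat.card K = q ^ 2) :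
    ∃ x : K, x ^ q ≠ x := by
  obtain ⟨g, hg⟩ := IsCyclic.exists_generator (α := Kˣ)
  refine ⟨g, fun h => ?_⟩
  have h1 : g ^ (q - 1) = 1 := by
    have h2 : g ^ (q - 1) * g = g := by
      rw [← pow_succ, Nat.sub_add_cancel hq.le]
      ext; simpa using h
    exact mul_eq_right.1 h2
  rw [← orderOf_dvd_iff_pow_eq_one, orderOf_eq_card_of_forall_mem_zpowers hg,
    card_units_of_sq hK] at h1
  have h3 := Nat.le_of_dvd (by omega) h1
  nlinarith [Nat.sub_add_cancel hq.le]

variable (K p a) in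
/-- The fixed field of `x ↦ x ^ (p ^ a)`. -/
def fixedSubfield : Subfield K := (iterateFrobenius K p a).eqLocusField (RingHom.id K)

theorem mem_fixedSubfield {x : K} : x ∈ fixedSubfield K p a ↔ x ^ (p ^ a) = x := by
  rw [fixedSubfield, RingHom.mem_eqLocusField, iterateFrobenius_def, RingHom.id_apply]

theorem card_fixedSubfield [Finite K] (ha : 1 < p ^ a) (hK : Nat.card K = (p ^ a) ^ 2) :
    Nat.card (fixedSubfield K p a) = p ^ a := by
  set q := p ^ a with hq
  have h1 : Nat.card (fixedSubfield K p a)ˣ = q - 1 := by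
    have hinj : Function.Injective (Units.map (fixedSubfield K p a).subtype.toMonoidHom) :=
      Units.map_injective Subtype.val_injective
    have hr : (Units.map (fixedSubfield K p a).subtype.toMonoidHom).range =
        (powMonoidHom (q - 1) : Kˣ →* Kˣ).ker := by
      ext u
      have hu : u ∈ (powMonoidHom (q - 1) : Kˣ →* Kˣ).ker ↔ (u : K) ∈ fixedSubfield K p a := by
        rw [MonoidHom.mem_ker, powMonoidHom_apply, mem_fixedSubfield, ← hq,
          ← Units.val_pow_eq_pow_val, Units.val_inj, ← mul_eq_right (a := u ^ (q - 1)) (b := u),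
          ← pow_succ, Nat.sub_add_cancel ha.le]
      rw [hu]
      constructor
      · rintro ⟨v, rfl⟩
        exact v.1.2
      · intro h
        exact ⟨Units.mk0 ⟨u, h⟩ (fun h0 => u.ne_zero (congrArg Subtype.val h0)), by ext; rfl⟩
    rw [Nat.card_congr (MonoidHom.ofInjective hinj).toEquiv, hr, IsCyclic.card_powMonoidHom_ker,
      card_units_of_sq hK, Nat.gcd_eq_right (Dvd.intro _ rfl)]
  rw [Nat.card_units] at h1
  have : 0 < Nat.card (fixedSubfield K p a) := Nat.card_pos
  omega

end QuadraticExtension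

end HallPi


namespace HallPi

/-! ### Reduction of SU₂ to SL₂. -/

section EtaForms

open Matrix
open scoped MatrixGroups

/-- Conjugation by U carries SL₂(k) onto S. The group Γ need only contain the transported GL₂(k) up
to scalars, since scalars vanish under conjugation. -/
theorem exists_mulEquiv_of_conj {k K : Type*} [Field k] [Field K] (i : k →+* K)
    (U : GL (Fin 2) K) {S Γ : Subgroup (GL (Fin 2) K)}
    (hS : ∀ g, g ∈ S ↔ ∃ s : SL(2, k), U * GeneralLinearGroup.map i (toGL s) * U⁻¹ = g)
    (hΓ : ∀ u : GL (Fin 2) k, ∃ γ ∈ Γ, ∃ c : K,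
      γ.1 = c • (U * GeneralLinearGroup.map i u * U⁻¹).1) :
    ∃ ψ : SL(2, k) ≃* S, ∀ u : GL (Fin 2) k, ∃ γ ∈ Γ, ∀ s,
      γ * (ψ s : GL (Fin 2) K) * γ⁻¹ = ψ (conjGL u s) := by
  have htoGL : ∀ (u : GL (Fin 2) k) (s : SL(2, k)), toGL (conjGL u s) = u * toGL s * u⁻¹ :=
    fun u s => Units.ext (mat_conjGL u s)
  let f : SL(2, k) →* S :=
    { toFun := fun s => ⟨U * GeneralLinearGroup.map i (toGL s) * U⁻¹, (hS _).2 ⟨s, rfl⟩⟩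
      map_one' := by
        have : toGL (1 : SL(2, k)) = 1 := Units.ext (map_one mat)
        ext1
        change U * GeneralLinearGroup.map i (toGL 1) * U⁻¹ = 1
        rw [this, map_one, mul_one, mul_inv_cancel]
      map_mul' := fun s s' => by
        have : toGL (s * s') = toGL s * toGL s' := Units.ext (map_mul mat s s')
        ext1
        change U * GeneralLinearGroup.map i (toGL (s * s')) * U⁻¹ =
          U * GeneralLinearGroup.map i (toGL s) * U⁻¹ *
            (U * GeneralLinearGroup.map i (toGL s') * U⁻¹)
        rw [this, map_mul]
        group }
  have hf : Function.Bijective f := by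
    constructor
    · intro s s' h
      have h1 : U * GeneralLinearGroup.map i (toGL s) * U⁻¹ =
        U * GeneralLinearGroup.map i (toGL s') * U⁻¹ := congrArg Subtype.val h
      have h2 := mul_left_cancel (mul_right_cancel h1)
      apply mat_injective
      ext x y
      have h3 := congrArg Units.val h2
      exact i.injective (congrFun (congrFun h3 x) y)
    · rintro ⟨g, hg⟩
      obtain ⟨s, hs⟩ := (hS g).1 hg
      exact ⟨s, Subtype.ext hs⟩
  refine ⟨MulEquiv.ofBijective f hf, fun u => ?_⟩
  obtain ⟨γ, hγ, c, hc⟩ := hΓ u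
  refine ⟨γ, hγ, fun s => ?_⟩
  change γ * (U * GeneralLinearGroup.map i (toGL s) * U⁻¹) * γ⁻¹ =
    U * GeneralLinearGroup.map i (toGL (conjGL u s)) * U⁻¹
  rw [mul_inv_eq_iff_eq_mul]
  have hl : ∀ A : GL (Fin 2) K,
      (γ * A).1 = c • (U * GeneralLinearGroup.map i u * U⁻¹ * A).1 := fun A => by
    rw [Units.val_mul, hc, smul_mul_assoc]; rfl
  have hr : ∀ A : GL (Fin 2) K,
      (A * γ).1 = c • (A * (U * GeneralLinearGroup.map i u * U⁻¹)).1 := fun A => by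
    rw [Units.val_mul, hc, mul_smul_comm]; rfl
  apply Units.ext
  rw [hl, hr, htoGL, map_mul, map_mul, map_inv]
  congr 2
  group

theorem transpose_mul_alternating_mul {R : Type*} [CommRing R] (A : Matrix (Fin 2) (Fin 2) R) :
    Aᵀ * !![0, 1; -1, 0] * A = A.det • !![0, 1; -1, 0] := by
  ext i j
  fin_cases i <;> fin_cases j <;> simp [Matrix.mul_apply, Fin.sum_univ_two, det_fin_two] <;> ring

theorem eq_of_transpose_mul_alternating_mul {K : Type*} [Field K] {A B : Matrix (Fin 2) (Fin 2) K}
    {X : GL (Fin 2) K} (h : Aᵀ * !![0, 1; -1, 0] * X.1 = Bᵀ * !![0, 1; -1, 0] * X.1) : A = B := by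
  have hJ : IsUnit (!![0, 1; -1, 0] : Matrix (Fin 2) (Fin 2) K) := by
    rw [isUnit_iff_isUnit_det]; simp [det_fin_two]
  exact transpose_injective (hJ.mul_right_cancel (X.isUnit.mul_right_cancel h))

variable {K : Type*} [Field K] {p a : ℕ} [hp : Fact p.Prime] [CharP K p]

/-- In the basis given by U the Hermitian form has the alternating Gram matrix, up to the scalar d.
For determinant 1, comparison with the identity AᵀJA = (det A) J then says that X is fixed by
Frobenius. -/
theorem mem_unitaryGL_conj_iff {U : GL (Fin 2) K} {d : K} (hd : d ≠ 0)
    (hU : (U.1.map (iterateFrobenius K p a))ᵀ * U.1 = d • !![0, 1; -1, 0]) (X : GL (Fin 2) K) :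
    U * X * U⁻¹ ∈ unitaryGL 2 K p a ↔
      (X.1.map (iterateFrobenius K p a))ᵀ * !![0, 1; -1, 0] * X.1 = !![0, 1; -1, 0] := by
  set σ := iterateFrobenius K p a
  have hinv : (U.1.map σ)ᵀ * ((U⁻¹).1.map σ)ᵀ = 1 := by
    rw [← transpose_mul, ← Matrix.map_mul, ← Units.val_mul, inv_mul_cancel]; simp
  have hinv' : ((U⁻¹).1.map σ)ᵀ * (U.1.map σ)ᵀ = 1 := by
    rw [← transpose_mul, ← Matrix.map_mul, ← Units.val_mul, mul_inv_cancel]; simp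
  have hUU : (U⁻¹).1 * U.1 = 1 := by rw [← Units.val_mul, inv_mul_cancel]; rfl
  have hUU' : U.1 * (U⁻¹).1 = 1 := by rw [← Units.val_mul, mul_inv_cancel]; rfl
  change ((U * X * U⁻¹).1.map σ)ᵀ * (U * X * U⁻¹).1 = 1 ↔ _
  have h1 : ((U * X * U⁻¹).1.map σ)ᵀ * (U * X * U⁻¹).1 =
      ((U⁻¹).1.map σ)ᵀ * (d • ((X.1.map σ)ᵀ * !![0, 1; -1, 0] * X.1)) * (U⁻¹).1 := by
    rw [Units.val_mul, Units.val_mul, Matrix.map_mul, Matrix.map_mul, transpose_mul, transpose_mul]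
    have : d • ((X.1.map σ)ᵀ * !![0, 1; -1, 0] * X.1) =
        (X.1.map σ)ᵀ * ((U.1.map σ)ᵀ * U.1) * X.1 := by
      rw [hU, mul_smul_comm, smul_mul_assoc]
    rw [this]
    simp only [mul_assoc]
  rw [h1]
  constructor
  · intro h
    have h3 : (U.1.map σ)ᵀ * (((U⁻¹).1.map σ)ᵀ *
        (d • ((X.1.map σ)ᵀ * !![0, 1; -1, 0] * X.1)) * (U⁻¹).1) * U.1 =
          d • !![0, 1; -1, 0] := by rw [h, mul_one, hU]
    rw [← mul_assoc, ← mul_assoc, hinv, one_mul, mul_assoc, hUU, mul_one] at h3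
    exact smul_right_injective _ hd h3
  · intro h
    rw [h, ← hU, ← mul_assoc, hinv', one_mul, hUU']

/-- A change of basis taking the Hermitian form to a multiple of an alternating form defined over
the fixed field. -/
theorem exists_conj_alternating [Finite K] (hp2 : p ≠ 2) (hq : 1 < p ^ a)
    (hK : Nat.card K = (p ^ a) ^ 2) : ∃ (U : GL (Fin 2) K) (d : K), d ≠ 0 ∧
      (U.1.map (iterateFrobenius K p a))ᵀ * U.1 = d • !![0, 1; -1, 0] := by
  have h2 : (2 : K) ≠ 0 := by
    intro h
    have h4 : ((2 : ℕ) : K) = 0 := by exact_mod_cast h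
    rw [CharP.cast_eq_zero_iff K p] at h4
    exact hp2 ((Nat.prime_dvd_prime_iff_eq hp.out Nat.prime_two).1 h4)
  obtain ⟨c, hc⟩ := exists_pow_eq_of_pow_eq_self hq hK (x := -1) (neg_ne_zero.2 one_ne_zero)
    (((hp.out.eq_two_or_odd'.resolve_left hp2).pow).neg_one_pow)
  obtain ⟨x, hx⟩ := exists_pow_ne_self hq hK
  set σ := iterateFrobenius K p a with hσ
  have hσ' : ∀ y, σ y = y ^ (p ^ a) := fun y => iterateFrobenius_def p a y
  have hσσ : ∀ y, σ (σ y) = y := by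
    intro y
    have := Fintype.ofFinite K
    rw [hσ', hσ', ← pow_mul, ← sq, ← hK, Nat.card_eq_fintype_card, FiniteField.pow_card]
  set t := x - σ x with ht
  have ht0 : t ≠ 0 := by
    rw [ht, sub_ne_zero, hσ']; exact hx.symm
  have hσt : σ t = -t := by rw [ht, map_sub, hσσ]; ring
  have hσc : σ c * c = -1 := by rw [hσ']; exact hc
  have hc0 : c ≠ 0 := by
    rintro rfl
    rw [mul_zero] at hσc
    exact one_ne_zero (neg_eq_zero.1 hσc.symm)
  -- The columns (1, c) and t(1, -c) are isotropic because c^(q+1) = -1; the factor t, with t^q =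
  -- -t, makes their two pairings 2t and -2t.
  refine ⟨GeneralLinearGroup.mkOfDetNeZero !![1, t; c, -(t * c)] ?_, 2 * t, mul_ne_zero h2 ht0, ?_⟩
  · rw [det_fin_two_of, show 1 * -(t * c) - t * c = -(2 * t * c) by ring]
    exact neg_ne_zero.2 (mul_ne_zero (mul_ne_zero h2 ht0) hc0)
  · change ((!![1, t; c, -(t * c)]).map σ)ᵀ * !![1, t; c, -(t * c)] = _
    ext i j
    fin_cases i <;> fin_cases j <;>
      simp [Matrix.mul_apply, Fin.sum_univ_two, hσt]
    · linear_combination hσc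
    · linear_combination -t * hσc
    · linear_combination t * hσc
    · linear_combination -t ^ 2 * hσc

theorem mem_SLEta_iff {n : ℕ} {η : ℤˣ} {g : GL (Fin n) K} :
    g ∈ SLEta n K p a η ↔ g ∈ GLEta n K p a η ∧ g.1.det = 1 := by
  rw [SLEta, Subgroup.mem_inf, MonoidHom.mem_ker, ← Units.val_inj]
  rfl

/-- The groups `SL₂` and `SU₂` are isomorphic, compatibly with the actions of `PGL₂` and `PGU₂`. -/
theorem exists_mulEquiv_SLEta {K : Type*} [Field K] [CharP K p] (hp2 : p ≠ 2) (hq : 1 < p ^ a)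
    (η : ℤˣ) (hK : Nat.card K = if η = 1 then p ^ a else (p ^ a) ^ 2) :
    ∃ k : Subfield K, Nat.card k = p ^ a ∧ ∃ ψ : SL(2, k) ≃* SLEta 2 K p a η,
      ∀ u : GL (Fin 2) k, ∃ γ ∈ GLEta 2 K p a η, ∀ s,
        γ * (ψ s : GL (Fin 2) K) * γ⁻¹ = ψ (conjGL u s) := by
  split_ifs at hK with hη
  · refine ⟨⊤, ?_, exists_mulEquiv_of_conj (⊤ : Subfield K).subtype 1 ?_ ?_⟩
    · rw [← hK]; exact Nat.card_congr Subfield.topEquiv.toEquiv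
    · intro g
      rw [mem_SLEta_iff, GLEta, if_pos hη]
      constructor
      · rintro ⟨-, hg⟩
        refine ⟨⟨g.1.map Subfield.topEquiv.symm, ?_⟩, ?_⟩
        · have := RingHom.map_det (Subfield.topEquiv (K := K)).symm.toRingHom g.1
          rw [hg, map_one] at this
          exact this.symm
        · rw [one_mul, inv_one, mul_one]
          exact Units.ext rfl
      · rintro ⟨s, rfl⟩
        refine ⟨trivial, ?_⟩
        rw [one_mul, inv_one, mul_one]
        have := RingHom.map_det (⊤ : Subfield K).subtype (mat s)
        rw [det_mat, map_one] at this
        exact this.symm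
    · intro u
      refine ⟨1 * GeneralLinearGroup.map (⊤ : Subfield K).subtype u * 1⁻¹, ?_, 1, ?_⟩
      · rw [GLEta, if_pos hη]; trivial
      · rw [one_smul]
  · have hfin : Finite K := Nat.finite_of_card_ne_zero (by rw [hK]; positivity)
    obtain ⟨U, d, hd, hU⟩ := exists_conj_alternating hp2 hq hK
    set σ := iterateFrobenius K p a with hσ
    have hmem : ∀ x : K, x ∈ fixedSubfield K p a ↔ σ x = x := fun x => Iff.rfl
    have hfix : ∀ A : Matrix (Fin 2) (Fin 2) (fixedSubfield K p a),
        (A.map (fixedSubfield K p a).subtype).map σ = A.map (fixedSubfield K p a).subtype := by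
      intro A
      ext x y
      exact (A x y).2
    refine ⟨fixedSubfield K p a, card_fixedSubfield hq hK,
      exists_mulEquiv_of_conj (fixedSubfield K p a).subtype U ?_ ?_⟩
    · intro g
      rw [mem_SLEta_iff, GLEta, if_neg hη]
      obtain ⟨X, rfl⟩ : ∃ X, g = U * X * U⁻¹ := ⟨U⁻¹ * g * U, by group⟩
      have hdet : (U * X * U⁻¹).1.det = X.1.det := by
        rw [Units.val_mul, Units.val_mul, det_mul_right_comm, ← Units.val_mul, mul_inv_cancel,
          Units.val_one, one_mul]
      rw [mem_unitaryGL_conj_iff hd hU, hdet]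
      constructor
      · rintro ⟨h1, h3⟩
        have h4 := transpose_mul_alternating_mul X.1
        rw [h3, one_smul] at h4
        have h5 : X.1.map σ = X.1 := eq_of_transpose_mul_alternating_mul (h1.trans h4.symm)
        have h6 : ∀ x y, X.1 x y ∈ fixedSubfield K p a := fun x y => by
          rw [hmem, ← Matrix.map_apply (f := σ) (M := X.1), h5]
        set Y : Matrix (Fin 2) (Fin 2) (fixedSubfield K p a) :=
          Matrix.of fun x y => ⟨X.1 x y, h6 x y⟩ with hY
        have hYd : Y.det = 1 :=
          Subtype.ext ((RingHom.map_det (fixedSubfield K p a).subtype Y).trans h3)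
        have hYX : GeneralLinearGroup.map (fixedSubfield K p a).subtype (toGL ⟨Y, hYd⟩) = X :=
          Units.ext rfl
        exact ⟨⟨Y, hYd⟩, by rw [hYX]⟩
      · rintro ⟨s, hs⟩
        have hX : GeneralLinearGroup.map (fixedSubfield K p a).subtype (toGL s) = X :=
          mul_left_cancel (mul_right_cancel hs)
        have hXv : X.1 = (mat s).map (fixedSubfield K p a).subtype := by rw [← hX]; rfl
        have h3 : X.1.det = 1 := by
          have := RingHom.map_det (fixedSubfield K p a).subtype (mat s)
          rw [det_mat, map_one] at this
          rw [hXv]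
          exact this.symm
        refine ⟨?_, h3⟩
        have h4 := transpose_mul_alternating_mul X.1
        rw [h3, one_smul] at h4
        have h5 : X.1.map σ = X.1 := by rw [hXv]; exact hfix _
        rw [h5, h4]
    · intro u
      set V := GeneralLinearGroup.map (fixedSubfield K p a).subtype u with hV
      have hVσ : V.1.map σ = V.1 := hfix u.1
      have hVd : σ V.1.det = V.1.det := by
        have h1 := RingHom.map_det σ V.1
        rw [RingHom.mapMatrix_apply, hVσ] at h1
        exact h1
      have hd0 : V.1.det ≠ 0 := det_ne_zero V
      -- A matrix V over the fixed field multiplies the form by det V. Scaling V by c with c^(q+1) =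
      -- (det V)⁻¹ compensates this and gives a unitary matrix with the same conjugation action.
      obtain ⟨c, hc⟩ := exists_pow_eq_of_pow_eq_self hq hK (x := V.1.det⁻¹) (inv_ne_zero hd0)
        (by rw [inv_pow, ← iterateFrobenius_def, ← hσ, hVd])
      have hc0 : c ≠ 0 := by
        rintro rfl
        rw [mul_zero] at hc
        exact inv_ne_zero hd0 hc.symm
      have hcd : (c • V.1).det ≠ 0 := by
        rw [det_smul, Fintype.card_fin]
        exact mul_ne_zero (pow_ne_zero _ hc0) hd0
      set W := GeneralLinearGroup.mkOfDetNeZero (c • V.1) hcd with hW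
      have hWv : W.1 = c • V.1 := rfl
      refine ⟨U * W * U⁻¹, ?_, c, ?_⟩
      · rw [GLEta, if_neg hη, mem_unitaryGL_conj_iff hd hU]
        have h1 : W.1.map σ = c ^ (p ^ a) • V.1 := by
          ext x y
          have h3 : σ (V.1 x y) = V.1 x y := congrFun (congrFun hVσ x) y
          change σ (c * V.1 x y) = c ^ (p ^ a) * V.1 x y
          rw [map_mul, h3, hσ, iterateFrobenius_def]
        rw [h1, hWv, transpose_smul, smul_mul_assoc, smul_mul_smul_comm,
          transpose_mul_alternating_mul, hc, smul_smul, inv_mul_cancel₀ hd0, one_smul]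
      · rw [Units.val_mul, Units.val_mul, hWv, mul_smul_comm, smul_mul_assoc]
        rfl

end EtaForms

end HallPi


namespace HallPi

/-! ### Transport along group isomorphisms. -/

section Transport

variable {G G' : Type*} [Group G] [Group G'] (φ : G ≃* G')

theorem map_symm_map (H : Subgroup G) :
    (H.map φ.toMonoidHom).map φ.symm.toMonoidHom = H := by
  have : φ.symm.toMonoidHom.comp φ.toMonoidHom = MonoidHom.id G := by ext; simp
  rw [Subgroup.map_map, this, Subgroup.map_id]

theorem map_map_symm (H : Subgroup G') :
    (H.map φ.symm.toMonoidHom).map φ.toMonoidHom = H :=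
  map_symm_map φ.symm H

theorem card_map_mulEquiv (H : Subgroup G) : Nat.card (H.map φ.toMonoidHom) = Nat.card H :=
  (Nat.card_congr (φ.subgroupMap H).toEquiv).symm

theorem isPiSubgroup_map_iff {π : Set ℕ} (H : Subgroup G) :
    IsPiSubgroup π (H.map φ.toMonoidHom) ↔ IsPiSubgroup π H := by
  rw [IsPiSubgroup, IsPiSubgroup, card_map_mulEquiv]

theorem isHall_map_iff {π : Set ℕ} (H : Subgroup G) :
    IsHall π (H.map φ.toMonoidHom) ↔ IsHall π H := by
  rw [IsHall, IsHall, isPiSubgroup_map_iff, H.index_map_of_bijective φ.bijective]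

theorem ConjSub.map {H K : Subgroup G} (h : ConjSub H K) :
    ConjSub (H.map φ.toMonoidHom) (K.map φ.toMonoidHom) := by
  obtain ⟨g, rfl⟩ := h
  refine ⟨φ g, ?_⟩
  rw [Subgroup.map_map, Subgroup.map_map]
  congr 1
  ext x
  simp

theorem conjSub_map_iff {H K : Subgroup G} :
    ConjSub (H.map φ.toMonoidHom) (K.map φ.toMonoidHom) ↔ ConjSub H K := by
  refine ⟨fun h => ?_, ConjSub.map φ⟩
  have := h.map φ.symm
  rwa [map_symm_map, map_symm_map] at this

theorem center_map : (Subgroup.center G).map φ.toMonoidHom = Subgroup.center G' := by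
  ext x
  obtain ⟨y, rfl⟩ := φ.surjective x
  rw [Subgroup.mem_center_iff]
  constructor
  · rintro ⟨z, hz, hzy⟩ g
    obtain ⟨g', rfl⟩ := φ.surjective g
    rw [← φ.injective hzy, ← map_mul, ← map_mul, Subgroup.mem_center_iff.1 hz g']
  · intro h
    refine ⟨y, Subgroup.mem_center_iff.2 fun g => φ.injective ?_, rfl⟩
    rw [map_mul, map_mul, h]

/-- The isomorphism of central quotients induced by an isomorphism. -/
def centralQuotientCongr : G ⧸ Subgroup.center G ≃* G' ⧸ Subgroup.center G' :=
  QuotientGroup.congr _ _ φ (center_map φ)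

theorem proj_map (H : Subgroup G) :
    proj (H.map φ.toMonoidHom) = (proj H).map (centralQuotientCongr φ).toMonoidHom := by
  rw [proj, proj, Subgroup.map_map, Subgroup.map_map]
  rfl

theorem projIso_map_iff {X : Type*} [Group X] (H : Subgroup G) :
    ProjIso X (H.map φ.toMonoidHom) ↔ ProjIso X H := by
  rw [ProjIso, ProjIso, proj_map]
  exact ⟨fun ⟨f⟩ => ⟨((centralQuotientCongr φ).subgroupMap _).trans f⟩,
    fun ⟨f⟩ => ⟨((centralQuotientCongr φ).subgroupMap _).symm.trans f⟩⟩

theorem HallInDihedral.map {π : Set ℕ} {q : ℕ} {H : Subgroup G} (h : HallInDihedral π q H) :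
    HallInDihedral π q (H.map φ.toMonoidHom) := by
  obtain ⟨D, ⟨f⟩, hle, hcard, hindex⟩ := h
  set ψ := centralQuotientCongr φ
  rw [HallInDihedral, proj_map]
  have hle' : (proj H).map ψ.toMonoidHom ≤ D.map ψ.toMonoidHom := Subgroup.map_mono hle
  refine ⟨D.map ψ.toMonoidHom, ⟨(ψ.subgroupMap D).symm.trans f⟩, hle', ?_, ?_⟩
  · rw [IsPiSubgroup, Nat.card_congr (Subgroup.subgroupOfEquivOfLe hle').toEquiv,
      card_map_mulEquiv, ← Nat.card_congr (Subgroup.subgroupOfEquivOfLe hle).toEquiv]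
    exact hcard
  · have hi : (((proj H).map ψ.toMonoidHom).subgroupOf (D.map ψ.toMonoidHom)).index =
        ((proj H).subgroupOf D).index :=
      Subgroup.relIndex_map_map_of_injective _ _ ψ.injective
    rwa [hi]

theorem hallInDihedral_map_iff {π : Set ℕ} {q : ℕ} {H : Subgroup G} :
    HallInDihedral π q (H.map φ.toMonoidHom) ↔ HallInDihedral π q H := by
  refine ⟨fun h => ?_, HallInDihedral.map φ⟩
  have := h.map φ.symm
  rwa [map_symm_map] at this

theorem primesOf_eq (φ : G ≃* G') : primesOf G = primesOf G' := by
  rw [primesOf, primesOf, Nat.card_congr φ.toEquiv]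

end Transport

/-! ### Two SL₂-classes fused by GL₂, transported to G. -/

section Interchange

open Matrix
open scoped MatrixGroups

theorem SL2_card_center {F : Type*} [Field F] (h2 : (2 : F) ≠ 0) :
    Nat.card (Subgroup.center SL(2, F)) = 2 := by
  have h : (Subgroup.center SL(2, F) : Set SL(2, F)) = {1, -1} := by
    ext g
    exact SL2_mem_center_iff
  change Nat.card (Subgroup.center SL(2, F) : Set SL(2, F)) = 2
  rw [h, Nat.card_coe_set_eq, Set.ncard_pair (SL2_one_ne_neg_one h2)]

theorem twoClassesInterchanged_of_twoGLClasses {F : Type*} [Field F] {G L : Type*} [Group G]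
    [Group L] {π : Set ℕ} {T : Subgroup G → Prop} {T' : Subgroup SL(2, F) → Prop} {ι : G →* L}
    {Γ : Subgroup L} (φ : G ≃* SL(2, F))
    (hT : ∀ H : Subgroup G, (IsHall π H ∧ T H) ↔ T' (H.map φ.toMonoidHom))
    (hΓ : ∀ u : GL (Fin 2) F, ∃ γ ∈ Γ, ∀ g, γ * ι g * γ⁻¹ = ι (φ.symm (conjGL u (φ g))))
    (h : TwoGLClasses T') : TwoClassesInterchanged π T ι Γ := by
  obtain ⟨H₁, H₂, h1, h2, hn, hiff, u, hu, hu'⟩ := h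
  have hmap : ∀ {H : Subgroup SL(2, F)}, T' H → IsHall π (H.map φ.symm.toMonoidHom) ∧
      T (H.map φ.symm.toMonoidHom) := fun {H} hH => (hT _).2 (by rwa [map_map_symm])
  have hc : ∀ (H : Subgroup SL(2, F)) (K : Subgroup G),
      ConjSub H (K.map φ.toMonoidHom) ↔ ConjSub (H.map φ.symm.toMonoidHom) K := fun H K => by
    rw [← conjSub_map_iff φ, map_map_symm]
  obtain ⟨γ, hγ, hγι⟩ := hΓ u
  have hι : ∀ H : Subgroup SL(2, F),
      ((H.map φ.symm.toMonoidHom).map ι).map (MulAut.conj γ).toMonoidHom =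
        ((H.map (conjGL u).toMonoidHom).map φ.symm.toMonoidHom).map ι := by
    intro H
    simp only [Subgroup.map_map]
    congr 1
    ext1 x
    have := hγι (φ.symm x)
    rw [φ.apply_symm_apply] at this
    exact this
  refine ⟨H₁.map φ.symm.toMonoidHom, H₂.map φ.symm.toMonoidHom, hmap h1, hmap h2, ?_, ?_, γ, hγ,
    ⟨_, ConjSub.refl _, ?_⟩, ⟨_, hu'.map φ.symm, hι H₂⟩⟩
  · rwa [conjSub_map_iff]
  · intro K
    rw [hT, hiff, hc, hc]
  · rw [hι, hu]

end Interchange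

end HallPi


/-! ### Assembly of the theorem. -/

theorem mainTheorem9
    (π : Set ℕ) (hπ : ∀ r ∈ π, r.Prime) (h2 : 2 ∈ π) (h3 : 3 ∈ π)
    (p a q : ℕ) [Fact p.Prime] (hp : p ≠ 2) (hpπ : p ∉ π) (hq : q = p ^ a)
    (η : ℤˣ) (K : Type*) [Field K] [CharP K p]
    (hK : Nat.card K = if η = 1 then q else q ^ 2)
    (G : Type*) [Group G] (e : G ≃* HallPi.SLEta 2 K p a η) :
    -- (A): the possible types of Hall subgroups
    (∀ H : Subgroup G, HallPi.IsHall π H →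
      (HallPi.CondA π G q ∧ HallPi.HallInDihedral π q H) ∨
      (HallPi.CondB π G q ∧ HallPi.ProjIso (alternatingGroup (Fin 4)) H) ∨
      (HallPi.CondC π G q ∧ HallPi.ProjIso (Equiv.Perm (Fin 4)) H) ∨
      (HallPi.CondD π G q ∧ HallPi.ProjIso (alternatingGroup (Fin 5)) H)) ∧
    -- (A): the conjugacy classes of each type
    (HallPi.CondA π G q →
      HallPi.AllConjugate π (fun H : Subgroup G => HallPi.HallInDihedral π q H)) ∧
    (HallPi.CondB π G q →
      HallPi.AllConjugate π
        (fun H : Subgroup G => HallPi.ProjIso (alternatingGroup (Fin 4)) H)) ∧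
    (HallPi.CondC π G q →
      HallPi.TwoClassesInterchanged π
        (fun H : Subgroup G => HallPi.ProjIso (Equiv.Perm (Fin 4)) H)
        ((HallPi.SLEta 2 K p a η).subtype.comp e.toMonoidHom) (HallPi.GLEta 2 K p a η)) ∧
    (HallPi.CondD π G q →
      HallPi.TwoClassesInterchanged π
        (fun H : Subgroup G => HallPi.ProjIso (alternatingGroup (Fin 5)) H)
        ((HallPi.SLEta 2 K p a η).subtype.comp e.toMonoidHom) (HallPi.GLEta 2 K p a η)) ∧
    -- (B)
    (HallPi.CondA π G q ∨ HallPi.CondB π G q ∨ HallPi.CondC π G q ∨ HallPi.CondD π G q →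
      HallPi.SatisfiesE π G) ∧
    -- (C)
    (HallPi.SatisfiesE π G →
      HallPi.numHallClasses π G = 1 ∨ HallPi.numHallClasses π G = 2 ∨
        HallPi.numHallClasses π G = 3) ∧
    -- (D)
    (∀ H : Subgroup G, HallPi.IsHall π H →
      ∃ L : Subgroup G, HallPi.IsPiSubgroup π L ∧
        ∀ M : Subgroup G, M ≤ H → ¬ HallPi.ConjSub L M) ∧
    ¬ HallPi.SatisfiesD π G ∧
    -- (E)
    (∀ P : Subgroup (G ⧸ Subgroup.center G), HallPi.IsHall π P →
      ∃ H : Subgroup G, HallPi.IsHall π H ∧ HallPi.proj H = P) ∧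
    (∀ P : Subgroup (G ⧸ Subgroup.center G), HallPi.IsHall π P →
      HallPi.IsHall π (P.comap (QuotientGroup.mk' (Subgroup.center G)))) := by
  obtain rfl := hq
  -- For a = 0 the cardinality hypothesis would make K a one-element field.
  have hqlt : 1 < p ^ a := by
    rcases Nat.eq_zero_or_pos a with rfl | ha
    · rw [pow_zero, one_pow, ite_self, Nat.card_eq_one_iff_unique] at hK
      exact absurd hK.1 (not_subsingleton K)
    · exact Nat.one_lt_pow ha.ne' (Fact.out : p.Prime).one_lt
  obtain ⟨k, hk, ψ, hψ⟩ := HallPi.exists_mulEquiv_SLEta hp hqlt η hK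
  rw [← hk] at hqlt ⊢
  have hfin : Finite k := Nat.finite_of_card_ne_zero (by omega)
  have hchar : CharP k p := (k.subtype.charP_iff k.subtype.injective p).2 inferInstance
  obtain ⟨h, m, hhm, hh, hm⟩ := HallPi.exists_eq_mul_of_primeFactors π
    (n := Nat.card k ^ 2 - 1) (by have := Nat.one_lt_pow two_ne_zero hqlt; omega)
  have S : HallPi.HallSetup π k p h m := ⟨h2, h3, hpπ, hhm, hh, hm⟩
  let φ : G ≃* Matrix.SpecialLinearGroup (Fin 2) k := e.trans ψ.symm
  have hΓ : ∀ u : Matrix.GeneralLinearGroup (Fin 2) k, ∃ γ ∈ HallPi.GLEta 2 K p a η, ∀ g : G,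
      γ * (HallPi.SLEta 2 K p a η).subtype.comp e.toMonoidHom g * γ⁻¹ =
        (HallPi.SLEta 2 K p a η).subtype.comp e.toMonoidHom
          (φ.symm (HallPi.conjGL u (φ g))) := by
    intro u
    obtain ⟨γ, hγ, hs⟩ := hψ u
    refine ⟨γ, hγ, fun g => ?_⟩
    have h1 := hs (φ g)
    have h4 : ψ (φ g) = e g := ψ.apply_symm_apply (e g)
    have h5 : e (φ.symm (HallPi.conjGL u (φ g))) = ψ (HallPi.conjGL u (φ g)) :=
      e.apply_symm_apply _
    rw [h4, ← h5] at h1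
    exact h1
  have hGfin : Finite G := Finite.of_equiv _ φ.symm.toEquiv
  have hHall : ∀ H : Subgroup G, HallPi.IsHall π H ↔ Nat.card (H.map φ.toMonoidHom) = h :=
    fun H => by rw [← HallPi.isHall_map_iff φ, S.isHall_iff]
  have hA : HallPi.CondA π G (Nat.card k) ↔ h ∣ 2 * HallPi.qSubEps (Nat.card k) := by
    rw [← S.condA_iff, HallPi.CondA, HallPi.CondA, HallPi.primesOf_eq φ]
  have hB : HallPi.CondB π G (Nat.card k) ↔ h = 24 := by
    rw [← S.condB_iff, HallPi.CondB, HallPi.CondB, HallPi.primesOf_eq φ]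
  have hC : HallPi.CondC π G (Nat.card k) ↔ h = 48 := by
    rw [← S.condC_iff, HallPi.CondC, HallPi.CondC, HallPi.primesOf_eq φ]
  have hD : HallPi.CondD π G (Nat.card k) ↔ h = 120 := by
    rw [← S.condD_iff, HallPi.CondD, HallPi.CondD, HallPi.primesOf_eq φ]
  have hE : (∃ H' : Subgroup (Matrix.SpecialLinearGroup (Fin 2) k), Nat.card H' = h) →
      HallPi.SatisfiesE π G := by
    rintro ⟨H', hH'⟩
    exact ⟨H'.map φ.symm.toMonoidHom, (hHall _).2 (by rwa [HallPi.map_map_symm])⟩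
  have hcenter : Nat.card (Subgroup.center G) = 2 := by
    rw [← HallPi.card_map_mulEquiv φ, HallPi.center_map, HallPi.SL2_card_center S.two_ne]
  have hND : ∀ H : Subgroup G, HallPi.IsHall π H → ∃ L : Subgroup G, HallPi.IsPiSubgroup π L ∧
      ∀ M : Subgroup G, M ≤ H → ¬ HallPi.ConjSub L M := by
    intro H hH
    obtain ⟨L, hL, hn⟩ := S.exists_not_conj ((hHall H).1 hH)
    refine ⟨L.map φ.symm.toMonoidHom, (HallPi.isPiSubgroup_map_iff φ.symm L).2 hL,
      fun M hM hc => hn _ (Subgroup.map_mono hM) ?_⟩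
    have := hc.map φ
    rwa [HallPi.map_map_symm] at this
  refine ⟨?_, ?_, ?_, ?_, ?_, ?_, ?_, hND, HallPi.not_satisfiesD hND, ?_, ?_⟩
  · intro H hH
    rw [hHall] at hH
    rw [hA, hB, hC, hD, ← HallPi.hallInDihedral_map_iff φ, ← HallPi.projIso_map_iff φ,
      ← HallPi.projIso_map_iff φ, ← HallPi.projIso_map_iff φ]
    exact (S.hall_alternatives hH).imp
      (fun ⟨⟨_, hI⟩, hd⟩ => ⟨hd, S.hallInDihedral_of_isDihedralAt hI hH⟩) id
  · intro _ H₁ H₂ h₁ h₁' h₂ h₂'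
    rw [hHall] at h₁ h₂
    rw [← HallPi.hallInDihedral_map_iff φ] at h₁' h₂'
    obtain ⟨I₁, hI₁⟩ := S.exists_isDihedralAt_of_hallInDihedral h₁ h₁'
    obtain ⟨I₂, hI₂⟩ := S.exists_isDihedralAt_of_hallInDihedral h₂ h₂'
    exact (HallPi.conjSub_map_iff φ).1 (S.conjSub_of_isDihedralAt hI₁ hI₂ h₁ h₂)
  · intro hc H₁ H₂ h₁ h₁' h₂ h₂'
    obtain rfl := hB.1 hc
    rw [hHall] at h₁ h₂
    rw [← HallPi.projIso_map_iff φ] at h₁' h₂'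
    exact (HallPi.conjSub_map_iff φ).1
      (S.conjSub_of_projIso_alternatingGroup_four h₁ h₁' h₂ h₂')
  · intro hc
    obtain rfl := hC.1 hc
    exact HallPi.twoClassesInterchanged_of_twoGLClasses φ
      (fun H => by rw [hHall, HallPi.projIso_map_iff]) hΓ S.twoGLClasses_perm_four
  · intro hc
    obtain rfl := hD.1 hc
    exact HallPi.twoClassesInterchanged_of_twoGLClasses φ
      (fun H => by rw [hHall, HallPi.projIso_map_iff]) hΓ S.twoGLClasses_alternatingGroup_five
  · rintro (hc | hc | hc | hc)
    · exact hE (S.exists_card_eq_of_dvd (hA.1 hc))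
    · obtain rfl := hB.1 hc
      obtain ⟨H, hH, -⟩ := S.exists_projIso_alternatingGroup_four
      exact hE ⟨H, hH⟩
    · obtain rfl := hC.1 hc
      obtain ⟨H, -, hH, -⟩ := S.twoGLClasses_perm_four
      exact hE ⟨H, hH.1⟩
    · obtain rfl := hD.1 hc
      obtain ⟨H, -, hH, -⟩ := S.twoGLClasses_alternatingGroup_five
      exact hE ⟨H, hH.1⟩
  · intro hex
    obtain ⟨K₁, K₂, K₃, hK'⟩ := S.exists_three
    have hc : ∀ (L : Subgroup (Matrix.SpecialLinearGroup (Fin 2) k)) (H : Subgroup G),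
        HallPi.ConjSub L (H.map φ.toMonoidHom) →
          HallPi.ConjSub (L.map φ.symm.toMonoidHom) H := fun L H hL => by
      have := hL.map φ.symm
      rwa [HallPi.map_symm_map] at this
    exact HallPi.numHallClasses_mem_of_three hex (K₁.map φ.symm.toMonoidHom)
      (K₂.map φ.symm.toMonoidHom) (K₃.map φ.symm.toMonoidHom) fun H hH =>
        (hK' _ ((hHall H).1 hH)).imp (hc K₁ H) (Or.imp (hc K₂ H) (hc K₃ H))
  · intro P hP
    exact ⟨_, HallPi.isHall_comap_of_card_center h2 hcenter hP,
      Subgroup.map_comap_eq_self_of_surjective (QuotientGroup.mk'_surjective _) P⟩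
  · exact fun P hP => HallPi.isHall_comap_of_card_center h2 hcenter hP
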